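/- **Sequential input.** Fix a tree type: each node is one of a set of cases, a case $c$ storing a value (or none) and a fixed number $\operatorname{ar}(c)$ of children; and a fixed set of operations, operation $o$ taking an argument of a non-node type (or none) and $k_o\ge 1$ nodes and returning a node. Each operation is given by a purely functional body: deterministic code that may read nodes it knows (learning the case, the value and the children), call operations on known nodes (adding the result to the known nodes), construct nodes, and finally must return a constructed node or the contents of a node it has read; it cannot return the result of a call directly. Assume that, under call-by-value evaluation on immutable finite trees, every operation terminates on all arguments. (Affine use of nodes is not required.) **Transformed structure.** Nodes become memory cells. A cell contains either an immediate node (a case with its value and child cells) or a deferred node (an operation with its argument and its node cells, or a built-in snapshot of a cell), and it carries a mark "finalized". Cells support the primitives LLX and SCX. $\mathrm{LLX}(r)$ reads $r$ together with its mark; it may fail, but only if $r$ was changed by an SCX between the start and the end of the LLX. SCX atomically writes one cell of its read set, optionally finalizing it, if no cell of the read set has changed since it was read by LLX, and fails otherwise. - *apply.* The body of an operation is run on cells, every read of a node being replaced by readStrict, and every call by the allocation of a new deferred node. - *readStrict($r$)* performs $\mathrm{LLX}(r)$. If it fails, the current attempt restarts. If $r$ is immediate, its contents are returned, and $r$ joins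 the read set unless it is finalized. If $r$ is deferred and not finalized, $r$ is forced and then read again. If $r$ is deferred and finalized, the current work is abandoned and the caller retries. - *force($r$)*, called for the deferred contents $d$ that were read in $r$, starts a new read set and performs $\mathrm{LLX}(r)$. If $r$ no longer contains $d$ or is finalized, force is abandoned and its caller retries its own attempt. Otherwise $d$ is applied and the result is written to $r$ by SCX; if the LLX or the SCX fails, force($r$) restarts. - *Snapshot.* Applying a snapshot of $l$ reads $l$ by readStrict, returns its contents if $l$ is finalized, and otherwise returns them with each child $t$ (read by LLX, without forcing) replaced by a new deferred snapshot of $t$, unless $t$ is a snapshot node or is immediate and finalized. The SCX of a snapshot finalizes the written cell. **Processes.** Finitely many asynchronous processes share the cells and a root pointer, initially the root of an immediate finite tree. Each process repeatedly invokes operations: *update* (read the root $r$, construct a deferred node from an operation, an argument, and any mixture of $r$ and nodes the process holds, replace the root by it with a CAS, and retry if the CAS fails); *snapshot* (the same with a deferred snapshot of $r$, which the process then holds); and *read* (readStrict of the root or of a node it holds, after which it holds the children). Between its operations a process may also construct immediate or deferred nodes from nodes it holds. **Theorem.** This concurrent structure is lock-free: under an arbitrary scheduler, a process with a pending operation is never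 blocked (it always has an enabled step), and in every infinite execution in which infinitely many steps belong to operations (update, snapshot, read), infinitely many operations complete. -/

import Mathlib

/-! Trees built by the lazy copy-on-write transformation, run by asynchronous processes on cells
that support `LLX`/`SCX`. -/

universe u v

namespace LazyCow

/-! ### Sequential input of the transformation -/

/-- A tree type and its fixed set of operations.  A node is a case `c` with a value of type `Val c`
(the element type, or a one-point type if the case stores no value) and `arity c` children.
Operation `o` takes an argument of the non-node type `Arg o` (a one-point type if there is none)
and `opArity o ≥ 1` nodes. -/
structure Signature where
  Case : Type u
  Val : Case → Type u
  arity : Case → ℕ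
  Op : Type u
  Arg : Op → Type u
  opArity : Op → ℕ
  opArity_pos : ∀ o, 0 < opArity o

/-- What the body of an operation does next, when it knows `m` nodes, addressed as `Fin m`, and has
control states `St`.  `read` matches on a node: the body learns its case and value and from then on
knows its children too.  `call` calls an operation, and `mk` constructs a node; either adds the
resulting node to the known ones.  `ret` returns a constructed node (returning a node that was
already read is returning its case, value and children).  There is no way to mutate state, and no
way to return the result of a call directly, i.e. no call in tail position. -/
inductive Act (S : Signature.{u}) (St : ℕ → Type u) (m : ℕ) : Type u
  | read (x : Fin m) (k : (c : S.Case) → S.Val c → St (m + S.arity c))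
  | call (o : S.Op) (a : S.Arg o) (xs : Fin (S.opArity o) → Fin m) (k : St (m + 1))
  | mk (c : S.Case) (w : S.Val c) (xs : Fin (S.arity c) → Fin m) (k : St (m + 1))
  | ret (c : S.Case) (w : S.Val c) (xs : Fin (S.arity c) → Fin m)

/-- A purely functional body of operation `o`: deterministic code whose control state depends only
on the argument and on what it has read.  Loops and auxiliary functions that read arbitrarily many
descendants are allowed. -/
structure OpDef (S : Signature.{u}) (o : S.Op) where
  St : ℕ → Type u
  init : S.Arg o → St (S.opArity o)
  act : {m : ℕ} → St m → Act S St m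

/-- A sequential definition of all operations of the tree type. -/
structure Program (S : Signature.{u}) where
  opDef : (o : S.Op) → OpDef S o

/-- Sequential (immutable) trees. -/
inductive Tree (S : Signature.{u}) : Type u
  | node (c : S.Case) (w : S.Val c) (children : Fin (S.arity c) → Tree S) : Tree S

/-- Sequential call-by-value evaluation: `Eval Pr o s ts t` says that the body of `o`, from control
state `s` and knowing the trees `ts`, terminates and returns `t`. -/
inductive Eval {S : Signature.{u}} (Pr : Program S) :
    (o : S.Op) → {m : ℕ} → (Pr.opDef o).St m → (Fin m → Tree S) → Tree S → Prop
  | read {o : S.Op} {m : ℕ} {s : (Pr.opDef o).St m} {ts : Fin m → Tree S} {t : Tree S} {x : Fin m}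
      {k : (c : S.Case) → S.Val c → (Pr.opDef o).St (m + S.arity c)}
      {c : S.Case} {w : S.Val c} {cs : Fin (S.arity c) → Tree S}
      (hact : (Pr.opDef o).act s = .read x k) (hx : ts x = .node c w cs)
      (hk : Eval Pr o (k c w) (Fin.append ts cs) t) : Eval Pr o s ts t
  | call {o : S.Op} {m : ℕ} {s : (Pr.opDef o).St m} {ts : Fin m → Tree S} {t t' : Tree S}
      {o' : S.Op} {a : S.Arg o'} {xs : Fin (S.opArity o') → Fin m} {k : (Pr.opDef o).St (m + 1)}
      (hact : (Pr.opDef o).act s = .call o' a xs k)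
      (hcall : Eval Pr o' ((Pr.opDef o').init a) (fun i => ts (xs i)) t')
      (hk : Eval Pr o k (Fin.snoc (α := fun _ => Tree S) ts t') t) : Eval Pr o s ts t
  | mk {o : S.Op} {m : ℕ} {s : (Pr.opDef o).St m} {ts : Fin m → Tree S} {t : Tree S}
      {c : S.Case} {w : S.Val c} {xs : Fin (S.arity c) → Fin m} {k : (Pr.opDef o).St (m + 1)}
      (hact : (Pr.opDef o).act s = .mk c w xs k)
      (hk : Eval Pr o k
        (Fin.snoc (α := fun _ => Tree S) ts (.node c w fun i => ts (xs i))) t) : Eval Pr o s ts t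
  | ret {o : S.Op} {m : ℕ} {s : (Pr.opDef o).St m} {ts : Fin m → Tree S}
      {c : S.Case} {w : S.Val c} {xs : Fin (S.arity c) → Fin m}
      (hact : (Pr.opDef o).act s = .ret c w xs) :
      Eval Pr o s ts (.node c w fun i => ts (xs i))

/-- Every operation, as sequentially defined, terminates on all inputs. -/
def Program.Terminates {S : Signature.{u}} (Pr : Program S) : Prop :=
  ∀ (o : S.Op) (a : S.Arg o) (ts : Fin (S.opArity o) → Tree S),
    ∃ t, Eval Pr o ((Pr.opDef o).init a) ts t

/-! ### The transformed node type -/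

abbrev Addr := ℕ

/-- `Immediate[E]`: a case of the tree type whose children are cells. -/
structure Imm (S : Signature.{u}) where
  case : S.Case
  val : S.Val case
  children : Fin (S.arity case) → Addr

/-- `Deferred[E]`: an operation promoted to data, or the built-in snapshot. -/
inductive Def (S : Signature.{u})
  | op (o : S.Op) (a : S.Arg o) (args : Fin (S.opArity o) → Addr)
  | snapshot (l : Addr)

inductive Content (S : Signature.{u})
  | imm (i : Imm S)
  | dfr (d : Def S)

/-- A memory cell; the metadata for `LLX`/`SCX` are the number of `SCX`s that have changed the cell
and the mark that makes it immutable for later `SCX`s. -/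
structure Cell (S : Signature.{u}) where
  content : Content S
  version : ℕ
  final : Bool

def Cell.fresh {S : Signature.{u}} (x : Content S) : Cell S := ⟨x, 0, false⟩

/-- The allocated cells; the address of a cell is its position. -/
abbrev Heap (S : Signature.{u}) := List (Cell S)

def Def.isSnapshot {S : Signature.{u}} : Def S → Bool
  | .op .. => false
  | .snapshot _ => true

/-! ### `apply` -/

/-- State of a running `apply` method: inside the body of an operation with its nodes replaced by
cells; a snapshot of `l` before and after `l` has been read (`ds` are the new children made so far);
or finished with a result. -/
inductive Apply {S : Signature.{u}} (Pr : Program S)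
  | op (o : S.Op) {m : ℕ} (s : (Pr.opDef o).St m) (env : Fin m → Addr)
  | snap (l : Addr)
  | snapKids (i : Imm S) (ds : List Addr)
  | done (i : Imm S)

def Def.start {S : Signature.{u}} (Pr : Program S) : Def S → Apply Pr
  | .op o a args => .op o ((Pr.opDef o).init a) args
  | .snapshot l => .snap l

/-- The cell on which `readStrict` is to be called next, if any, and how to continue with the
immediate contents and the finality of the resulting reference. -/
def Apply.strict? {S : Signature.{u}} {Pr : Program S} :
    Apply Pr → Option (Addr × (Imm S → Bool → Apply Pr))
  | .op o s env =>
    match (Pr.opDef o).act s with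
    | .read x k =>
      some (env x, fun i _ => .op o (k i.case i.val) (Fin.append env i.children))
    | _ => none
  | .snap l => some (l, fun i fin => if fin then .done i else .snapKids i [])
  | _ => none

/-- The cell on which `readLazy` is to be called next, if any, and how to continue with the new
child. -/
def Apply.lazy? {S : Signature.{u}} {Pr : Program S} :
    Apply Pr → Option (Addr × (Addr → Apply Pr))
  | .snapKids i ds =>
    if h : ds.length < S.arity i.case then
      some (i.children ⟨ds.length, h⟩, fun d => .snapKids i (ds ++ [d]))
    else none
  | _ => none

/-- The next step, if it is local, i.e. needs no `LLX` or `SCX`.  A call allocates a deferred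
node. -/
def Apply.local? {S : Signature.{u}} {Pr : Program S} (H : Heap S) :
    Apply Pr → Option (Heap S × Apply Pr)
  | .op o s env =>
    match (Pr.opDef o).act s with
    | .read _ _ => none
    | .call o' a xs k =>
      some (H ++ [Cell.fresh (.dfr (.op o' a fun i => env (xs i)))],
        .op o k (Fin.snoc (α := fun _ => Addr) env H.length))
    | .mk c w xs k =>
      some (H ++ [Cell.fresh (.imm ⟨c, w, fun i => env (xs i)⟩)],
        .op o k (Fin.snoc (α := fun _ => Addr) env H.length))
    | .ret c w xs => some (H, .done ⟨c, w, fun i => env (xs i)⟩)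
  | .snapKids i ds =>
    if h : ds.length = S.arity i.case then
      some (H, .done ⟨i.case, i.val, fun j => ds[j.val]'(by rw [h]; exact j.isLt)⟩)
    else none
  | _ => none

/-- Whether `Snapshot::apply` keeps a child with these contents, rather than putting a new snapshot
node above it: it is a snapshot node, or immediate and final. -/
def Cell.snapshotted {S : Signature.{u}} (x : Cell S) : Bool :=
  match x.content with
  | .dfr d => d.isSnapshot
  | .imm _ => x.final

/-! ### `readStrict` and `force` -/

/-- Progress of one activation of `force`.  `ctx` is the read set: the cells read by successful
`LLX`s of the current attempt, with the versions seen.  An `LLX` starts in one step and ends in a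
later one; `w` is the version of its cell when it started. -/
inductive Phase {S : Signature.{u}} (Pr : Program S)
  | start
  | llxRoot (w : ℕ)
  | run (ctx : List (Addr × ℕ)) (q : Apply Pr)
  | llx (ctx : List (Addr × ℕ)) (q : Apply Pr) (w : ℕ)

/-- An activation of `force`, for the deferred contents `dfr` of the cell `node`. -/
structure Frame {S : Signature.{u}} (Pr : Program S) where
  node : Addr
  dfr : Def S
  phase : Phase Pr

/-- When a `force` is abandoned since its work is already done, its caller retries. -/
def retryCaller {S : Signature.{u}} {Pr : Program S} : List (Frame Pr) → List (Frame Pr)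
  | [] => []
  | f :: fs => { f with phase := .start } :: fs

/-- No cell of the read set has changed since it was read. -/
def CtxValid {S : Signature.{u}} (H : Heap S) (ctx : List (Addr × ℕ)) : Prop :=
  ∀ e ∈ ctx, ∃ x, H[e.1]? = some x ∧ x.version = e.2 ∧ x.final = false

/-- One step of the topmost activation of `force` (first argument after the heap; the others are
below it), giving the new heap and the new stack. -/
inductive ForceStep {S : Signature.{u}} {Pr : Program S} :
    Heap S → Frame Pr → List (Frame Pr) → Heap S → List (Frame Pr) → Prop
  -- `LLX` on the node itself
  | rootStart {H : Heap S} {n : Addr} {d : Def S} {fs : List (Frame Pr)} {x : Cell S}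
      (hx : H[n]? = some x) :
      ForceStep H ⟨n, d, .start⟩ fs H (⟨n, d, .llxRoot x.version⟩ :: fs)
  -- an `LLX` can only fail if its cell was changed while it was running; then retry
  | rootFailed {H : Heap S} {n : Addr} {d : Def S} {fs : List (Frame Pr)} {x : Cell S} {w : ℕ}
      (hx : H[n]? = some x) (hw : x.version ≠ w) :
      ForceStep H ⟨n, d, .llxRoot w⟩ fs H (⟨n, d, .start⟩ :: fs)
  | rootOk {H : Heap S} {n : Addr} {d : Def S} {fs : List (Frame Pr)} {x : Cell S} {w : ℕ}
      (hx : H[n]? = some x) (hfin : x.final = false) (hc : x.content = .dfr d) :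
      ForceStep H ⟨n, d, .llxRoot w⟩ fs H
        (⟨n, d, .run [(n, x.version)] (d.start Pr)⟩ :: fs)
  | rootGone {H : Heap S} {n : Addr} {d : Def S} {fs : List (Frame Pr)} {x : Cell S} {w : ℕ}
      (hx : H[n]? = some x) (hgone : x.final = true ∨ x.content ≠ .dfr d) :
      ForceStep H ⟨n, d, .llxRoot w⟩ fs H (retryCaller fs)
  -- local steps of `apply`
  | loc {H H' : Heap S} {n : Addr} {d : Def S} {fs : List (Frame Pr)}
      {ctx : List (Addr × ℕ)} {q q' : Apply Pr} (hq : q.local? H = some (H', q')) :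
      ForceStep H ⟨n, d, .run ctx q⟩ fs H' (⟨n, d, .run ctx q'⟩ :: fs)
  -- `readStrict`
  | strictStart {H : Heap S} {n : Addr} {d : Def S} {fs : List (Frame Pr)}
      {ctx : List (Addr × ℕ)} {q : Apply Pr} {r : Addr} {k : Imm S → Bool → Apply Pr} {x : Cell S}
      (hq : q.strict? = some (r, k)) (hx : H[r]? = some x) :
      ForceStep H ⟨n, d, .run ctx q⟩ fs H (⟨n, d, .llx ctx q x.version⟩ :: fs)
  | strictFailed {H : Heap S} {n : Addr} {d : Def S} {fs : List (Frame Pr)}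
      {ctx : List (Addr × ℕ)} {q : Apply Pr} {r : Addr} {k : Imm S → Bool → Apply Pr} {x : Cell S}
      {w : ℕ} (hq : q.strict? = some (r, k)) (hx : H[r]? = some x) (hw : x.version ≠ w) :
      ForceStep H ⟨n, d, .llx ctx q w⟩ fs H (⟨n, d, .start⟩ :: fs)
  | strictFinal {H : Heap S} {n : Addr} {d : Def S} {fs : List (Frame Pr)}
      {ctx : List (Addr × ℕ)} {q : Apply Pr} {r : Addr} {k : Imm S → Bool → Apply Pr} {x : Cell S}
      {w : ℕ} {i : Imm S} (hq : q.strict? = some (r, k)) (hx : H[r]? = some x)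
      (hfin : x.final = true) (hc : x.content = .imm i) :
      ForceStep H ⟨n, d, .llx ctx q w⟩ fs H (⟨n, d, .run ctx (k i true)⟩ :: fs)
  | strictEscape {H : Heap S} {n : Addr} {d d' : Def S} {fs : List (Frame Pr)}
      {ctx : List (Addr × ℕ)} {q : Apply Pr} {r : Addr} {k : Imm S → Bool → Apply Pr} {x : Cell S}
      {w : ℕ} (hq : q.strict? = some (r, k)) (hx : H[r]? = some x)
      (hfin : x.final = true) (hc : x.content = .dfr d') :
      ForceStep H ⟨n, d, .llx ctx q w⟩ fs H (retryCaller fs)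
  | strictMut {H : Heap S} {n : Addr} {d : Def S} {fs : List (Frame Pr)}
      {ctx : List (Addr × ℕ)} {q : Apply Pr} {r : Addr} {k : Imm S → Bool → Apply Pr} {x : Cell S}
      {w : ℕ} {i : Imm S} (hq : q.strict? = some (r, k)) (hx : H[r]? = some x)
      (hfin : x.final = false) (hc : x.content = .imm i) :
      ForceStep H ⟨n, d, .llx ctx q w⟩ fs H
        (⟨n, d, .run (ctx ++ [(r, x.version)]) (k i false)⟩ :: fs)
  -- a deferred node is forced first, with a read set of its own, and then read again
  | strictForce {H : Heap S} {n : Addr} {d d' : Def S} {fs : List (Frame Pr)}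
      {ctx : List (Addr × ℕ)} {q : Apply Pr} {r : Addr} {k : Imm S → Bool → Apply Pr} {x : Cell S}
      {w : ℕ} (hq : q.strict? = some (r, k)) (hx : H[r]? = some x)
      (hfin : x.final = false) (hc : x.content = .dfr d') :
      ForceStep H ⟨n, d, .llx ctx q w⟩ fs H (⟨r, d', .start⟩ :: ⟨n, d, .run ctx q⟩ :: fs)
  -- `readLazy` in `Snapshot::apply`
  | lazyStart {H : Heap S} {n : Addr} {d : Def S} {fs : List (Frame Pr)}
      {ctx : List (Addr × ℕ)} {q : Apply Pr} {r : Addr} {k : Addr → Apply Pr} {x : Cell S}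
      (hq : q.lazy? = some (r, k)) (hx : H[r]? = some x) :
      ForceStep H ⟨n, d, .run ctx q⟩ fs H (⟨n, d, .llx ctx q x.version⟩ :: fs)
  | lazyFailed {H : Heap S} {n : Addr} {d : Def S} {fs : List (Frame Pr)}
      {ctx : List (Addr × ℕ)} {q : Apply Pr} {r : Addr} {k : Addr → Apply Pr} {x : Cell S}
      {w : ℕ} (hq : q.lazy? = some (r, k)) (hx : H[r]? = some x) (hw : x.version ≠ w) :
      ForceStep H ⟨n, d, .llx ctx q w⟩ fs H (⟨n, d, .start⟩ :: fs)
  | lazyKeep {H : Heap S} {n : Addr} {d : Def S} {fs : List (Frame Pr)}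
      {ctx : List (Addr × ℕ)} {q : Apply Pr} {r : Addr} {k : Addr → Apply Pr} {x : Cell S}
      {w : ℕ} (hq : q.lazy? = some (r, k)) (hx : H[r]? = some x) (hs : x.snapshotted = true) :
      ForceStep H ⟨n, d, .llx ctx q w⟩ fs H
        (⟨n, d, .run (if x.final then ctx else ctx ++ [(r, x.version)]) (k r)⟩ :: fs)
  | lazyNew {H : Heap S} {n : Addr} {d : Def S} {fs : List (Frame Pr)}
      {ctx : List (Addr × ℕ)} {q : Apply Pr} {r : Addr} {k : Addr → Apply Pr} {x : Cell S}
      {w : ℕ} (hq : q.lazy? = some (r, k)) (hx : H[r]? = some x) (hs : x.snapshotted = false) :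
      ForceStep H ⟨n, d, .llx ctx q w⟩ fs (H ++ [Cell.fresh (.dfr (.snapshot r))])
        (⟨n, d, .run (if x.final then ctx else ctx ++ [(r, x.version)]) (k H.length)⟩ :: fs)
  -- `SCX` of the result into the node; it finalizes the node of a snapshot
  | scxOk {H : Heap S} {n : Addr} {d : Def S} {fs : List (Frame Pr)}
      {ctx : List (Addr × ℕ)} {i : Imm S} {x : Cell S}
      (hctx : CtxValid H ctx) (hx : H[n]? = some x) :
      ForceStep H ⟨n, d, .run ctx (.done i)⟩ fs
        (H.set n ⟨.imm i, x.version + 1, d.isSnapshot⟩) fs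
  | scxFailed {H : Heap S} {n : Addr} {d : Def S} {fs : List (Frame Pr)}
      {ctx : List (Addr × ℕ)} {i : Imm S} (hctx : ¬ CtxValid H ctx) :
      ForceStep H ⟨n, d, .run ctx (.done i)⟩ fs H (⟨n, d, .start⟩ :: fs)

/-! ### The concurrent object -/

/-- Operations that a process can invoke on the data structure.  An address is a node that the
invoking process holds a reference to, and `none` stands for the current root.
* `update o a args` replaces the root by the deferred node `o(a, args)`;
* `snapshot` replaces the root by a snapshot node, and returns a reference to it;
* `read src` is a forced read of a node, and returns its contents. -/
inductive Call (S : Signature.{u})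
  | update (o : S.Op) (a : S.Arg o) (args : Fin (S.opArity o) → Option Addr)
  | snapshot
  | read (src : Option Addr)

def Call.Valid {S : Signature.{u}} (refs : List Addr) : Call S → Prop
  | .update _ _ args => ∀ i, ∀ r ∈ args i, r ∈ refs
  | .snapshot => True
  | .read src => ∀ r ∈ src, r ∈ refs

/-- Contents that mention only nodes of `refs`. -/
def Content.Over {S : Signature.{u}} (refs : List Addr) : Content S → Prop
  | .imm i => ∀ j, i.children j ∈ refs
  | .dfr (.op _ _ args) => ∀ j, args j ∈ refs
  | .dfr (.snapshot l) => l ∈ refs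

/-- The deferred node that a call puts at the root in place of the root `r`, if it does so. -/
def Call.post? {S : Signature.{u}} (r : Addr) : Call S → Option (Def S)
  | .update o a args => some (.op o a fun i => (args i).getD r)
  | .snapshot => some (.snapshot r)
  | .read _ => none

/-- What a process that posted the node `n` at the root gets to hold. -/
def Call.gained {S : Signature.{u}} (n : Addr) : Call S → List Addr
  | .snapshot => [n]
  | _ => []

/-- Control state of a process: no pending call; a call about to (re)start; about to replace the
root `r` by `n` with a `CAS`; or in `readStrict` of `x`, where `w` is the version of `x` when the
running `LLX` on `x` started, if one is running, and `frames` are the activations of `force`,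
innermost first. -/
inductive Pc {S : Signature.{u}} (Pr : Program S)
  | idle
  | start (call : Call S)
  | cas (call : Call S) (r n : Addr)
  | reading (x : Addr) (w : Option ℕ) (frames : List (Frame Pr))

structure Proc {S : Signature.{u}} (Pr : Program S) where
  pc : Pc Pr
  refs : List Addr

structure Mem (S : Signature.{u}) where
  heap : Heap S
  root : Addr

/-- Kinds of steps: private steps of a client between its operations; steps of operations; and
steps that complete an operation. -/
inductive Kind
  | client
  | internal
  | complete

/-- One atomic step of a process. -/
inductive ProcStep {S : Signature.{u}} {Pr : Program S} :
    Mem S → Proc Pr → Kind → Mem S → Proc Pr → Prop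
  -- between its operations, a client may build private nodes
  | make {M : Mem S} {refs : List Addr} {y : Content S} (hy : y.Over refs) :
      ProcStep M ⟨.idle, refs⟩ .client
        ⟨M.heap ++ [Cell.fresh y], M.root⟩ ⟨.idle, refs ++ [M.heap.length]⟩
  | invoke {M : Mem S} {refs : List Addr} {call : Call S} (hcall : call.Valid refs) :
      ProcStep M ⟨.idle, refs⟩ .internal M ⟨.start call, refs⟩
  -- root holder: read the root, construct a deferred node, `CAS` the root, retry on failure
  | post {M : Mem S} {refs : List Addr} {call : Call S} {d : Def S}
      (hd : call.post? M.root = some d) :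
      ProcStep M ⟨.start call, refs⟩ .internal
        ⟨M.heap ++ [Cell.fresh (.dfr d)], M.root⟩ ⟨.cas call M.root M.heap.length, refs⟩
  | casOk {M : Mem S} {refs : List Addr} {call : Call S} {r n : Addr} (hr : M.root = r) :
      ProcStep M ⟨.cas call r n, refs⟩ .complete
        ⟨M.heap, n⟩ ⟨.idle, refs ++ call.gained n⟩
  | casFailed {M : Mem S} {refs : List Addr} {call : Call S} {r n : Addr} (hr : M.root ≠ r) :
      ProcStep M ⟨.cas call r n, refs⟩ .internal M ⟨.start call, refs⟩
  -- a forced read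
  | readInit {M : Mem S} {refs : List Addr} {src : Option Addr} :
      ProcStep M ⟨.start (.read src), refs⟩ .internal
        M ⟨.reading (src.getD M.root) none [], refs⟩
  | readStart {M : Mem S} {refs : List Addr} {r : Addr} {x : Cell S}
      (hx : M.heap[r]? = some x) :
      ProcStep M ⟨.reading r none [], refs⟩ .internal M ⟨.reading r (some x.version) [], refs⟩
  | readFailed {M : Mem S} {refs : List Addr} {r : Addr} {x : Cell S} {w : ℕ}
      (hx : M.heap[r]? = some x) (hw : x.version ≠ w) :
      ProcStep M ⟨.reading r (some w) [], refs⟩ .internal M ⟨.reading r none [], refs⟩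
  | readImm {M : Mem S} {refs : List Addr} {r : Addr} {x : Cell S} {w : ℕ} {i : Imm S}
      (hx : M.heap[r]? = some x) (hc : x.content = .imm i) :
      ProcStep M ⟨.reading r (some w) [], refs⟩ .complete
        M ⟨.idle, refs ++ List.ofFn i.children⟩
  | readEscape {M : Mem S} {refs : List Addr} {r : Addr} {x : Cell S} {w : ℕ} {d : Def S}
      (hx : M.heap[r]? = some x) (hfin : x.final = true) (hc : x.content = .dfr d) :
      ProcStep M ⟨.reading r (some w) [], refs⟩ .internal M ⟨.reading r none [], refs⟩
  | readForce {M : Mem S} {refs : List Addr} {r : Addr} {x : Cell S} {w : ℕ} {d : Def S}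
      (hx : M.heap[r]? = some x) (hfin : x.final = false) (hc : x.content = .dfr d) :
      ProcStep M ⟨.reading r (some w) [], refs⟩ .internal
        M ⟨.reading r none [⟨r, d, .start⟩], refs⟩
  | force {M : Mem S} {refs : List Addr} {r : Addr} {f : Frame Pr} {fs fs' : List (Frame Pr)}
      {H' : Heap S} (h : ForceStep M.heap f fs H' fs') :
      ProcStep M ⟨.reading r none (f :: fs), refs⟩ .internal
        ⟨H', M.root⟩ ⟨.reading r none fs', refs⟩

/-- Shared memory and all processes. -/
structure Config {S : Signature.{u}} (Pr : Program S) (P : Type v) where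
  mem : Mem S
  procs : P → Proc Pr

/-- Initially, the root is the root of some immediate finite tree, and all processes are idle. -/
def Config.Initial {S : Signature.{u}} {Pr : Program S} {P : Type v} (C : Config Pr P) : Prop :=
  (∀ r x, C.mem.heap[r]? = some x →
    ∃ i : Imm S, x = Cell.fresh (.imm i) ∧ ∀ j, i.children j < r) ∧
  C.mem.root < C.mem.heap.length ∧
  ∀ p, C.procs p = ⟨.idle, []⟩

/-- A step of process `p`; the other processes do not move. -/
def Config.Step {S : Signature.{u}} {Pr : Program S} {P : Type v} (p : P) (κ : Kind)
    (C C' : Config Pr P) : Prop :=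
  ProcStep C.mem (C.procs p) κ C'.mem (C'.procs p) ∧ ∀ q, q ≠ p → C'.procs q = C.procs q

def Config.Reachable {S : Signature.{u}} {Pr : Program S} {P : Type v} (C : Config Pr P) : Prop :=
  ∃ C₀ : Config Pr P, C₀.Initial ∧
    Relation.ReflTransGen (fun C₁ C₂ => ∃ p κ, Config.Step p κ C₁ C₂) C₀ C

/-- An infinite execution under an arbitrary scheduler: `sched n` takes the `n`-th step, which is of
kind `kind n`. -/
structure IsExecution {S : Signature.{u}} {Pr : Program S} {P : Type v}
    (C : ℕ → Config Pr P) (sched : ℕ → P) (kind : ℕ → Kind) : Prop where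
  init : (C 0).Initial
  step : ∀ n, Config.Step (sched n) (kind n) (C n) (C (n + 1))

/-- Lock-freedom for the processes `P`: a process with a pending operation is never blocked, and in
every execution in which steps of operations are taken infinitely often, operations complete
infinitely often. -/
def LockFree {S : Signature.{u}} (Pr : Program S) (P : Type v) : Prop :=
  (∀ C : Config Pr P, C.Reachable → ∀ p, (C.procs p).pc ≠ .idle →
    ∃ κ C', Config.Step p κ C C') ∧
  ∀ (C : ℕ → Config Pr P) (sched : ℕ → P) (kind : ℕ → Kind), IsExecution C sched kind →
    (∀ N, ∃ n ≥ N, kind n ≠ .client) → ∀ N, ∃ n ≥ N, kind n = .complete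

end LazyCow

/-! Absence of blocking is a matter of invariants: every address in use is allocated, and a deferred
cell has version 0 and is not final, so some rule applies in every pending control state.

Progress rests on two facts about the heap. First, a cell changes at most once after its allocation,
from deferred to immediate: the read set of a `force` contains its node at version 0, so the `SCX`
succeeds only while the node is still deferred (`Heap.Le`). Second, sequential termination gives
every cell a value and a rank. At allocation a cell mentions only older cells, so both are defined
by recursion on the address (`exists_value_rank`); the rank of a deferred operation is the largest
rank of its arguments plus the number of steps of its call-by-value evaluation plus one. While a
body runs, a bound on the ranks of the cells it knows plus the cost still to come stays below the
rank of its node (`Apply.Ok`). Deferring a call turns cost into rank, so the balance is kept.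
Consequently a cell only ever mentions cells of smaller rank, before and after it is forced.

Every activation of `force` therefore ends if its process keeps moving (`pops`), by induction on the
rank. Nodes forced on the way have smaller rank, so an attempt is finite: it is popped or restarted
(`restarts`). Suppose that it is restarted forever. Over the whole execution a cell has at most two
contents, so by König's argument only finitely many cells are ever reachable from the node and its
contents (`finite_reach`), and after some time none of them changes (`exists_frozen`). An attempt
begun after that time uses only these frozen cells and cells that its own process has allocated
since, which no other process can find (`Solo`). Nothing can invalidate it, so it is not restarted,
a contradiction.

Hence forced reads finish. The remaining loop is the `CAS` on the root, which fails only if another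
operation has completed; with finitely many processes, infinitely many operation steps yield
infinitely many completions. -/

namespace LazyCow

variable {S : Signature.{u}} {Pr : Program S} {P : Type v}

/-! ### Addresses mentioned by contents, computations and processes -/

/-- The contents mention the address. -/
def Content.Dep : Content S → Addr → Prop
  | .imm i, b => ∃ j, i.children j = b
  | .dfr (.op _ _ args), b => ∃ j, args j = b
  | .dfr (.snapshot l), b => l = b

/-- All addresses mentioned by the contents satisfy `A`. -/
def Content.All (A : Addr → Prop) (y : Content S) : Prop := ∀ b, y.Dep b → A b

@[simp] theorem Content.all_imm {A : Addr → Prop} {i : Imm S} :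
    (Content.imm i).All A ↔ ∀ j, A (i.children j) := by
  simp [Content.All, Content.Dep]

@[simp] theorem Content.all_op {A : Addr → Prop} {o : S.Op} {a : S.Arg o}
    {args : Fin (S.opArity o) → Addr} :
    (Content.dfr (.op o a args)).All A ↔ ∀ j, A (args j) := by
  simp [Content.All, Content.Dep]

@[simp] theorem Content.all_snapshot {A : Addr → Prop} {l : Addr} :
    (Content.dfr (.snapshot l) : Content S).All A ↔ A l := by
  simp [Content.All, Content.Dep]

theorem Content.All.mono {A B : Addr → Prop} {y : Content S} (h : y.All A)
    (hAB : ∀ a, A a → B a) : y.All B := fun b hb => hAB b (h b hb)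

theorem Content.finite_dep (y : Content S) : {b | y.Dep b}.Finite := by
  match y with
  | .imm i => exact Set.finite_range i.children
  | .dfr (.op _ _ args) => exact Set.finite_range args
  | .dfr (.snapshot l) =>
    refine (Set.finite_singleton l).subset fun b hb => ?_
    exact (show l = b from hb).symm

/-- All addresses in use by the computation satisfy `A`. -/
def Apply.All (A : Addr → Prop) : Apply Pr → Prop
  | .op _ _ env => ∀ j, A (env j)
  | .snap l => A l
  | .snapKids i ds => (∀ j, A (i.children j)) ∧ ∀ d ∈ ds, A d
  | .done i => ∀ j, A (i.children j)

def Phase.All (A : Addr → Prop) : Phase Pr → Prop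
  | .run ctx q => (∀ e ∈ ctx, A e.1) ∧ q.All A
  | .llx ctx q _ => (∀ e ∈ ctx, A e.1) ∧ q.All A
  | _ => True

structure Frame.All (A : Addr → Prop) (f : Frame Pr) : Prop where
  node : A f.node
  dfr : (Content.dfr f.dfr).All A
  phase : f.phase.All A

def Call.All (A : Addr → Prop) : Call S → Prop
  | .update _ _ args => ∀ i, ∀ r ∈ args i, A r
  | .snapshot => True
  | .read src => ∀ r ∈ src, A r

/-- The expected root of a `CAS` is left out: it is only compared with the root, never dereferenced,
and the process gains no reference to it. -/
def Pc.All (A : Addr → Prop) : Pc Pr → Prop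
  | .idle => True
  | .start call => call.All A
  | .cas call _ n => call.All A ∧ A n
  | .reading x _ fs => A x ∧ ∀ f ∈ fs, f.All A

def Proc.All (A : Addr → Prop) (p : Proc Pr) : Prop := p.pc.All A ∧ ∀ r ∈ p.refs, A r

theorem Apply.All.mono {A B : Addr → Prop} {q : Apply Pr} (h : q.All A)
    (hAB : ∀ a, A a → B a) : q.All B := by
  cases q with
  | op o s env => exact fun j => hAB _ (h j)
  | snap l => exact hAB _ h
  | snapKids i ds => exact ⟨fun j => hAB _ (h.1 j), fun d hd => hAB _ (h.2 d hd)⟩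
  | done i => exact fun j => hAB _ (h j)

theorem Phase.All.mono {A B : Addr → Prop} {f : Phase Pr} (h : f.All A)
    (hAB : ∀ a, A a → B a) : f.All B := by
  cases f with
  | start => trivial
  | llxRoot w => trivial
  | run ctx q => exact ⟨fun e he => hAB _ (h.1 e he), h.2.mono hAB⟩
  | llx ctx q w => exact ⟨fun e he => hAB _ (h.1 e he), h.2.mono hAB⟩

theorem Frame.All.mono {A B : Addr → Prop} {f : Frame Pr} (h : f.All A)
    (hAB : ∀ a, A a → B a) : f.All B :=
  ⟨hAB _ h.node, h.dfr.mono hAB, h.phase.mono hAB⟩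

theorem Call.All.mono {A B : Addr → Prop} {c : Call S} (h : c.All A)
    (hAB : ∀ a, A a → B a) : c.All B := by
  cases c with
  | update o a args => exact fun i r hr => hAB _ (h i r hr)
  | snapshot => trivial
  | read src => exact fun r hr => hAB _ (h r hr)

theorem Proc.All.mono {A B : Addr → Prop} {p : Proc Pr} (h : p.All A)
    (hAB : ∀ a, A a → B a) : p.All B := by
  obtain ⟨pc, refs⟩ := p
  refine ⟨?_, fun r hr => hAB _ (h.2 r hr)⟩
  cases pc with
  | idle => trivial
  | start c => exact Call.All.mono h.1 hAB
  | cas c r n => exact ⟨Call.All.mono h.1.1 hAB, hAB _ h.1.2⟩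
  | reading x w fs => exact ⟨hAB _ h.1.1, fun f hf => (h.1.2 f hf).mono hAB⟩

/-- Cells at addresses that satisfy `A` mention only such addresses. -/
def Heap.Closed (A : Addr → Prop) (H : Heap S) : Prop :=
  ∀ a x, A a → H[a]? = some x → x.content.All A

/-! ### Inversion of the selectors of `Apply` -/

theorem Apply.strict?_eq_some {q : Apply Pr} {r : Addr} {k : Imm S → Bool → Apply Pr}
    (h : q.strict? = some (r, k)) :
    (∃ (o : S.Op) (m : ℕ) (s : (Pr.opDef o).St m) (env : Fin m → Addr) (x : Fin m)
      (k' : (c : S.Case) → S.Val c → (Pr.opDef o).St (m + S.arity c)),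
      q = .op o s env ∧ (Pr.opDef o).act s = .read x k' ∧ r = env x ∧
      k = fun i _ => .op o (k' i.case i.val) (Fin.append env i.children)) ∨
    (q = .snap r ∧ k = fun i fin => if fin then .done i else .snapKids i []) := by
  cases q with
  | op o s env =>
    left
    simp only [Apply.strict?] at h
    split at h
    · rename_i x k' hact
      simp only [Option.some.injEq, Prod.mk.injEq] at h
      exact ⟨o, _, s, env, x, k', rfl, hact, h.1.symm, h.2.symm⟩
    · cases h
  | snap l =>
    right
    simp only [Apply.strict?, Option.some.injEq, Prod.mk.injEq] at h
    exact ⟨by rw [h.1], h.2.symm⟩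
  | snapKids i ds => cases h
  | done i => cases h

theorem Apply.lazy?_eq_some {q : Apply Pr} {r : Addr} {k : Addr → Apply Pr}
    (h : q.lazy? = some (r, k)) :
    ∃ (i : Imm S) (ds : List Addr) (hd : ds.length < S.arity i.case),
      q = .snapKids i ds ∧ r = i.children ⟨ds.length, hd⟩ ∧
      k = fun d => .snapKids i (ds ++ [d]) := by
  cases q with
  | snapKids i ds =>
    simp only [Apply.lazy?] at h
    split at h
    · rename_i hd
      simp only [Option.some.injEq, Prod.mk.injEq] at h
      exact ⟨i, ds, hd, rfl, h.1.symm, h.2.symm⟩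
    · cases h
  | op o s env => cases h
  | snap l => cases h
  | done i => cases h

theorem Apply.local?_eq_some {q q' : Apply Pr} {H H' : Heap S}
    (h : q.local? H = some (H', q')) :
    (∃ (o : S.Op) (m : ℕ) (s : (Pr.opDef o).St m) (env : Fin m → Addr) (o' : S.Op)
      (a : S.Arg o') (xs : Fin (S.opArity o') → Fin m) (k : (Pr.opDef o).St (m + 1)),
      q = .op o s env ∧ (Pr.opDef o).act s = .call o' a xs k ∧
      H' = H ++ [Cell.fresh (.dfr (.op o' a fun i => env (xs i)))] ∧
      q' = .op o k (Fin.snoc (α := fun _ => Addr) env H.length)) ∨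
    (∃ (o : S.Op) (m : ℕ) (s : (Pr.opDef o).St m) (env : Fin m → Addr) (c : S.Case)
      (w : S.Val c) (xs : Fin (S.arity c) → Fin m) (k : (Pr.opDef o).St (m + 1)),
      q = .op o s env ∧ (Pr.opDef o).act s = .mk c w xs k ∧
      H' = H ++ [Cell.fresh (.imm ⟨c, w, fun i => env (xs i)⟩)] ∧
      q' = .op o k (Fin.snoc (α := fun _ => Addr) env H.length)) ∨
    (∃ (o : S.Op) (m : ℕ) (s : (Pr.opDef o).St m) (env : Fin m → Addr) (c : S.Case)
      (w : S.Val c) (xs : Fin (S.arity c) → Fin m),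
      q = .op o s env ∧ (Pr.opDef o).act s = .ret c w xs ∧ H' = H ∧
      q' = .done ⟨c, w, fun i => env (xs i)⟩) ∨
    (∃ (i : Imm S) (ds : List Addr) (hd : ds.length = S.arity i.case),
      q = .snapKids i ds ∧ H' = H ∧
      q' = .done ⟨i.case, i.val, fun j => ds[j.val]'(by rw [hd]; exact j.isLt)⟩) := by
  cases q with
  | op o s env =>
    simp only [Apply.local?] at h
    split at h
    · cases h
    · rename_i o' a xs k hact
      simp only [Option.some.injEq, Prod.mk.injEq] at h
      exact .inl ⟨o, _, s, env, o', a, xs, k, rfl, hact, h.1.symm, h.2.symm⟩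
    · rename_i c w xs k hact
      simp only [Option.some.injEq, Prod.mk.injEq] at h
      exact .inr (.inl ⟨o, _, s, env, c, w, xs, k, rfl, hact, h.1.symm, h.2.symm⟩)
    · rename_i c w xs hact
      simp only [Option.some.injEq, Prod.mk.injEq] at h
      exact .inr (.inr (.inl ⟨o, _, s, env, c, w, xs, rfl, hact, h.1.symm, h.2.symm⟩))
  | snapKids i ds =>
    simp only [Apply.local?] at h
    split at h
    · rename_i hd
      simp only [Option.some.injEq, Prod.mk.injEq] at h
      exact .inr (.inr (.inr ⟨i, ds, hd, rfl, h.1.symm, h.2.symm⟩))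
    · cases h
  | snap l => cases h
  | done i => cases h

theorem Apply.All.strict {A : Addr → Prop} {q : Apply Pr} {r : Addr}
    {k : Imm S → Bool → Apply Pr} (h : q.All A) (hq : q.strict? = some (r, k)) :
    A r ∧ ∀ i b, (Content.imm i).All A → (k i b).All A := by
  rcases Apply.strict?_eq_some hq with ⟨o, m, s, env, x, k', rfl, -, rfl, rfl⟩ | ⟨rfl, rfl⟩
  · refine ⟨h x, fun i b hi => ?_⟩
    intro j
    refine Fin.addCases (fun j => ?_) (fun j => ?_) j
    · simpa using h j
    · simpa using Content.all_imm.1 hi j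
  · refine ⟨h, fun i b hi => ?_⟩
    cases b
    · exact ⟨Content.all_imm.1 hi, by simp⟩
    · exact Content.all_imm.1 hi

theorem Apply.All.lazy {A : Addr → Prop} {q : Apply Pr} {r : Addr} {k : Addr → Apply Pr}
    (h : q.All A) (hq : q.lazy? = some (r, k)) : A r ∧ ∀ d, A d → (k d).All A := by
  obtain ⟨i, ds, hd, rfl, rfl, rfl⟩ := Apply.lazy?_eq_some hq
  refine ⟨h.1 _, fun d hd => ⟨h.1, fun e he => ?_⟩⟩
  rcases List.mem_append.1 he with he | he
  · exact h.2 e he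
  · rw [List.mem_singleton.1 he]; exact hd

/-- Contents of a new cell use only addresses already known, whereas the continuation also knows the
new address; hence the assumption on new addresses guards the last conjunct alone. -/
theorem Apply.All.local {A : Addr → Prop} {q q' : Apply Pr} {H H' : Heap S} (h : q.All A)
    (hq : q.local? H = some (H', q')) :
    (H' = H ∨ ∃ y, H' = H ++ [Cell.fresh y]) ∧
    (∀ y, H' = H ++ [Cell.fresh y] → y.All A) ∧
    ((∀ a, H.length ≤ a → a < H'.length → A a) → q'.All A) := by
  have snoc : ∀ {m : ℕ} (env : Fin m → Addr), (∀ j, A (env j)) → A H.length →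
      ∀ j, A (Fin.snoc (α := fun _ => Addr) env H.length j) := by
    intro m env he hl j
    refine Fin.lastCases ?_ (fun j => ?_) j
    · simpa using hl
    · simpa using he j
  rcases Apply.local?_eq_some hq with ⟨o, m, s, env, o', a, xs, k, rfl, -, rfl, rfl⟩ |
    ⟨o, m, s, env, c, w, xs, k, rfl, -, rfl, rfl⟩ | ⟨o, m, s, env, c, w, xs, rfl, -, rfl, rfl⟩ |
    ⟨i, ds, hd, rfl, rfl, rfl⟩
  · refine ⟨.inr ⟨_, rfl⟩, fun y hy => ?_, fun hn => snoc env h (hn _ le_rfl (by simp))⟩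
    simp only [List.append_cancel_left_eq, List.cons.injEq, Cell.fresh, Cell.mk.injEq,
      and_true] at hy
    subst hy
    simpa using fun j => h (xs j)
  · refine ⟨.inr ⟨_, rfl⟩, fun y hy => ?_, fun hn => snoc env h (hn _ le_rfl (by simp))⟩
    simp only [List.append_cancel_left_eq, List.cons.injEq, Cell.fresh, Cell.mk.injEq,
      and_true] at hy
    subst hy
    simpa using fun j => h (xs j)
  · exact ⟨.inl rfl, fun y hy => by simp at hy, fun _ j => h _⟩
  · exact ⟨.inl rfl, fun y hy => by simp at hy, fun _ j => h.2 _ (List.getElem_mem _)⟩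

theorem Def.all_start {A : Addr → Prop} {d : Def S} (h : (Content.dfr d).All A) :
    (d.start Pr).All A := by
  cases d with
  | op o a args => exact Content.all_op.1 h
  | snapshot l => exact Content.all_snapshot.1 h

/-! ### How a step changes the heap -/

/-- The heap is unchanged, or a cell is allocated whose contents mention only addresses in use, or
an `SCX` has written into the node of the topmost activation `top`. -/
inductive HeapChange (H : Heap S) (use : (Addr → Prop) → Prop) (top : Frame Pr → Prop) :
    Heap S → Prop
  | same : HeapChange H use top H
  | alloc (y : Content S) (hy : ∀ A, use A → y.All A) :
      HeapChange H use top (H ++ [Cell.fresh y])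
  | write (f : Frame Pr) (hf : top f) (ctx : List (Addr × ℕ)) (i : Imm S)
      (hphase : f.phase = .run ctx (.done i)) (hctx : CtxValid H ctx) (x : Cell S)
      (hx : H[f.node]? = some x) :
      HeapChange H use top (H.set f.node ⟨.imm i, x.version + 1, f.dfr.isSnapshot⟩)

theorem HeapChange.imp {H H' : Heap S} {use use' : (Addr → Prop) → Prop}
    {top top' : Frame Pr → Prop} (h : HeapChange H use top H') (hu : ∀ A, use' A → use A)
    (ht : ∀ f, top f → top' f) : HeapChange H use' top' H' := by
  cases h with
  | same => exact .same
  | alloc y hy => exact .alloc y fun A hA => hy A (hu A hA)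
  | write f hf ctx i hphase hctx x hx => exact .write f (ht f hf) ctx i hphase hctx x hx

theorem ForceStep.heapChange {H H' : Heap S} {f : Frame Pr} {fs fs' : List (Frame Pr)}
    (h : ForceStep H f fs H' fs') : HeapChange H (fun A => f.All A) (· = f) H' := by
  cases h with
  | loc hq =>
    rename_i ctx q q'
    rcases Apply.local?_eq_some hq with ⟨o, m, s, env, o', a, xs, k, rfl, -, rfl, rfl⟩ |
      ⟨o, m, s, env, c, w, xs, k, rfl, -, rfl, rfl⟩ | ⟨o, m, s, env, c, w, xs, rfl, -, rfl, rfl⟩ |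
      ⟨i, ds, hd, rfl, rfl, rfl⟩
    · exact .alloc _ fun A hA => (Apply.All.local (hA.phase.2) hq).2.1 _ rfl
    · exact .alloc _ fun A hA => (Apply.All.local (hA.phase.2) hq).2.1 _ rfl
    · exact .same
    · exact .same
  | lazyNew hq hx hs =>
    exact .alloc _ fun A hA => Content.all_snapshot.2 (hA.phase.2.lazy hq).1
  | scxOk hctx hx =>
    rename_i n d ctx i x
    exact .write (top := (· = _)) ⟨n, d, .run ctx (.done i)⟩ rfl ctx i rfl hctx x hx
  | _ => exact .same

/-- The innermost activation of a process. -/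
def Proc.Top (p : Proc Pr) (f : Frame Pr) : Prop :=
  ∃ r w fs, p.pc = .reading r w (f :: fs)

theorem Content.Over.all {A : Addr → Prop} {refs : List Addr} {y : Content S} (h : y.Over refs)
    (hr : ∀ r ∈ refs, A r) : y.All A := by
  match y, h with
  | .imm i, h => exact Content.all_imm.2 fun j => hr _ (h j)
  | .dfr (.op _ _ args), h => exact Content.all_op.2 fun j => hr _ (h j)
  | .dfr (.snapshot l), h => exact Content.all_snapshot.2 (hr _ h)

theorem Call.all_post {A : Addr → Prop} {c : Call S} {r : Addr} {d : Def S} (hc : c.All A)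
    (hr : A r) (hd : c.post? r = some d) : (Content.dfr d).All A := by
  cases c with
  | update o a args =>
    simp only [Call.post?, Option.some.injEq] at hd
    subst hd
    refine Content.all_op.2 fun j => ?_
    cases h : args j with
    | none => exact hr
    | some b => exact hc j b h
  | snapshot =>
    simp only [Call.post?, Option.some.injEq] at hd
    subst hd
    exact Content.all_snapshot.2 hr
  | read src => cases hd

theorem ProcStep.heapChange {M M' : Mem S} {p p' : Proc Pr} {κ : Kind}
    (h : ProcStep M p κ M' p') :
    HeapChange M.heap (fun A => A M.root ∧ p.All A) p.Top M'.heap := by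
  cases h with
  | make hy => exact .alloc _ fun A hA => hy.all hA.2.2
  | post hd => exact .alloc _ fun A hA => Call.all_post hA.2.1 hA.1 hd
  | force h =>
    refine h.heapChange.imp (fun A hA => hA.2.1.2 _ List.mem_cons_self) fun g hg => ?_
    subst hg
    exact ⟨_, _, _, rfl⟩
  | _ => exact .same

theorem HeapChange.length_le {H H' : Heap S} {use : (Addr → Prop) → Prop}
    {top : Frame Pr → Prop} (h : HeapChange H use top H') : H.length ≤ H'.length := by
  cases h <;> simp

theorem HeapChange.closed {A : Addr → Prop} {H H' : Heap S} {use : (Addr → Prop) → Prop}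
    {top : Frame Pr → Prop} (h : HeapChange H use top H') (hc : H.Closed A) (hu : use A)
    (ht : ∀ f, top f → f.All A) : H'.Closed A := by
  intro a z ha hz
  cases h with
  | same => exact hc a z ha hz
  | alloc y hy =>
    rw [List.getElem?_append] at hz
    split at hz
    · exact hc a z ha hz
    · rw [List.getElem?_singleton] at hz
      split at hz
      · cases hz; exact hy A hu
      · cases hz
  | write f hf ctx i hphase hctx x hx =>
    rw [List.getElem?_set] at hz
    split at hz
    · split at hz
      · cases hz
        have := (ht f hf).phase
        rw [hphase] at this
        exact Content.all_imm.2 this.2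
      · cases hz
    · exact hc a z ha hz

/-- The contents of new cells mention only addresses in use. -/
theorem HeapChange.new_all {A : Addr → Prop} {H H' : Heap S} {use : (Addr → Prop) → Prop}
    {top : Frame Pr → Prop} (h : HeapChange H use top H') (hu : use A) {a : Addr} {x : Cell S}
    (ha : H.length ≤ a) (hx : H'[a]? = some x) : x.content.All A := by
  cases h with
  | same => rw [List.getElem?_eq_none ha] at hx; cases hx
  | alloc y hy =>
    rw [List.getElem?_append_right ha, List.getElem?_singleton] at hx
    split at hx
    · cases hx; exact hy A hu
    · cases hx
  | write f hf ctx i hphase hctx z hz =>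
    rw [List.getElem?_eq_none (by simpa using ha)] at hx; cases hx

/-- Only the node of the topmost activation can change. -/
theorem HeapChange.eq_of_ne {H H' : Heap S} {use : (Addr → Prop) → Prop}
    {top : Frame Pr → Prop} (h : HeapChange H use top H') {a : Addr} (ha : a < H.length)
    (hne : H'[a]? ≠ H[a]?) : ∃ f, top f ∧ f.node = a := by
  cases h with
  | same => exact absurd rfl hne
  | alloc y hy => exact absurd (List.getElem?_append_left ha) hne
  | write f hf ctx i hphase hctx z hz =>
    refine ⟨f, hf, ?_⟩
    by_contra hfa
    exact hne (List.getElem?_set_ne hfa)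

/-! ### Addresses in use are preserved by steps -/

theorem retryCaller_all {A : Addr → Prop} {fs : List (Frame Pr)} (h : ∀ g ∈ fs, g.All A) :
    ∀ g ∈ retryCaller fs, g.All A := by
  cases fs with
  | nil => exact h
  | cons f fs =>
    simp only [retryCaller, List.mem_cons, forall_eq_or_imp] at h ⊢
    exact ⟨⟨h.1.node, h.1.dfr, trivial⟩, h.2⟩

theorem ForceStep.all {A : Addr → Prop} {H H' : Heap S} {f : Frame Pr} {fs fs' : List (Frame Pr)}
    (h : ForceStep H f fs H' fs') (hc : H.Closed A)
    (hnew : ∀ a, H.length ≤ a → a < H'.length → A a) (hf : f.All A) (hfs : ∀ g ∈ fs, g.All A) :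
    ∀ g ∈ fs', g.All A := by
  have cons : ∀ {g : Frame Pr}, g.All A → ∀ g' ∈ g :: fs, g'.All A := by
    intro g hg
    simpa using ⟨hg, hfs⟩
  have ctxA : ∀ {ctx : List (Addr × ℕ)} {r : Addr} {b : ℕ}, (∀ e ∈ ctx, A e.1) → A r →
      ∀ e ∈ ctx ++ [(r, b)], A e.1 := by
    intro ctx r b h1 h2 e he
    rcases List.mem_append.1 he with he | he
    · exact h1 e he
    · rw [List.mem_singleton.1 he]; exact h2
  obtain ⟨h1, h2, h3⟩ := hf
  cases h with
  | rootStart hx => exact cons ⟨h1, h2, trivial⟩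
  | rootFailed hx hw => exact cons ⟨h1, h2, trivial⟩
  | rootOk hx hfin hcn => exact cons ⟨h1, h2, by simpa using h1, Def.all_start h2⟩
  | rootGone hx hgone => exact retryCaller_all hfs
  | loc hq => exact cons ⟨h1, h2, h3.1, (h3.2.local hq).2.2 hnew⟩
  | strictStart hq hx => exact cons ⟨h1, h2, h3⟩
  | strictFailed hq hx hw => exact cons ⟨h1, h2, trivial⟩
  | strictFinal hq hx hfin hcn =>
    exact cons ⟨h1, h2, h3.1, (h3.2.strict hq).2 _ _ (hcn ▸ hc _ _ (h3.2.strict hq).1 hx)⟩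
  | strictEscape hq hx hfin hcn => exact retryCaller_all hfs
  | strictMut hq hx hfin hcn =>
    exact cons ⟨h1, h2, ctxA h3.1 (h3.2.strict hq).1,
      (h3.2.strict hq).2 _ _ (hcn ▸ hc _ _ (h3.2.strict hq).1 hx)⟩
  | strictForce hq hx hfin hcn =>
    have hr := (h3.2.strict hq).1
    have hd := hc _ _ hr hx
    rw [hcn] at hd
    simp only [List.mem_cons, forall_eq_or_imp]
    exact ⟨⟨hr, hd, trivial⟩, ⟨h1, h2, h3⟩, hfs⟩
  | lazyStart hq hx => exact cons ⟨h1, h2, h3⟩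
  | lazyFailed hq hx hw => exact cons ⟨h1, h2, trivial⟩
  | lazyKeep hq hx hs =>
    have hr := (h3.2.lazy hq).1
    refine cons ⟨h1, h2, ?_, (h3.2.lazy hq).2 _ hr⟩
    split
    · exact h3.1
    · exact ctxA h3.1 hr
  | lazyNew hq hx hs =>
    have hr := (h3.2.lazy hq).1
    refine cons ⟨h1, h2, ?_, (h3.2.lazy hq).2 _ (hnew _ le_rfl (by simp))⟩
    split
    · exact h3.1
    · exact ctxA h3.1 hr
  | scxOk hctx hx => exact hfs
  | scxFailed hctx => exact cons ⟨h1, h2, trivial⟩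

/-- A process learns addresses only from the root, from what it holds, from cells it already knows,
and by allocating. The set `A` is arbitrary on purpose: with the allocated addresses this is memory
safety, and with the complement of a set of private cells it says that other processes never
discover them. -/
theorem ProcStep.all {A : Addr → Prop} {M M' : Mem S} {p p' : Proc Pr} {κ : Kind}
    (h : ProcStep M p κ M' p') (hroot : A M.root) (hc : M.heap.Closed A)
    (hnew : ∀ a, M.heap.length ≤ a → a < M'.heap.length → A a) (hp : p.All A) :
    A M'.root ∧ p'.All A := by
  have app : ∀ {l l' : List Addr}, (∀ r ∈ l, A r) → (∀ r ∈ l', A r) → ∀ r ∈ l ++ l', A r := by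
    intro l l' h1 h2 r hr
    exact (List.mem_append.1 hr).elim (h1 r) (h2 r)
  obtain ⟨h1, h2⟩ := hp
  cases h with
  | make hy =>
    exact ⟨hroot, trivial, app h2 (by simpa using hnew _ le_rfl (by simp))⟩
  | invoke hcall =>
    refine ⟨hroot, ?_, h2⟩
    rename_i refs call
    cases call with
    | update o a args => exact fun i r hr => h2 r (hcall i r hr)
    | snapshot => trivial
    | read src => exact fun r hr => h2 r (hcall r hr)
  | post hd => exact ⟨hroot, ⟨h1, hnew _ le_rfl (by simp)⟩, h2⟩
  | casOk hr =>
    rename_i refs call r n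
    refine ⟨h1.2, trivial, app h2 ?_⟩
    cases call with
    | snapshot => simpa [Call.gained] using h1.2
    | _ => simp [Call.gained]
  | casFailed hr => exact ⟨hroot, h1.1, h2⟩
  | readInit =>
    rename_i refs src
    refine ⟨hroot, ⟨?_, by simp⟩, h2⟩
    cases src with
    | none => exact hroot
    | some r => exact h1 r rfl
  | readStart hx => exact ⟨hroot, h1, h2⟩
  | readFailed hx hw => exact ⟨hroot, h1, h2⟩
  | readImm hx hcn =>
    have := hc _ _ h1.1 hx
    rw [hcn, Content.all_imm] at this
    exact ⟨hroot, trivial, app h2 (by simpa [List.mem_ofFn] using this)⟩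
  | readEscape hx hfin hcn => exact ⟨hroot, h1, h2⟩
  | readForce hx hfin hcn =>
    have := hc _ _ h1.1 hx
    rw [hcn] at this
    exact ⟨hroot, ⟨h1.1, by simpa using ⟨h1.1, this, trivial⟩⟩, h2⟩
  | force h =>
    have hh := h1.2
    simp only [List.mem_cons, forall_eq_or_imp] at hh
    exact ⟨hroot, ⟨h1.1, h.all hc hnew hh.1 hh.2⟩, h2⟩

/-! ### Structural invariants -/

/-- A deferred cell has not been changed yet. -/
def Heap.WF (H : Heap S) : Prop :=
  ∀ (a : Addr) (x : Cell S), H[a]? = some x → ∀ d, x.content = .dfr d → x.version = 0 ∧ x.final = false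

/-- The cell at `a` is immediate. -/
def Heap.IsImm (H : Heap S) (a : Addr) : Prop :=
  ∃ (x : Cell S) (i : Imm S), H[a]? = some x ∧ x.content = .imm i

/-- Cells persist, except that a deferred cell may become immediate. -/
def Heap.Le (H H' : Heap S) : Prop :=
  ∀ (a : Addr) (x : Cell S), H[a]? = some x → H'[a]? = some x ∨
    ∃ (x' : Cell S) (i : Imm S) (d : Def S), H'[a]? = some x' ∧ x.content = .dfr d ∧ x'.content = .imm i ∧ x'.version ≠ 0

theorem Heap.Le.refl (H : Heap S) : H.Le H := fun _ _ h => .inl h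

theorem Heap.Le.imm {H H' : Heap S} (h : H.Le H') {a : Addr} {x : Cell S} {i : Imm S}
    (hx : H[a]? = some x) (hi : x.content = .imm i) : H'[a]? = some x := by
  rcases h a x hx with h | ⟨_, _, d, _, hd, _⟩
  · exact h
  · rw [hi] at hd; cases hd

theorem Heap.Le.isImm {H H' : Heap S} (h : H.Le H') {a : Addr} (ha : H.IsImm a) :
    H'.IsImm a := by
  obtain ⟨x, i, hx, hi⟩ := ha
  exact ⟨x, i, h.imm hx hi, hi⟩

theorem Heap.Le.trans {H H' H'' : Heap S} (h : H.Le H') (h' : H'.Le H'') : H.Le H'' := by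
  intro a x hx
  rcases h a x hx with h1 | ⟨x', i, d, h1, hd, hi, hv⟩
  · exact h' a x h1
  · exact .inr ⟨x', i, d, h'.imm h1 hi, hd, hi, hv⟩

theorem Heap.Le.length_le {H H' : Heap S} (h : H.Le H') : H.length ≤ H'.length := by
  by_contra! hlt
  have hx : H[H'.length]? = some H[H'.length] := List.getElem?_eq_getElem hlt
  rcases h _ _ hx with h | ⟨_, _, _, h, _⟩ <;> simp at h

/-- The read set contains the node, as it was before being changed; as long as nodes may be forced,
all other cells of the read set are immediate. -/
def Apply.CtxOk (H : Heap S) (n : Addr) (ctx : List (Addr × ℕ)) : Apply Pr → Prop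
  | .op _ _ _ | .snap _ => (n, 0) ∈ ctx ∧ ∀ e ∈ ctx, e.1 = n ∨ H.IsImm e.1
  | .snapKids i ds => (n, 0) ∈ ctx ∧ ds.length ≤ S.arity i.case
  | .done _ => (n, 0) ∈ ctx

def Phase.WF (H : Heap S) (n : Addr) : Phase Pr → Prop
  | .run ctx q => q.CtxOk H n ctx
  | .llx ctx q _ => q.CtxOk H n ctx ∧ (q.strict? ≠ none ∨ q.lazy? ≠ none)
  | _ => True

/-- The nonzero version in the second alternative makes a node forced by somebody else
distinguishable from the version 0 recorded in the read set. -/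
structure Frame.WF (H : Heap S) (f : Frame Pr) : Prop where
  cell : ∃ x, H[f.node]? = some x ∧
    (x.content = .dfr f.dfr ∨ ∃ i, x.content = .imm i ∧ x.version ≠ 0)
  phase : f.phase.WF H f.node

/-- The lower activation of `force` waits for the node of the upper one. -/
def Frame.Link (f g : Frame Pr) : Prop :=
  ∃ ctx q k, g.phase = .run ctx q ∧ q.strict? = some (f.node, k)

def StackWF (H : Heap S) (fs : List (Frame Pr)) : Prop :=
  (∀ f ∈ fs, f.WF H) ∧ fs.IsChain Frame.Link

def Pc.WF (H : Heap S) : Pc Pr → Prop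
  | .reading _ w fs => (fs ≠ [] → w = none) ∧ StackWF H fs
  | _ => True

structure Mem.WF (M : Mem S) : Prop where
  root : M.root < M.heap.length
  heap : M.heap.WF
  closed : M.heap.Closed (· < M.heap.length)

structure Proc.WF (H : Heap S) (p : Proc Pr) : Prop where
  all : p.All (· < H.length)
  pc : p.pc.WF H

structure Config.WF (C : Config Pr P) : Prop where
  mem : C.mem.WF
  proc : ∀ p, (C.procs p).WF C.mem.heap

/-! ### Preservation of the structural invariants. -/

theorem Apply.CtxOk.mem {H : Heap S} {n : Addr} {ctx : List (Addr × ℕ)} {q : Apply Pr}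
    (h : q.CtxOk H n ctx) : (n, 0) ∈ ctx := by
  cases q with
  | op o s env => exact h.1
  | snap l => exact h.1
  | snapKids i ds => exact h.1
  | done i => exact h

theorem Apply.CtxOk.mono {H H' : Heap S} {n : Addr} {ctx : List (Addr × ℕ)} {q : Apply Pr}
    (h : q.CtxOk H n ctx) (hle : H.Le H') : q.CtxOk H' n ctx := by
  cases q with
  | op o s env => exact ⟨h.1, fun e he => (h.2 e he).imp_right hle.isImm⟩
  | snap l => exact ⟨h.1, fun e he => (h.2 e he).imp_right hle.isImm⟩
  | snapKids i ds => exact h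
  | done i => exact h

theorem Apply.CtxOk.of_strict {H : Heap S} {n r : Addr} {ctx : List (Addr × ℕ)} {q : Apply Pr}
    {k : Imm S → Bool → Apply Pr} (h : q.CtxOk H n ctx) (hq : q.strict? = some (r, k)) :
    ∀ e ∈ ctx, e.1 = n ∨ H.IsImm e.1 := by
  rcases Apply.strict?_eq_some hq with ⟨o, m, s, env, x, k', rfl, -, -, -⟩ | ⟨rfl, -⟩
  · exact h.2
  · exact h.2

theorem Apply.CtxOk.strict {H : Heap S} {n r : Addr} {ctx : List (Addr × ℕ)} {q : Apply Pr}
    {k : Imm S → Bool → Apply Pr} (h : q.CtxOk H n ctx) (hq : q.strict? = some (r, k))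
    (i : Imm S) (b : Bool) : (k i b).CtxOk H n ctx := by
  rcases Apply.strict?_eq_some hq with ⟨o, m, s, env, x, k', rfl, -, -, rfl⟩ | ⟨rfl, rfl⟩
  · exact h
  · cases b
    · exact ⟨h.1, by simp⟩
    · exact h.1

theorem Apply.CtxOk.append {H : Heap S} {n r : Addr} {ctx : List (Addr × ℕ)} {q : Apply Pr}
    {b : ℕ} (h : q.CtxOk H n ctx) (hr : H.IsImm r) : q.CtxOk H n (ctx ++ [(r, b)]) := by
  cases q with
  | op o s env =>
    refine ⟨List.mem_append_left _ h.1, fun e he => ?_⟩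
    rcases List.mem_append.1 he with he | he
    · exact h.2 e he
    · rw [List.mem_singleton.1 he]; exact .inr hr
  | snap l =>
    refine ⟨List.mem_append_left _ h.1, fun e he => ?_⟩
    rcases List.mem_append.1 he with he | he
    · exact h.2 e he
    · rw [List.mem_singleton.1 he]; exact .inr hr
  | snapKids i ds => exact ⟨List.mem_append_left _ h.1, h.2⟩
  | done i => exact List.mem_append_left _ h

/-- The added cells need not be immediate: once the children are being read lazily, nothing more is
forced, and `CtxOk` no longer constrains the rest of the read set. -/
theorem Apply.CtxOk.lazy {H : Heap S} {n r : Addr} {ctx : List (Addr × ℕ)} {q : Apply Pr}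
    {k : Addr → Apply Pr} (h : q.CtxOk H n ctx) (hq : q.lazy? = some (r, k))
    (d : Addr) (l : List (Addr × ℕ)) : (k d).CtxOk H n (ctx ++ l) := by
  obtain ⟨i, ds, hd, rfl, rfl, rfl⟩ := Apply.lazy?_eq_some hq
  refine ⟨List.mem_append_left _ h.1, ?_⟩
  simpa using hd

theorem Apply.CtxOk.local {H H₀ H' : Heap S} {n : Addr} {ctx : List (Addr × ℕ)} {q q' : Apply Pr}
    (h : q.CtxOk H n ctx) (hq : q.local? H₀ = some (H', q')) : q'.CtxOk H n ctx := by
  rcases Apply.local?_eq_some hq with ⟨o, m, s, env, o', a, xs, k, rfl, -, -, rfl⟩ |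
    ⟨o, m, s, env, c, w, xs, k, rfl, -, -, rfl⟩ | ⟨o, m, s, env, c, w, xs, rfl, -, -, rfl⟩ |
    ⟨i, ds, hd, rfl, -, rfl⟩
  · exact h
  · exact h
  · exact h.1
  · exact h.1

theorem Frame.WF.mono {H H' : Heap S} {f : Frame Pr} (h : f.WF H) (hle : H.Le H') : f.WF H' := by
  obtain ⟨⟨x, hx, hc⟩, hp⟩ := h
  refine ⟨?_, ?_⟩
  · rcases hle _ _ hx with h1 | ⟨x', i, d, h1, hd, hi, hv⟩
    · exact ⟨x, h1, hc⟩
    · exact ⟨x', h1, .inr ⟨i, hi, hv⟩⟩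
  · revert hp
    cases f.phase with
    | start => exact id
    | llxRoot w => exact id
    | run ctx q => exact fun hp => Apply.CtxOk.mono hp hle
    | llx ctx q w => exact fun hp => ⟨Apply.CtxOk.mono hp.1 hle, hp.2⟩

theorem Proc.WF.mono {H H' : Heap S} {p : Proc Pr} (h : p.WF H) (hle : H.Le H') : p.WF H' := by
  refine ⟨h.all.mono fun a ha => ha.trans_le hle.length_le, ?_⟩
  have := h.pc
  revert this
  cases p.pc with
  | reading x w fs => exact fun h => ⟨h.1, fun f hf => (h.2.1 f hf).mono hle, h.2.2⟩
  | _ => exact id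

/-- When an activation is about to write, its node is still deferred. -/
theorem Frame.WF.content_of_ctxValid {H : Heap S} {f : Frame Pr} {ctx : List (Addr × ℕ)}
    {q : Apply Pr} (h : f.WF H) (hp : f.phase = .run ctx q) (hctx : CtxValid H ctx) {x : Cell S}
    (hx : H[f.node]? = some x) : x.content = .dfr f.dfr := by
  obtain ⟨⟨y, hy, hc⟩, hph⟩ := h
  rw [hp] at hph
  obtain ⟨z, hz, hv, -⟩ := hctx _ (Apply.CtxOk.mem hph)
  simp only at hz hv
  rw [hx] at hy hz
  cases hy
  cases hz
  exact hc.resolve_right fun ⟨i, _, hne⟩ => hne hv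

/-- A write has just validated version 0 of its node, so it finds the node deferred. This is why no
cell changes twice. -/
theorem HeapChange.le {H H' : Heap S} {use : (Addr → Prop) → Prop} {top : Frame Pr → Prop}
    (h : HeapChange H use top H') (ht : ∀ f, top f → f.WF H) : H.Le H' := by
  cases h with
  | same => exact .refl _
  | alloc y hy =>
    intro a x hx
    left
    rw [List.getElem?_append_left (List.getElem?_eq_some_iff.1 hx).1, hx]
  | write f hf ctx i hphase hctx x hx =>
    intro a z hz
    rw [List.getElem?_set]
    split
    · rename_i hfa
      subst hfa
      rw [hx] at hz
      cases hz
      rw [if_pos (List.getElem?_eq_some_iff.1 hx).1]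
      exact .inr ⟨_, i, f.dfr, rfl, (ht f hf).content_of_ctxValid hphase hctx hx, rfl, by simp⟩
    · exact .inl hz

/-- Cells are born with version 0 and unmarked, and every write leaves its cell immediate. -/
theorem HeapChange.heapWF {H H' : Heap S} {use : (Addr → Prop) → Prop} {top : Frame Pr → Prop}
    (h : HeapChange H use top H') (hw : H.WF) : H'.WF := by
  intro a z hz d hd
  cases h with
  | same => exact hw a z hz d hd
  | alloc y hy =>
    rw [List.getElem?_append] at hz
    split at hz
    · exact hw a z hz d hd
    · rw [List.getElem?_singleton] at hz
      split at hz
      · cases hz; exact ⟨rfl, rfl⟩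
      · cases hz
  | write f hf ctx i hphase hctx x hx =>
    rw [List.getElem?_set] at hz
    split at hz
    · split at hz
      · cases hz; cases hd
      · cases hz
    · exact hw a z hz d hd

theorem isChain_link_cons {f g : Frame Pr} {fs : List (Frame Pr)} (hfg : f.node = g.node)
    (h : (f :: fs).IsChain Frame.Link) : (g :: fs).IsChain Frame.Link := by
  cases fs with
  | nil => exact List.isChain_singleton _
  | cons e fs =>
    rw [List.isChain_cons_cons] at h ⊢
    refine ⟨?_, h.2⟩
    unfold Frame.Link at h ⊢
    rw [← hfg]
    exact h.1

theorem StackWF.retryCaller {H : Heap S} {fs : List (Frame Pr)} (h : StackWF H fs) :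
    StackWF H (retryCaller fs) := by
  cases fs with
  | nil => exact h
  | cons f fs =>
    obtain ⟨h1, h2⟩ := h
    simp only [List.mem_cons, forall_eq_or_imp] at h1
    refine ⟨?_, isChain_link_cons (f := f) rfl h2⟩
    simp only [LazyCow.retryCaller, List.mem_cons, forall_eq_or_imp]
    exact ⟨⟨h1.1.cell, trivial⟩, h1.2⟩

theorem ForceStep.stackWF {H H' : Heap S} {f : Frame Pr} {fs fs' : List (Frame Pr)}
    (h : ForceStep H f fs H' fs') (hH : H.WF) (hw : StackWF H (f :: fs)) : StackWF H fs' := by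
  have tail : StackWF H fs := ⟨fun g hg => hw.1 g (List.mem_cons_of_mem _ hg), hw.2.of_cons⟩
  have cons : ∀ {p : Phase Pr}, p.WF H f.node → StackWF H (⟨f.node, f.dfr, p⟩ :: fs) := by
    intro p hp
    refine ⟨?_, isChain_link_cons (f := f) rfl hw.2⟩
    simp only [List.mem_cons, forall_eq_or_imp]
    exact ⟨⟨(hw.1 f List.mem_cons_self).cell, hp⟩, tail.1⟩
  have hf := hw.1 f List.mem_cons_self
  have hp := hf.phase
  cases h with
  | rootStart hx => exact cons trivial
  | rootFailed hx hne => exact cons trivial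
  | rootOk hx hfin hc =>
    rename_i n d x w
    refine cons ?_
    -- The node is still deferred, so the version recorded by the `LLX` is the 0 that `CtxOk` asks
    -- for.
    have hv := (hH _ _ hx _ hc).1
    cases d with
    | op o a args => exact ⟨by simp [hv], by simp⟩
    | snapshot l => exact ⟨by simp [hv], by simp⟩
  | rootGone hx hgone => exact tail.retryCaller
  | loc hq => exact cons (Apply.CtxOk.local hp hq)
  | strictStart hq hx => exact cons ⟨hp, .inl (by simp [hq])⟩
  | strictFailed hq hx hne => exact cons trivial
  | strictFinal hq hx hfin hc => exact cons (Apply.CtxOk.strict hp.1 hq _ _)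
  | strictEscape hq hx hfin hc => exact tail.retryCaller
  | strictMut hq hx hfin hc => exact cons ((Apply.CtxOk.strict hp.1 hq _ _).append ⟨_, _, hx, hc⟩)
  | strictForce hq hx hfin hc =>
    have h1 := cons (p := .run _ _) hp.1
    refine ⟨?_, List.isChain_cons_cons.2 ⟨⟨_, _, _, rfl, hq⟩, h1.2⟩⟩
    simp only [List.mem_cons, forall_eq_or_imp] at h1 ⊢
    exact ⟨⟨⟨_, hx, .inl hc⟩, trivial⟩, by simpa using h1.1⟩
  | lazyStart hq hx => exact cons ⟨hp, .inr (by simp [hq])⟩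
  | lazyFailed hq hx hne => exact cons trivial
  | lazyKeep hq hx hs =>
    rename_i r k x w
    refine cons ?_
    split
    · have := Apply.CtxOk.lazy hp.1 hq r []
      rw [List.append_nil] at this
      exact this
    · exact Apply.CtxOk.lazy hp.1 hq _ _
  | lazyNew hq hx hs =>
    refine cons ?_
    split
    · have := Apply.CtxOk.lazy hp.1 hq H.length []
      rw [List.append_nil] at this
      exact this
    · exact Apply.CtxOk.lazy hp.1 hq _ _
  | scxOk hctx hx => exact tail
  | scxFailed hctx => exact cons trivial

theorem StackWF.mono {H H' : Heap S} {fs : List (Frame Pr)} (h : StackWF H fs) (hle : H.Le H') :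
    StackWF H' fs := ⟨fun f hf => (h.1 f hf).mono hle, h.2⟩

theorem Proc.WF.top {H : Heap S} {p : Proc Pr} (h : p.WF H) {f : Frame Pr} (hf : p.Top f) :
    f.WF H := by
  obtain ⟨r, w, fs, hpc⟩ := hf
  have := h.pc
  rw [hpc] at this
  exact this.2.1 f List.mem_cons_self

theorem ProcStep.heapLe {M M' : Mem S} {p p' : Proc Pr} {κ : Kind}
    (h : ProcStep M p κ M' p') (hp : p.WF M.heap) : M.heap.Le M'.heap :=
  h.heapChange.le fun _ hf => hp.top hf

theorem Proc.All.top {A : Addr → Prop} {p : Proc Pr} (h : p.All A) {f : Frame Pr}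
    (hf : p.Top f) : f.All A := by
  obtain ⟨r, w, fs, hpc⟩ := hf
  have := h.1
  rw [hpc] at this
  exact this.2 f List.mem_cons_self

theorem ProcStep.wf {M M' : Mem S} {p p' : Proc Pr} {κ : Kind}
    (h : ProcStep M p κ M' p') (hM : M.WF) (hp : p.WF M.heap) : M'.WF ∧ p'.WF M'.heap := by
  have hle := h.heapLe hp
  have hlen := hle.length_le
  have hc : M.heap.Closed (· < M'.heap.length) := by
    intro a x _ hx
    exact (hM.closed a x (List.getElem?_eq_some_iff.1 hx).1 hx).mono
      fun b hb => hb.trans_le hlen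
  have hpA : p.All (· < M'.heap.length) := hp.all.mono fun b hb => hb.trans_le hlen
  have hr : M.root < M'.heap.length := hM.root.trans_le hlen
  obtain ⟨h1, h2⟩ := h.all hr hc (fun a _ ha => ha) hpA
  refine ⟨⟨h1, h.heapChange.heapWF hM.heap,
    h.heapChange.closed hc ⟨hr, hpA⟩ fun f hf => hpA.top hf⟩, h2, ?_⟩
  cases h with
  | force h =>
    have := hp.pc
    refine ⟨fun _ => rfl, ?_⟩
    exact (h.stackWF hM.heap this.2).mono hle
  | readInit => exact ⟨by simp, by simp, List.isChain_nil⟩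
  | readStart hx => exact ⟨by simp, by simp, List.isChain_nil⟩
  | readFailed hx hw => exact ⟨by simp, by simp, List.isChain_nil⟩
  | readEscape hx hfin hc => exact ⟨by simp, by simp, List.isChain_nil⟩
  | readForce hx hfin hcn =>
    refine ⟨by simp, ?_, List.isChain_singleton _⟩
    simp only [List.mem_singleton, forall_eq]
    exact ⟨⟨_, hx, .inl hcn⟩, trivial⟩
  | _ => trivial

/-! ### Reachable configurations satisfy the invariants. -/

theorem Config.Step.wf {C C' : Config Pr P} {p : P} {κ : Kind} (h : Config.Step p κ C C')
    (hC : C.WF) : C'.WF := by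
  have hle := h.1.heapLe (hC.proc p)
  obtain ⟨h1, h2⟩ := h.1.wf hC.mem (hC.proc p)
  refine ⟨h1, fun q => ?_⟩
  by_cases hq : q = p
  · rw [hq]; exact h2
  · rw [h.2 q hq]; exact (hC.proc q).mono hle

theorem Config.Initial.wf {C : Config Pr P} (h : C.Initial) : C.WF := by
  obtain ⟨h1, h2, h3⟩ := h
  refine ⟨⟨h2, fun a x hx d hd => ?_, fun a x ha hx => ?_⟩, fun p => ?_⟩
  · obtain ⟨i, rfl, -⟩ := h1 a x hx
    cases hd
  · obtain ⟨i, rfl, hi⟩ := h1 a x hx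
    exact Content.all_imm.2 fun j => (hi j).trans ha
  · rw [h3 p]
    exact ⟨⟨trivial, by simp⟩, trivial⟩

theorem Config.Reachable.wf {C : Config Pr P} (h : C.Reachable) : C.WF := by
  obtain ⟨C₀, h0, h⟩ := h
  induction h with
  | refl => exact h0.wf
  | tail _ h ih =>
    obtain ⟨p, κ, h⟩ := h
    exact h.wf ih

/-! ### Pending operations are never blocked -/

/-- The success rules of an `LLX` do not inspect the version seen at its start, so the failure rules
are never needed to find a step. A deferred cell met by `readStrict` is not final, so it can be
forced. -/
theorem ForceStep.exists_of_wf {H : Heap S} {f : Frame Pr} (fs : List (Frame Pr)) (hH : H.WF)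
    (hA : f.All (· < H.length)) (hf : f.WF H) : ∃ H' fs', ForceStep H f fs H' fs' := by
  obtain ⟨n, d, ph⟩ := f
  obtain ⟨⟨x, hx, -⟩, hp⟩ := hf
  have get : ∀ {r : Addr}, r < H.length → ∃ y : Cell S, H[r]? = some y :=
    fun h => ⟨_, List.getElem?_eq_getElem h⟩
  cases ph with
  | start => exact ⟨_, _, .rootStart hx⟩
  | llxRoot w =>
    by_cases h : x.final = true ∨ x.content ≠ .dfr d
    · exact ⟨_, _, .rootGone hx h⟩
    · push Not at h
      exact ⟨_, _, .rootOk hx (by simpa using h.1) h.2⟩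
  | run ctx q =>
    cases q with
    | op o s env =>
      cases hact : (Pr.opDef o).act s with
      | read y k =>
        obtain ⟨z, hz⟩ := get (hA.phase.2 y)
        exact ⟨_, _, .strictStart (r := env y) (by simp only [Apply.strict?, hact]; rfl) hz⟩
      | call o' a xs k => exact ⟨_, _, .loc (by simp only [Apply.local?, hact]; rfl)⟩
      | mk c w xs k => exact ⟨_, _, .loc (by simp only [Apply.local?, hact]; rfl)⟩
      | ret c w xs => exact ⟨_, _, .loc (by simp only [Apply.local?, hact]; rfl)⟩
    | snap l =>
      obtain ⟨z, hz⟩ := get (r := l) hA.phase.2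
      exact ⟨_, _, .strictStart rfl hz⟩
    | snapKids i ds =>
      rcases Nat.lt_or_eq_of_le hp.2 with h | h
      · obtain ⟨z, hz⟩ := get (hA.phase.2.1 ⟨ds.length, h⟩)
        exact ⟨_, _, .lazyStart (by simp only [Apply.lazy?, h, dite_true]; rfl) hz⟩
      · exact ⟨_, _, .loc (by simp only [Apply.local?, h, dite_true]; rfl)⟩
    | done i =>
      by_cases h : CtxValid H ctx
      · exact ⟨_, _, .scxOk h hx⟩
      · exact ⟨_, _, .scxFailed h⟩
  | llx ctx q w =>
    rcases hp.2 with h | h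
    · obtain ⟨⟨r, k⟩, hq⟩ := Option.ne_none_iff_exists'.1 h
      obtain ⟨z, hz⟩ := get (hA.phase.2.strict hq).1
      cases hc : z.content with
      | imm i =>
        cases hfin : z.final
        · exact ⟨_, _, .strictMut hq hz hfin hc⟩
        · exact ⟨_, _, .strictFinal hq hz hfin hc⟩
      | dfr d' => exact ⟨_, _, .strictForce hq hz (hH _ _ hz _ hc).2 hc⟩
    · obtain ⟨⟨r, k⟩, hq⟩ := Option.ne_none_iff_exists'.1 h
      obtain ⟨z, hz⟩ := get (hA.phase.2.lazy hq).1
      cases hs : z.snapshotted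
      · exact ⟨_, _, .lazyNew hq hz hs⟩
      · exact ⟨_, _, .lazyKeep hq hz hs⟩

theorem ProcStep.exists_of_wf {M : Mem S} {p : Proc Pr} (hM : M.WF) (hp : p.WF M.heap)
    (hne : p.pc ≠ .idle) : ∃ κ M' p', ProcStep M p κ M' p' := by
  obtain ⟨pc, refs⟩ := p
  cases pc with
  | idle => exact absurd rfl hne
  | start call =>
    cases call with
    | update o a args => exact ⟨_, _, _, .post rfl⟩
    | snapshot => exact ⟨_, _, _, .post rfl⟩
    | read src => exact ⟨_, _, _, .readInit⟩
  | cas call r n =>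
    by_cases h : M.root = r
    · exact ⟨_, _, _, .casOk h⟩
    · exact ⟨_, _, _, .casFailed h⟩
  | reading r w fs =>
    have hr : ∃ x : Cell S, M.heap[r]? = some x :=
      ⟨_, List.getElem?_eq_getElem (show r < M.heap.length from hp.all.1.1)⟩
    obtain ⟨x, hx⟩ := hr
    cases fs with
    | cons f fs =>
      obtain rfl : w = none := hp.pc.1 (by simp)
      obtain ⟨H', fs', h⟩ := ForceStep.exists_of_wf fs hM.heap
        (hp.all.1.2 f List.mem_cons_self) (hp.pc.2.1 f List.mem_cons_self)
      exact ⟨_, _, _, .force h⟩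
    | nil =>
      cases w with
      | none => exact ⟨_, _, _, .readStart hx⟩
      | some w =>
        cases hc : x.content with
        | imm i => exact ⟨_, _, _, .readImm hx hc⟩
        | dfr d => exact ⟨_, _, _, .readForce hx (hM.heap _ _ hx _ hc).2 hc⟩

theorem Config.WF.exists_step {C : Config Pr P} (hC : C.WF) {p : P}
    (hne : (C.procs p).pc ≠ .idle) : ∃ κ C', Config.Step p κ C C' := by
  classical
  obtain ⟨κ, M', p', h⟩ := ProcStep.exists_of_wf hC.mem (hC.proc p) hne
  refine ⟨κ, ⟨M', Function.update C.procs p p'⟩, ?_, fun q hq => ?_⟩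
  · simpa using h
  · simp [hq]

/-! ### Cost of sequential evaluation -/

/-- Sequential evaluation, counting the steps of all bodies that are run. -/
inductive EvalN (Pr : Program S) :
    (o : S.Op) → {m : ℕ} → (Pr.opDef o).St m → (Fin m → Tree S) → Tree S → ℕ → Prop
  | read {o : S.Op} {m : ℕ} {s : (Pr.opDef o).St m} {ts : Fin m → Tree S} {t : Tree S} {x : Fin m}
      {k : (c : S.Case) → S.Val c → (Pr.opDef o).St (m + S.arity c)}
      {c : S.Case} {w : S.Val c} {cs : Fin (S.arity c) → Tree S} {N : ℕ}
      (hact : (Pr.opDef o).act s = .read x k) (hx : ts x = .node c w cs)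
      (hk : EvalN Pr o (k c w) (Fin.append ts cs) t N) : EvalN Pr o s ts t (N + 1)
  | call {o : S.Op} {m : ℕ} {s : (Pr.opDef o).St m} {ts : Fin m → Tree S} {t t' : Tree S}
      {o' : S.Op} {a : S.Arg o'} {xs : Fin (S.opArity o') → Fin m} {k : (Pr.opDef o).St (m + 1)}
      {N N' : ℕ} (hact : (Pr.opDef o).act s = .call o' a xs k)
      (hcall : EvalN Pr o' ((Pr.opDef o').init a) (fun i => ts (xs i)) t' N')
      (hk : EvalN Pr o k (Fin.snoc (α := fun _ => Tree S) ts t') t N) :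
      EvalN Pr o s ts t (N + N' + 1)
  | mk {o : S.Op} {m : ℕ} {s : (Pr.opDef o).St m} {ts : Fin m → Tree S} {t : Tree S}
      {c : S.Case} {w : S.Val c} {xs : Fin (S.arity c) → Fin m} {k : (Pr.opDef o).St (m + 1)}
      {N : ℕ} (hact : (Pr.opDef o).act s = .mk c w xs k)
      (hk : EvalN Pr o k
        (Fin.snoc (α := fun _ => Tree S) ts (.node c w fun i => ts (xs i))) t N) :
      EvalN Pr o s ts t (N + 1)
  | ret {o : S.Op} {m : ℕ} {s : (Pr.opDef o).St m} {ts : Fin m → Tree S}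
      {c : S.Case} {w : S.Val c} {xs : Fin (S.arity c) → Fin m}
      (hact : (Pr.opDef o).act s = .ret c w xs) :
      EvalN Pr o s ts (.node c w fun i => ts (xs i)) 0

theorem Eval.exists_evalN {o : S.Op} {m : ℕ} {s : (Pr.opDef o).St m} {ts : Fin m → Tree S}
    {t : Tree S} (h : Eval Pr o s ts t) : ∃ N, EvalN Pr o s ts t N := by
  induction h with
  | read hact hx hk ih => exact ⟨_, .read hact hx ih.choose_spec⟩
  | call hact hcall hk ih1 ih2 => exact ⟨_, .call hact ih1.choose_spec ih2.choose_spec⟩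
  | mk hact hk ih => exact ⟨_, .mk hact ih.choose_spec⟩
  | ret hact => exact ⟨_, .ret hact⟩

/-- Bodies are deterministic. This identifies the cost charged to a deferred cell at its allocation
with the cost of that call in the evaluation of the caller. -/
theorem EvalN.unique {o : S.Op} {m : ℕ} {s : (Pr.opDef o).St m} {ts : Fin m → Tree S}
    {t t' : Tree S} {N N' : ℕ} (h : EvalN Pr o s ts t N) (h' : EvalN Pr o s ts t' N') :
    t = t' ∧ N = N' := by
  induction h generalizing t' N' with
  | read hact hx hk ih =>
    cases h' with
    | read hact' hx' hk' =>
      rw [hact] at hact'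
      cases hact'
      rw [hx] at hx'
      cases hx'
      obtain ⟨rfl, rfl⟩ := ih hk'
      exact ⟨rfl, rfl⟩
    | call hact' _ _ => rw [hact] at hact'; cases hact'
    | mk hact' _ => rw [hact] at hact'; cases hact'
    | ret hact' => rw [hact] at hact'; cases hact'
  | call hact hcall hk ih1 ih2 =>
    cases h' with
    | call hact' hcall' hk' =>
      rw [hact] at hact'
      cases hact'
      obtain ⟨rfl, rfl⟩ := ih1 hcall'
      obtain ⟨rfl, rfl⟩ := ih2 hk'
      exact ⟨rfl, rfl⟩
    | read hact' _ _ => rw [hact] at hact'; cases hact'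
    | mk hact' _ => rw [hact] at hact'; cases hact'
    | ret hact' => rw [hact] at hact'; cases hact'
  | mk hact hk ih =>
    cases h' with
    | mk hact' hk' =>
      rw [hact] at hact'
      cases hact'
      obtain ⟨rfl, rfl⟩ := ih hk'
      exact ⟨rfl, rfl⟩
    | call hact' _ _ => rw [hact] at hact'; cases hact'
    | read hact' _ _ => rw [hact] at hact'; cases hact'
    | ret hact' => rw [hact] at hact'; cases hact'
  | ret hact =>
    cases h' with
    | ret hact' =>
      rw [hact] at hact'
      cases hact'
      exact ⟨rfl, rfl⟩
    | call hact' _ _ => rw [hact] at hact'; cases hact'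
    | mk hact' _ => rw [hact] at hact'; cases hact'
    | read hact' _ _ => rw [hact] at hact'; cases hact'

/-- The number of nodes of a tree. -/
def Tree.size : Tree S → ℕ
  | .node _ _ ch => 1 + ∑ j, (ch j).size

theorem Tree.size_child_lt {c : S.Case} {w : S.Val c} (ch : Fin (S.arity c) → Tree S)
    (j : Fin (S.arity c)) : (ch j).size < (Tree.node c w ch).size := by
  have := Finset.single_le_sum (f := fun j => (ch j).size) (fun _ _ => Nat.zero_le _)
    (Finset.mem_univ j)
  simp only [Tree.size]
  omega

/-! ### Values and ranks of cells -/

/-- Values `V` and ranks `ρ` of cells are such that the cell `a` may have these contents: evaluating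
them sequentially gives `V a`, and the rank of `a` exceeds the ranks of all cells that they mention
by more than the cost of the evaluation. -/
def Content.Ok (Pr : Program S) (V : Addr → Tree S) (ρ : Addr → ℕ) (a : Addr) : Content S → Prop
  | .imm i => V a = .node i.case i.val (fun j => V (i.children j)) ∧
      ∀ j, ρ (i.children j) < ρ a
  | .dfr (.op o b args) => ∃ N B, EvalN Pr o ((Pr.opDef o).init b) (fun j => V (args j)) (V a) N ∧
      (∀ j, ρ (args j) ≤ B) ∧ B + N < ρ a
  | .dfr (.snapshot l) => V a = V l ∧ ρ l + (V l).size < ρ a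

/-- Upper bound on the rank of a cell allocated with these contents. -/
def Content.RankLe (Pr : Program S) (V : Addr → Tree S) (ρ : Addr → ℕ) (a : Addr) :
    Content S → Prop
  | .imm i => ∀ B, (∀ j, ρ (i.children j) ≤ B) → ρ a ≤ B + 1
  | .dfr (.op o b args) => ∃ N, EvalN Pr o ((Pr.opDef o).init b) (fun j => V (args j)) (V a) N ∧
      ∀ B, (∀ j, ρ (args j) ≤ B) → ρ a ≤ B + N + 1
  | .dfr (.snapshot l) => ρ a ≤ ρ l + (V l).size + 1

/-- Addresses do not serve as a well-founded order here, because a forced cell may mention cells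
younger than itself; ranks do. -/
theorem Content.Ok.rank_lt {V : Addr → Tree S} {ρ : Addr → ℕ} {a b : Addr} {y : Content S}
    (h : y.Ok Pr V ρ a) (hb : y.Dep b) : ρ b < ρ a := by
  match y, h, hb with
  | .imm i, h, ⟨j, hj⟩ => exact hj ▸ h.2 j
  | .dfr (.op o c args), ⟨N, B, _, h1, h2⟩, ⟨j, hj⟩ =>
    have := h1 j
    rw [hj] at this
    omega
  | .dfr (.snapshot l), h, hb =>
    obtain rfl : l = b := hb
    have := h.2
    omega

/-- The step function is total and sees `default` at indices not below `a`; this is harmless below,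
where contents at allocation mention only older addresses. -/
theorem exists_strong_rec {α : Type*} [Inhabited α] (F : ℕ → (ℕ → α) → α) :
    ∃ W : ℕ → α, ∀ a, W a = F a fun b => if b < a then W b else default := by
  let G : (a : ℕ) → ((b : ℕ) → b < a → α) → α :=
    fun a ih => F a fun b => if h : b < a then ih b h else default
  refine ⟨fun a => Nat.lt_wfRel.wf.fix G a, fun a => ?_⟩
  show Nat.lt_wfRel.wf.fix G a = _
  rw [WellFounded.fix_eq]
  simp only [G]
  congr 1

/-- Given the contents of cells at their allocation, the values and ranks exist. -/
theorem exists_value_rank (hterm : Pr.Terminates) [Nonempty (Tree S)] (birth : Addr → Content S)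
    (hbirth : ∀ a, (birth a).All (· < a)) : ∃ (V : Addr → Tree S) (ρ : Addr → ℕ),
      ∀ a, (birth a).Ok Pr V ρ a ∧ (birth a).RankLe Pr V ρ a := by
  have hN : ∀ (o : S.Op) (b : S.Arg o) (ts : Fin (S.opArity o) → Tree S), ∃ z : Tree S × ℕ,
      EvalN Pr o ((Pr.opDef o).init b) ts z.1 z.2 := fun o b ts =>
    have ⟨t, ht⟩ := hterm o b ts
    have ⟨N, hN⟩ := ht.exists_evalN
    ⟨(t, N), hN⟩
  choose ev hev using hN
  have : Inhabited (Tree S × ℕ) := ⟨(Classical.arbitrary _, 0)⟩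
  -- The rank is the largest rank mentioned, plus the cost of the evaluation, plus one for
  -- strictness. For a snapshot the size of the tree plays the part of the cost, since new snapshot
  -- nodes may be created all the way down.
  let F : ℕ → (ℕ → Tree S × ℕ) → Tree S × ℕ := fun a W =>
    match birth a with
    | .imm i => (.node i.case i.val fun j => (W (i.children j)).1,
        (Finset.univ.sup fun j => (W (i.children j)).2) + 1)
    | .dfr (.op o b args) => ((ev o b fun j => (W (args j)).1).1,
        (Finset.univ.sup fun j => (W (args j)).2) + (ev o b fun j => (W (args j)).1).2 + 1)
    | .dfr (.snapshot l) => ((W l).1, (W l).2 + (W l).1.size + 1)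
  obtain ⟨W, hW⟩ := exists_strong_rec F
  refine ⟨fun a => (W a).1, fun a => (W a).2, fun a => ?_⟩
  have h1 := hW a
  have h2 := hbirth a
  simp only [F] at h1
  cases hb : birth a with
  | imm i =>
    rw [hb] at h1 h2
    simp only [Content.all_imm] at h2
    simp only [h2, if_true] at h1
    simp only [Content.Ok, Content.RankLe, h1, true_and]
    refine ⟨fun j => Nat.lt_succ_of_le ?_, fun B hB => Nat.succ_le_succ ?_⟩
    · exact Finset.le_sup (f := fun j => (W (i.children j)).2) (Finset.mem_univ j)
    · exact Finset.sup_le fun j _ => hB j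
  | dfr d =>
    cases d with
    | op o b args =>
      rw [hb] at h1 h2
      simp only [Content.all_op] at h2
      simp only [h2, if_true] at h1
      simp only [Content.Ok, Content.RankLe, h1]
      refine ⟨⟨_, _, hev o b _, fun j => ?_, Nat.lt_succ_self _⟩, ⟨_, hev o b _, fun B hB => ?_⟩⟩
      · exact Finset.le_sup (f := fun j => (W (args j)).2) (Finset.mem_univ j)
      · exact Nat.succ_le_succ (Nat.add_le_add_right (Finset.sup_le fun j _ => hB j) _)
    | snapshot l =>
      rw [hb] at h1 h2
      simp only [Content.all_snapshot] at h2
      simp only [h2, if_true] at h1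
      simp only [Content.Ok, Content.RankLe, h1, true_and]
      omega

/-! ### Computations preserve values and ranks -/

/-- The computation for the cell `n` has the value of `n`. -/
def Apply.Ok (V : Addr → Tree S) (ρ : Addr → ℕ) (n : Addr) : Apply Pr → Prop
  | .op o s env => ∃ N B, EvalN Pr o s (fun j => V (env j)) (V n) N ∧
      (∀ j, ρ (env j) ≤ B) ∧ B + N < ρ n
  | .snap l => V n = V l ∧ ρ l + (V l).size < ρ n
  | .snapKids i ds => V n = .node i.case i.val (fun j => V (i.children j)) ∧
      (∀ j, ρ (i.children j) + (V (i.children j)).size + 1 < ρ n) ∧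
      (∀ j (hj : j < ds.length) (hj' : j < S.arity i.case), V ds[j] = V (i.children ⟨j, hj'⟩)) ∧
      ∀ d ∈ ds, ρ d < ρ n
  | .done i => (Content.imm i).Ok Pr V ρ n

def Phase.Ok (V : Addr → Tree S) (ρ : Addr → ℕ) (n : Addr) : Phase Pr → Prop
  | .run _ q => q.Ok V ρ n
  | .llx _ q _ => q.Ok V ρ n
  | _ => True

/-- The deferred contents are tracked apart from the heap, because another process may overwrite the
node while this activation is running. -/
structure Frame.Ok (V : Addr → Tree S) (ρ : Addr → ℕ) (f : Frame Pr) : Prop where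
  dfr : (Content.dfr f.dfr).Ok Pr V ρ f.node
  phase : f.phase.Ok V ρ f.node

def Heap.Ok (Pr : Program S) (V : Addr → Tree S) (ρ : Addr → ℕ) (H : Heap S) : Prop :=
  ∀ (a : Addr) (x : Cell S), H[a]? = some x → x.content.Ok Pr V ρ a

def Pc.Ok (V : Addr → Tree S) (ρ : Addr → ℕ) : Pc Pr → Prop
  | .reading _ _ fs => ∀ f ∈ fs, f.Ok V ρ
  | _ => True

variable {V : Addr → Tree S} {ρ : Addr → ℕ}

/-- This is the descent behind the induction in `pops`: a node forced on behalf of another one has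
smaller rank. -/
theorem Apply.Ok.rank_strict {n r : Addr} {q : Apply Pr} {k : Imm S → Bool → Apply Pr}
    (h : q.Ok V ρ n) (hq : q.strict? = some (r, k)) : ρ r < ρ n := by
  rcases Apply.strict?_eq_some hq with ⟨o, m, s, env, x, k', rfl, -, rfl, -⟩ | ⟨rfl, -⟩
  · obtain ⟨N, B, -, h1, h2⟩ := h
    have := h1 x
    omega
  · have := h.2
    omega

/-- Bound on the number of steps of a computation, without those of the nodes it forces. -/
def Apply.CostLe (V : Addr → Tree S) (n : Addr) (K : ℕ) : Apply Pr → Prop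
  | .op o s env => ∃ N, EvalN Pr o s (fun j => V (env j)) (V n) N ∧ N < K
  | .snap _ => ∃ c w ch, V n = .node c w ch ∧ S.arity c + 1 < K
  | .snapKids i ds => S.arity i.case - ds.length < K
  | .done _ => True

theorem Apply.Ok.exists_costLe {n : Addr} {q : Apply Pr} (h : q.Ok V ρ n) :
    ∃ K, q.CostLe V n K := by
  cases q with
  | op o s env =>
    obtain ⟨N, B, h, -⟩ := h
    exact ⟨N + 1, N, h, Nat.lt_succ_self N⟩
  | snap l =>
    cases hV : V n with
    | node c w ch => exact ⟨_, c, w, ch, hV, Nat.lt_succ_self _⟩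
  | snapKids i ds => exact ⟨_, Nat.lt_succ_self _⟩
  | done i => exact ⟨0, trivial⟩

theorem Fin.append_comp {α β : Type*} {m n : ℕ} (f : α → β) (a : Fin m → α) (b : Fin n → α) :
    (fun j => f (Fin.append a b j)) = Fin.append (fun j => f (a j)) (fun j => f (b j)) := by
  funext j
  refine Fin.addCases (fun j => ?_) (fun j => ?_) j <;> simp

theorem Fin.snoc_comp {α β : Type*} {m : ℕ} (f : α → β) (a : Fin m → α) (b : α) :
    (fun j => f (Fin.snoc (α := fun _ => α) a b j)) =
      Fin.snoc (α := fun _ => β) (fun j => f (a j)) (f b) := by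
  funext j
  refine Fin.lastCases ?_ (fun j => ?_) j <;> simp

/-- Reading uses up one unit of cost, and the children found have smaller rank than the cell read,
so the bound `B` survives. For a snapshot, passing to a child lowers both rank and size; the two
units gained leave room for the `+ 1` of a new snapshot node, strictly below `n`. -/
theorem Apply.Ok.strict {n r : Addr} {q : Apply Pr} {k : Imm S → Bool → Apply Pr} {i : Imm S}
    (h : q.Ok V ρ n) (hq : q.strict? = some (r, k)) (hi : (Content.imm i).Ok Pr V ρ r)
    (b : Bool) : (k i b).Ok V ρ n ∧
      ∀ K, q.CostLe V n K → ∃ K', K' + 1 = K ∧ (k i b).CostLe V n K' := by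
  rcases Apply.strict?_eq_some hq with ⟨o, m, s, env, x, k', rfl, hact, rfl, rfl⟩ | ⟨rfl, rfl⟩
  · obtain ⟨N, B, hE, hB, hlt⟩ := h
    have key : ∃ N', N' + 1 = N ∧ EvalN Pr o (k' i.case i.val)
        (fun j => V (Fin.append env i.children j)) (V n) N' := by
      -- The tree index must be a variable for the inversion of `EvalN` to unify.
      generalize V n = v at hE ⊢
      cases hE with
      | read hact' hx hk =>
        rw [hact] at hact'
        cases hact'
        simp only [hi.1] at hx
        cases hx
        exact ⟨_, rfl, by rw [Fin.append_comp V]; exact hk⟩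
      | call hact' _ _ => rw [hact] at hact'; cases hact'
      | mk hact' _ => rw [hact] at hact'; cases hact'
      | ret hact' => rw [hact] at hact'; cases hact'
    obtain ⟨N', rfl, hN'⟩ := key
    refine ⟨⟨N', B, hN', ?_, by omega⟩, fun K ⟨N'', hN'', hK⟩ => ?_⟩
    · intro j
      refine Fin.addCases (fun j => ?_) (fun j => ?_) j
      · simpa using hB j
      · have h1 := hi.2 j
        have h2 := hB x
        simp only [Fin.append_right]
        omega
    · obtain ⟨-, rfl⟩ := hE.unique hN''
      exact ⟨K - 1, by omega, N', hN', by omega⟩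
  · obtain ⟨hV, hρ⟩ := h
    have hVn := hV.trans hi.1
    have hK : ∀ K, (Apply.snap r : Apply Pr).CostLe V n K → S.arity i.case + 1 < K := by
      rintro K ⟨c, w, ch, hc, hlt⟩
      rw [hVn] at hc
      cases hc
      exact hlt
    cases b
    · refine ⟨⟨hVn, fun j => ?_, by simp, by simp⟩, fun K h => ⟨K - 1, ?_, ?_⟩⟩
      · have h1 := hi.2 j
        have h2 := Tree.size_child_lt (w := i.val) (fun j => V (i.children j)) j
        rw [← hi.1] at h2
        omega
      · have := hK K h; omega
      · have := hK K h
        simp only [Bool.false_eq_true, if_false, Apply.CostLe, List.length_nil]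
        omega
    · refine ⟨⟨hVn, fun j => ?_⟩, fun K h => ⟨K - 1, ?_, trivial⟩⟩
      · have h1 := hi.2 j
        omega
      · have := hK K h; omega

/-- The bound on `ρ d` covers both outcomes of `readLazy`: the child itself, and a fresh snapshot of
it. -/
theorem Apply.Ok.lazy {n r d : Addr} {q : Apply Pr} {k : Addr → Apply Pr}
    (h : q.Ok V ρ n) (hq : q.lazy? = some (r, k)) (hV : V d = V r)
    (hd : ρ d ≤ ρ r + (V r).size + 1) : (k d).Ok V ρ n ∧
      ∀ K, q.CostLe V n K → ∃ K', K' + 1 = K ∧ (k d).CostLe V n K' := by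
  obtain ⟨i, ds, hds, rfl, rfl, rfl⟩ := Apply.lazy?_eq_some hq
  obtain ⟨h1, h2, h3, h4⟩ := h
  refine ⟨⟨h1, h2, fun j hj hj' => ?_, fun e he => ?_⟩, fun K hK => ⟨K - 1, ?_, ?_⟩⟩
  · rw [List.getElem_append]
    split
    · exact h3 j _ hj'
    · rename_i hnlt
      obtain rfl : j = ds.length := by simp at hj; omega
      simpa using hV
  · rcases List.mem_append.1 he with he | he
    · exact h4 e he
    · rw [List.mem_singleton.1 he]
      exact hd.trans_lt (h2 _)
  · have : S.arity i.case - ds.length < K := hK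
    omega
  · have : S.arity i.case - ds.length < K := hK
    simp only [Apply.CostLe, List.length_append, List.length_singleton]
    omega

/-- A call exchanges cost for rank. If the callee costs `M`, the new deferred cell has rank at most
`B + M + 1`, while the cost to come drops by exactly `M + 1`, so bound plus cost is unchanged. A
construction does the same with a single unit. -/
theorem Apply.Ok.local {n : Addr} {q q' : Apply Pr} {H H' : Heap S}
    (h : q.Ok V ρ n) (hq : q.local? H = some (H', q'))
    (hnew : ∀ (a : Addr) (x : Cell S), H.length ≤ a → H'[a]? = some x →
      x.content.Ok Pr V ρ a ∧ x.content.RankLe Pr V ρ a) : q'.Ok V ρ n ∧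
      ∀ K, q.CostLe V n K → ∃ K', K' + 1 = K ∧ q'.CostLe V n K' := by
  have snoc : ∀ {m : ℕ} {env : Fin m → Addr} {B C : ℕ}, (∀ j, ρ (env j) ≤ B) → B ≤ C →
      ρ H.length ≤ C → ∀ j, ρ (Fin.snoc (α := fun _ => Addr) env H.length j) ≤ C := by
    intro m env B C hB hBC hC j
    refine Fin.lastCases ?_ (fun j => ?_) j
    · simpa using hC
    · simpa using (hB j).trans hBC
  rcases Apply.local?_eq_some hq with ⟨o, m, s, env, o', a, xs, k, rfl, hact, rfl, rfl⟩ |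
    ⟨o, m, s, env, c, w, xs, k, rfl, hact, rfl, rfl⟩ |
    ⟨o, m, s, env, c, w, xs, rfl, hact, rfl, rfl⟩ | ⟨i, ds, hd, rfl, rfl, rfl⟩
  · obtain ⟨-, M, hM, hρ⟩ := hnew H.length _ le_rfl (by simp; rfl)
    obtain ⟨N, B, hE, hB, hlt⟩ := h
    have key : ∃ N', N' + M + 1 = N ∧ EvalN Pr o k
        (fun j => V (Fin.snoc (α := fun _ => Addr) env H.length j)) (V n) N' := by
      generalize V n = v at hE ⊢
      cases hE with
      | call hact' hcall hk =>
        rw [hact] at hact'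
        cases hact'
        obtain ⟨rfl, rfl⟩ := hcall.unique hM
        exact ⟨_, rfl, by rw [Fin.snoc_comp V]; exact hk⟩
      | read hact' _ _ => rw [hact] at hact'; cases hact'
      | mk hact' _ => rw [hact] at hact'; cases hact'
      | ret hact' => rw [hact] at hact'; cases hact'
    obtain ⟨N', rfl, hN'⟩ := key
    refine ⟨⟨N', B + M + 1, hN', ?_, by omega⟩, fun K ⟨N'', hN'', hK⟩ => ?_⟩
    · exact snoc hB (by omega) (hρ B fun j => hB _)
    · obtain ⟨-, rfl⟩ := hE.unique hN''
      exact ⟨K - 1, by omega, N', hN', by omega⟩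
  · obtain ⟨hM, hρ⟩ := hnew H.length _ le_rfl (by simp; rfl)
    obtain ⟨N, B, hE, hB, hlt⟩ := h
    have key : ∃ N', N' + 1 = N ∧ EvalN Pr o k
        (fun j => V (Fin.snoc (α := fun _ => Addr) env H.length j)) (V n) N' := by
      generalize V n = v at hE ⊢
      cases hE with
      | mk hact' hk =>
        rw [hact] at hact'
        cases hact'
        exact ⟨_, rfl, by rw [Fin.snoc_comp V, hM.1]; exact hk⟩
      | read hact' _ _ => rw [hact] at hact'; cases hact'
      | call hact' _ _ => rw [hact] at hact'; cases hact'
      | ret hact' => rw [hact] at hact'; cases hact'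
    obtain ⟨N', rfl, hN'⟩ := key
    refine ⟨⟨N', B + 1, hN', ?_, by omega⟩, fun K ⟨N'', hN'', hK⟩ => ?_⟩
    · exact snoc hB (by omega) (hρ B fun j => hB _)
    · obtain ⟨-, rfl⟩ := hE.unique hN''
      exact ⟨K - 1, by omega, N', hN', by omega⟩
  · obtain ⟨N, B, hE, hB, hlt⟩ := h
    have key : V n = .node c w fun j => V (env (xs j)) := by
      generalize V n = v at hE ⊢
      cases hE with
      | ret hact' =>
        rw [hact] at hact'
        cases hact'
        rfl
      | read hact' _ _ => rw [hact] at hact'; cases hact'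
      | call hact' _ _ => rw [hact] at hact'; cases hact'
      | mk hact' _ => rw [hact] at hact'; cases hact'
    refine ⟨⟨key, fun j => ?_⟩, fun K ⟨N', _, hK⟩ => ⟨K - 1, by omega, trivial⟩⟩
    have := hB (xs j)
    show ρ (env (xs j)) < ρ n
    omega
  · obtain ⟨h1, h2, h3, h4⟩ := h
    refine ⟨⟨?_, fun j => h4 _ (List.getElem_mem _)⟩, fun K hK => ⟨K - 1, ?_, trivial⟩⟩
    · rw [h1]
      congr 1
      funext j
      exact (h3 j _ j.2).symm
    · have : S.arity i.case - ds.length < K := hK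
      omega

theorem Frame.Ok.start {f : Frame Pr} (h : f.Ok V ρ) :
    (f.dfr.start Pr).Ok V ρ f.node := by
  obtain ⟨n, d, ph⟩ := f
  have := h.dfr
  cases d with
  | op o a args => exact this
  | snapshot l => exact this

theorem retryCaller_ok {fs : List (Frame Pr)} (h : ∀ g ∈ fs, g.Ok V ρ) :
    ∀ g ∈ retryCaller fs, g.Ok V ρ := by
  cases fs with
  | nil => exact h
  | cons f fs =>
    simp only [retryCaller, List.mem_cons, forall_eq_or_imp] at h ⊢
    exact ⟨⟨h.1.dfr, trivial⟩, h.2⟩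

theorem ForceStep.ok {H H' : Heap S} {f : Frame Pr} {fs fs' : List (Frame Pr)}
    (h : ForceStep H f fs H' fs') (hH : H.Ok Pr V ρ)
    (hnew : ∀ (a : Addr) (x : Cell S), H.length ≤ a → H'[a]? = some x →
      x.content.Ok Pr V ρ a ∧ x.content.RankLe Pr V ρ a)
    (hf : f.Ok V ρ) (hfs : ∀ g ∈ fs, g.Ok V ρ) : ∀ g ∈ fs', g.Ok V ρ := by
  have cons : ∀ {g : Frame Pr}, g.Ok V ρ → ∀ g' ∈ g :: fs, g'.Ok V ρ := by
    intro g hg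
    simpa using ⟨hg, hfs⟩
  have hstart := hf.start
  obtain ⟨h1, h2⟩ := hf
  cases h with
  | rootStart hx => exact cons ⟨h1, trivial⟩
  | rootFailed hx hw => exact cons ⟨h1, trivial⟩
  | rootOk hx hfin hcn => exact cons ⟨h1, hstart⟩
  | rootGone hx hgone => exact retryCaller_ok hfs
  | loc hq => exact cons ⟨h1, (Apply.Ok.local h2 hq hnew).1⟩
  | strictStart hq hx => exact cons ⟨h1, h2⟩
  | strictFailed hq hx hw => exact cons ⟨h1, trivial⟩
  | strictFinal hq hx hfin hcn =>
    exact cons ⟨h1, (Apply.Ok.strict h2 hq (hcn ▸ hH _ _ hx) _).1⟩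
  | strictEscape hq hx hfin hcn => exact retryCaller_ok hfs
  | strictMut hq hx hfin hcn =>
    exact cons ⟨h1, (Apply.Ok.strict h2 hq (hcn ▸ hH _ _ hx) _).1⟩
  | strictForce hq hx hfin hcn =>
    have hd := hH _ _ hx
    rw [hcn] at hd
    simp only [List.mem_cons, forall_eq_or_imp]
    exact ⟨⟨hd, trivial⟩, ⟨h1, h2⟩, hfs⟩
  | lazyStart hq hx => exact cons ⟨h1, h2⟩
  | lazyFailed hq hx hw => exact cons ⟨h1, trivial⟩
  | lazyKeep hq hx hs => exact cons ⟨h1, (Apply.Ok.lazy h2 hq rfl (by omega)).1⟩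
  | lazyNew hq hx hs =>
    obtain ⟨h3, h4⟩ := hnew H.length _ le_rfl (by simp; rfl)
    exact cons ⟨h1, (Apply.Ok.lazy h2 hq h3.1 h4).1⟩
  | scxOk hctx hx => exact hfs
  | scxFailed hctx => exact cons ⟨h1, trivial⟩

/-- For a finished computation `Apply.Ok` is the condition on the contents about to be written, so
forcing a cell changes neither its value nor its rank. -/
theorem HeapChange.ok {H H' : Heap S} {use : (Addr → Prop) → Prop} {top : Frame Pr → Prop}
    (h : HeapChange H use top H') (hH : H.Ok Pr V ρ) (ht : ∀ f, top f → f.Ok V ρ)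
    (hnew : ∀ (a : Addr) (x : Cell S), H.length ≤ a → H'[a]? = some x →
      x.content.Ok Pr V ρ a) : H'.Ok Pr V ρ := by
  intro a z hz
  rcases le_or_gt H.length a with ha | ha
  · exact hnew a z ha hz
  cases h with
  | same => exact hH a z hz
  | alloc y hy =>
    rw [List.getElem?_append_left ha] at hz
    exact hH a z hz
  | write f hf ctx i hphase hctx x hx =>
    rw [List.getElem?_set] at hz
    split at hz
    · rename_i hfa
      subst hfa
      split at hz
      · cases hz
        have := (ht f hf).phase
        rw [hphase] at this
        exact this
      · exact absurd ha ‹_›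
    · exact hH a z hz

theorem Pc.Ok.top {p : Proc Pr} (h : p.pc.Ok V ρ) {f : Frame Pr} (hf : p.Top f) : f.Ok V ρ := by
  obtain ⟨r, w, fs, hpc⟩ := hf
  rw [hpc] at h
  exact h f List.mem_cons_self

theorem ProcStep.ok {M M' : Mem S} {p p' : Proc Pr} {κ : Kind} (h : ProcStep M p κ M' p')
    (hH : M.heap.Ok Pr V ρ) (hp : p.pc.Ok V ρ)
    (hnew : ∀ (a : Addr) (x : Cell S), M.heap.length ≤ a → M'.heap[a]? = some x →
      x.content.Ok Pr V ρ a ∧ x.content.RankLe Pr V ρ a) :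
    M'.heap.Ok Pr V ρ ∧ p'.pc.Ok V ρ := by
  refine ⟨h.heapChange.ok hH (fun f hf => Pc.Ok.top hp hf) fun a x ha hx => (hnew a x ha hx).1, ?_⟩
  cases h with
  | force h =>
    simp only [Pc.Ok, List.mem_cons, forall_eq_or_imp] at hp
    exact h.ok hH hnew hp.1 hp.2
  | readForce hx hfin hcn =>
    have := hH _ _ hx
    rw [hcn] at this
    simp only [Pc.Ok, List.mem_singleton, forall_eq]
    exact ⟨this, trivial⟩
  | readInit => simp [Pc.Ok]
  | readStart _ => simp [Pc.Ok]
  | readFailed _ _ => simp [Pc.Ok]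
  | readEscape _ _ _ => simp [Pc.Ok]
  | _ => trivial

/-! ### Inversion of steps of a process -/

theorem ProcStep.of_idle {M M' : Mem S} {p p' : Proc Pr} {κ : Kind} (h : ProcStep M p κ M' p')
    (hp : p.pc = .idle) :
    (κ = .client ∧ p'.pc = .idle) ∨ ∃ call, p'.pc = .start call := by
  cases h with
  | make hy => exact .inl ⟨rfl, rfl⟩
  | invoke hc => exact .inr ⟨_, rfl⟩
  | _ => cases hp

theorem ProcStep.of_start {M M' : Mem S} {p p' : Proc Pr} {κ : Kind} {call : Call S}
    (h : ProcStep M p κ M' p') (hp : p.pc = .start call) :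
    (∃ x, p'.pc = .reading x none []) ∨ ∃ n, p'.pc = .cas call M.root n := by
  cases h with
  | post hd => cases hp; exact .inr ⟨_, rfl⟩
  | readInit => exact .inl ⟨_, rfl⟩
  | _ => cases hp

theorem ProcStep.of_cas {M M' : Mem S} {p p' : Proc Pr} {κ : Kind} {call : Call S} {r n : Addr}
    (h : ProcStep M p κ M' p') (hp : p.pc = .cas call r n) :
    κ = .complete ∨ (M.root ≠ r ∧ p'.pc = .start call) := by
  cases h with
  | casOk hr => exact .inl rfl
  | casFailed hr => cases hp; exact .inr ⟨hr, rfl⟩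
  | _ => cases hp

theorem ProcStep.of_reading_none {M M' : Mem S} {p p' : Proc Pr} {κ : Kind} {x : Addr}
    (h : ProcStep M p κ M' p') (hp : p.pc = .reading x none []) :
    ∃ z, M.heap[x]? = some z ∧ M' = M ∧ p'.pc = .reading x (some z.version) [] := by
  cases h with
  | readStart hx => cases hp; exact ⟨_, hx, rfl, rfl⟩
  | _ => cases hp

theorem ProcStep.of_reading_some {M M' : Mem S} {p p' : Proc Pr} {κ : Kind} {x : Addr} {w : ℕ}
    (h : ProcStep M p κ M' p') (hp : p.pc = .reading x (some w) []) :
    κ = .complete ∨ ∃ z, M.heap[x]? = some z ∧ M' = M ∧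
      ((z.version ≠ w ∧ p'.pc = .reading x none []) ∨
        ∃ d, z.content = .dfr d ∧ ((z.final = true ∧ p'.pc = .reading x none []) ∨
          p'.pc = .reading x none [⟨x, d, .start⟩])) := by
  cases h with
  | readFailed hx hw => cases hp; exact .inr ⟨_, hx, rfl, .inl ⟨hw, rfl⟩⟩
  | readImm hx hc => exact .inl rfl
  | readEscape hx hfin hc => cases hp; exact .inr ⟨_, hx, rfl, .inr ⟨_, hc, .inl ⟨hfin, rfl⟩⟩⟩
  | readForce hx hfin hc => cases hp; exact .inr ⟨_, hx, rfl, .inr ⟨_, hc, .inr rfl⟩⟩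
  | _ => cases hp

theorem ProcStep.of_reading_cons {M M' : Mem S} {p p' : Proc Pr} {κ : Kind} {x : Addr}
    {f : Frame Pr} {fs : List (Frame Pr)} (h : ProcStep M p κ M' p')
    (hp : p.pc = .reading x none (f :: fs)) :
    ∃ fs', ForceStep M.heap f fs M'.heap fs' ∧ M'.root = M.root ∧
      p'.pc = .reading x none fs' := by
  cases h with
  | force h => cases hp; exact ⟨_, h, rfl, rfl⟩
  | _ => cases hp

theorem ProcStep.root_eq {M M' : Mem S} {p p' : Proc Pr} {κ : Kind} (h : ProcStep M p κ M' p')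
    (hκ : κ ≠ .complete) : M'.root = M.root := by
  cases h with
  | casOk hr => exact absurd rfl hκ
  | _ => rfl

/-! ### Executions -/

namespace IsExecution

variable {C : ℕ → Config Pr P} {sched : ℕ → P} {kind : ℕ → Kind}

theorem wf (hE : IsExecution C sched kind) (n : ℕ) : (C n).WF := by
  induction n with
  | zero => exact hE.init.wf
  | succ n ih => exact (hE.step n).wf ih

theorem le_succ (hE : IsExecution C sched kind) (n : ℕ) :
    (C n).mem.heap.Le (C (n + 1)).mem.heap :=
  (hE.step n).1.heapLe ((hE.wf n).proc _)

theorem le (hE : IsExecution C sched kind) {m n : ℕ} (hmn : m ≤ n) :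
    (C m).mem.heap.Le (C n).mem.heap := by
  induction hmn with
  | refl => exact .refl _
  | step _ ih => exact ih.trans (hE.le_succ _)

/-- In the initial heap children have smaller addresses, so the cell at address 0 is a leaf. -/
theorem nonempty_tree (hE : IsExecution C sched kind) : Nonempty (Tree S) := by
  obtain ⟨h1, h2, -⟩ := hE.init
  obtain ⟨i, -, hi⟩ := h1 0 _ (List.getElem?_eq_getElem (Nat.zero_lt_of_lt h2))
  exact ⟨.node i.case i.val fun j => absurd (hi j) (Nat.not_lt_zero _)⟩

/-- Heaps only grow, so an address is allocated at most once and its first contents are a function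
on addresses for the whole execution. Such contents refer to cells allocated earlier. -/
theorem exists_birth (hE : IsExecution C sched kind) : ∃ birth : Addr → Content S,
    (∀ a, (birth a).All (· < a)) ∧
    (∀ (a : Addr) (x : Cell S), (C 0).mem.heap[a]? = some x → birth a = x.content) ∧
    ∀ (n : ℕ) (a : Addr) (x : Cell S), (C n).mem.heap.length ≤ a →
      (C (n + 1)).mem.heap[a]? = some x → birth a = x.content := by
  suffices h : ∀ a, ∃ y : Content S, y.All (· < a) ∧
      (∀ x : Cell S, (C 0).mem.heap[a]? = some x → y = x.content) ∧
      ∀ (n : ℕ) (x : Cell S), (C n).mem.heap.length ≤ a →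
        (C (n + 1)).mem.heap[a]? = some x → y = x.content by
    choose birth hb using h
    exact ⟨birth, fun a => (hb a).1, fun a => (hb a).2.1, fun n a => (hb a).2.2 n⟩
  intro a
  by_cases h0 : a < (C 0).mem.heap.length
  · have hx := List.getElem?_eq_getElem h0
    refine ⟨(C 0).mem.heap[a].content, ?_, fun x h => ?_, fun n x h => ?_⟩
    · obtain ⟨i, hi, hlt⟩ := hE.init.1 a _ hx
      rw [hi]
      exact Content.all_imm.2 hlt
    · rw [hx] at h; cases h; rfl
    · exact absurd (h0.trans_le (hE.le (Nat.zero_le n)).length_le) (not_lt.2 h)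
  by_cases hex : ∃ n, (C n).mem.heap.length ≤ a ∧ a < (C (n + 1)).mem.heap.length
  · obtain ⟨n, h1, h2⟩ := hex
    have hx := List.getElem?_eq_getElem h2
    have hwf := hE.wf n
    refine ⟨(C (n + 1)).mem.heap[a].content, ?_, fun x h => ?_, fun m x h h' => ?_⟩
    · exact ((hE.step n).1.heapChange.new_all (A := (· < (C n).mem.heap.length))
        ⟨hwf.mem.root, (hwf.proc _).all⟩ h1 hx).mono fun b hb => hb.trans_le h1
    · exact absurd (List.getElem?_eq_some_iff.1 h).1 h0
    · have h'' := (List.getElem?_eq_some_iff.1 h').1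
      rcases lt_trichotomy m n with hmn | rfl | hmn
      · exact absurd (h''.trans_le (hE.le hmn).length_le) (not_lt.2 h1)
      · rw [hx] at h'; cases h'; rfl
      · exact absurd (h2.trans_le (hE.le hmn).length_le) (not_lt.2 h)
  -- An address that is never allocated is given the childless contents of cell 0.
  · push Not at hex
    obtain ⟨h1, h2, -⟩ := hE.init
    have hx := List.getElem?_eq_getElem (Nat.zero_lt_of_lt h2)
    obtain ⟨i, -, hi⟩ := h1 0 _ hx
    refine ⟨.imm i, Content.all_imm.2 fun j => absurd (hi j) (Nat.not_lt_zero _), fun x h => ?_,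
      fun n x h h' => ?_⟩
    · exact absurd (List.getElem?_eq_some_iff.1 h).1 h0
    · exact absurd (List.getElem?_eq_some_iff.1 h').1 (not_lt.2 (hex n h))

/-- Values and ranks that are valid throughout an execution. -/
def Ok (C : ℕ → Config Pr P) (V : Addr → Tree S) (ρ : Addr → ℕ) : Prop :=
  ∀ n, (C n).mem.heap.Ok Pr V ρ ∧ (∀ p, ((C n).procs p).pc.Ok V ρ) ∧
    ∀ (a : Addr) (x : Cell S), (C n).mem.heap.length ≤ a → (C (n + 1)).mem.heap[a]? = some x →
      x.content.Ok Pr V ρ a ∧ x.content.RankLe Pr V ρ a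

theorem exists_ok (hE : IsExecution C sched kind) (hterm : Pr.Terminates) :
    ∃ (V : Addr → Tree S) (ρ : Addr → ℕ), Ok C V ρ := by
  have := hE.nonempty_tree
  obtain ⟨birth, h1, h2, h3⟩ := hE.exists_birth
  obtain ⟨V, ρ, h⟩ := exists_value_rank hterm birth h1
  have hnew : ∀ (n : ℕ) (a : Addr) (x : Cell S), (C n).mem.heap.length ≤ a →
      (C (n + 1)).mem.heap[a]? = some x → x.content.Ok Pr V ρ a ∧ x.content.RankLe Pr V ρ a :=
    fun n a x ha hx => h3 n a x ha hx ▸ h a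
  refine ⟨V, ρ, fun n => and_assoc.1 ⟨?_, hnew n⟩⟩
  induction n with
  | zero =>
    refine ⟨fun a x hx => h2 a x hx ▸ (h a).1, fun p => ?_⟩
    rw [hE.init.2.2 p]
    trivial
  | succ n ih =>
    obtain ⟨h4, h5⟩ := (hE.step n).1.ok ih.1 (ih.2 _) (hnew n)
    refine ⟨h4, fun p => ?_⟩
    by_cases hp : p = sched n
    · rw [hp]; exact h5
    · rw [(hE.step n).2 p hp]; exact ih.2 p

/-- A process that keeps moving takes a next step. -/
theorem exists_next (hE : IsExecution C sched kind) {p : P} (hp : ∀ n, ∃ m ≥ n, sched m = p)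
    (n : ℕ) : ∃ m ≥ n, sched m = p ∧ (C m).procs p = (C n).procs p := by
  classical
  let m := Nat.find (hp n)
  obtain ⟨h1, h2⟩ : m ≥ n ∧ sched m = p := Nat.find_spec (hp n)
  refine ⟨m, h1, h2, ?_⟩
  have key : ∀ k, n ≤ k → k ≤ m → (C k).procs p = (C n).procs p := by
    intro k hk
    induction k, hk using Nat.le_induction with
    | base => exact fun _ => rfl
    | succ k hk ih =>
      intro hkm
      have hne : p ≠ sched k := fun h => Nat.find_min (hp n) (m := k) hkm ⟨hk, h.symm⟩
      rw [(hE.step k).2 p hne, ih (Nat.le_of_succ_le hkm)]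
  exact key m h1 le_rfl

/-! ### Cells that can be reached over time -/

/-- At some time, `a` mentions `b`. -/
def Edge (C : ℕ → Config Pr P) (a b : Addr) : Prop :=
  ∃ (n : ℕ) (x : Cell S), (C n).mem.heap[a]? = some x ∧ x.content.Dep b

/-- Over all times a cell has at most one deferred and at most one immediate contents, each
mentioning finitely many cells. -/
theorem finite_edge (hE : IsExecution C sched kind) (a : Addr) : {b | Edge C a b}.Finite := by
  have hi : {y : Content S | ∃ i, y = .imm i ∧ ∃ (n : ℕ) (x : Cell S),
      (C n).mem.heap[a]? = some x ∧ x.content = y}.Subsingleton := by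
    rintro _ ⟨i, rfl, n, x, hx, hc⟩ _ ⟨j, rfl, m, z, hz, hd⟩
    have h1 := (hE.le (le_max_left n m)).imm hx hc
    have h2 := (hE.le (le_max_right n m)).imm hz hd
    rw [h1] at h2
    cases h2
    exact hc.symm.trans hd
  have hd : {y : Content S | ∃ d, y = .dfr d ∧ ∃ (n : ℕ) (x : Cell S),
      (C n).mem.heap[a]? = some x ∧ x.content = y}.Subsingleton := by
    have key : ∀ {n m : ℕ} {x z : Cell S} {d d' : Def S}, n ≤ m →
        (C n).mem.heap[a]? = some x → x.content = .dfr d →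
        (C m).mem.heap[a]? = some z → z.content = .dfr d' → d = d' := by
      intro n m x z d d' hnm hx hc hz hd
      rcases hE.le hnm a x hx with h | ⟨x', i, _, h, _, hi, _⟩
      · rw [hz] at h; cases h; rw [hc] at hd; cases hd; rfl
      · rw [hz] at h; cases h; rw [hi] at hd; cases hd
    rintro _ ⟨d, rfl, n, x, hx, hc⟩ _ ⟨e, rfl, m, z, hz, hd⟩
    rcases le_total n m with h | h
    · rw [key h hx hc hz hd]
    · rw [key h hz hd hx hc]
  refine ((hi.finite.union hd.finite).biUnion fun y _ => y.finite_dep).subset ?_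
  rintro b ⟨n, x, hx, hb⟩
  simp only [Set.mem_iUnion]
  refine ⟨x.content, ?_, hb⟩
  cases hc : x.content with
  | imm i => exact .inl ⟨i, rfl, n, x, hx, hc⟩
  | dfr d => exact .inr ⟨d, rfl, n, x, hx, hc⟩

/-- König's argument: mentions branch finitely and decrease the rank. -/
theorem finite_reach (hE : IsExecution C sched kind) {V : Addr → Tree S} {ρ : Addr → ℕ}
    (hok : ∀ n, (C n).mem.heap.Ok Pr V ρ) (a : Addr) :
    {b | Relation.ReflTransGen (Edge C) a b}.Finite := by
  induction h : ρ a using Nat.strong_induction_on generalizing a with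
  | _ k ih =>
    subst h
    refine ((Set.finite_singleton a).union ((hE.finite_edge a).biUnion
      (t := fun b => {c | Relation.ReflTransGen (Edge C) b c}) fun b hb => ?_)).subset ?_
    · obtain ⟨n, x, hx, hd⟩ := hb
      exact ih _ ((hok n a x hx).rank_lt hd) b rfl
    · intro c hc
      rcases Relation.ReflTransGen.cases_head hc with rfl | ⟨b, hb, hbc⟩
      · exact .inl rfl
      · exact .inr (Set.mem_biUnion hb hbc)

theorem exists_const (hE : IsExecution C sched kind) (a : Addr) :
    ∃ c, ∀ᶠ n in Filter.atTop, (C n).mem.heap[a]? = c := by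
  by_cases h1 : ∃ n, (C n).mem.heap.IsImm a
  · obtain ⟨n, x, i, hx, hi⟩ := h1
    exact ⟨some x, Filter.eventually_atTop.2 ⟨n, fun m hm => (hE.le hm).imm hx hi⟩⟩
  by_cases h2 : ∃ n, ∃ x : Cell S, (C n).mem.heap[a]? = some x
  · obtain ⟨n, x, hx⟩ := h2
    refine ⟨some x, Filter.eventually_atTop.2 ⟨n, fun m hm => ?_⟩⟩
    rcases hE.le hm a x hx with h | ⟨x', i, _, h, _, hi, _⟩
    · exact h
    · exact absurd ⟨m, x', i, h, hi⟩ h1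
  · push Not at h2
    exact ⟨none, Filter.Eventually.of_forall fun n => Option.eq_none_iff_forall_ne_some.2 (h2 n)⟩

/-- Finitely many cells lie in a set that is closed at all times and eventually never changes. -/
theorem exists_frozen (hE : IsExecution C sched kind) {V : Addr → Tree S} {ρ : Addr → ℕ}
    (hok : ∀ n, (C n).mem.heap.Ok Pr V ρ) {D : Set Addr} (hD : D.Finite) :
    ∃ (F : Set Addr) (T : ℕ), D ⊆ F ∧ (∀ n, (C n).mem.heap.Closed (· ∈ F)) ∧
      ∀ n ≥ T, ∀ a ∈ F, (C (n + 1)).mem.heap[a]? = (C n).mem.heap[a]? := by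
  -- Reachability uses mentions at any time, past or future. This makes `F` closed in every heap at
  -- once, and its finiteness gives a common time after which all its cells are constant.
  let F := ⋃ a ∈ D, {b | Relation.ReflTransGen (Edge C) a b}
  have hF : F.Finite := hD.biUnion fun a _ => hE.finite_reach hok a
  choose c hc using hE.exists_const
  have hT := (Filter.eventually_all_finite hF).2 fun a _ => hc a
  obtain ⟨T, hT⟩ := Filter.eventually_atTop.1 hT
  refine ⟨F, T, fun a ha => Set.mem_biUnion ha .refl, fun n a x ha hx b hb => ?_,
    fun n hn a ha => ?_⟩
  · simp only [F, Set.mem_iUnion] at ha ⊢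
    obtain ⟨d, hd, hda⟩ := ha
    exact ⟨d, hd, hda.tail ⟨n, x, hx, hb⟩⟩
  · rw [hT n hn a ha, hT (n + 1) (hn.trans n.le_succ) a ha]

end IsExecution

/-! ### Stacks of activations -/

/-- How a step changes the stack: it changes the phase of the topmost activation, possibly pushing
another one for a deferred node, or it pops the topmost activation, with its node immediate. -/
theorem ForceStep.shape {H H' : Heap S} {f : Frame Pr} {fs fs' : List (Frame Pr)}
    (h : ForceStep H f fs H' fs') (hH : H.WF) (hf : f.WF H) :
    (∃ ph, fs' = ⟨f.node, f.dfr, ph⟩ :: fs ∧ H'[f.node]? = H[f.node]?) ∨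
    (∃ ph g y, fs' = g :: ⟨f.node, f.dfr, ph⟩ :: fs ∧ H' = H ∧ H[g.node]? = some y ∧
      y.content = .dfr g.dfr) ∨
    (fs' = fs ∧ H'.IsImm f.node) ∨
    (fs' = retryCaller fs ∧ H' = H ∧ H.IsImm f.node) := by
  have hlt : f.node < H.length := by
    obtain ⟨x, hx, -⟩ := hf.cell
    exact (List.getElem?_eq_some_iff.1 hx).1
  cases h with
  | rootGone hx hgone =>
    refine .inr (.inr (.inr ⟨rfl, rfl, ?_⟩))
    obtain ⟨z, hz, hc⟩ := hf.cell
    simp only at hz hc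
    rw [hx] at hz
    cases hz
    -- A node that still holds its deferred contents is not final, so `force` is abandoned only when
    -- the node is already immediate.
    rcases hc with hc | ⟨i, hi, -⟩
    · rcases hgone with h | h
      · rw [(hH _ _ hx _ hc).2] at h; cases h
      · exact absurd hc h
    · exact ⟨_, i, hx, hi⟩
  | loc hq =>
    refine .inl ⟨_, rfl, ?_⟩
    rcases (Apply.All.local (A := fun _ => True) (by
      rename_i q _; cases q <;> simp [Apply.All]) hq).1 with rfl | ⟨y, rfl⟩
    · rfl
    · rw [List.getElem?_append_left hlt]
  | strictEscape hq hx hfin hc => rw [(hH _ _ hx _ hc).2] at hfin; cases hfin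
  | strictForce hq hx hfin hc => exact .inr (.inl ⟨_, _, _, rfl, rfl, hx, hc⟩)
  | lazyNew hq hx hs =>
    refine .inl ⟨_, rfl, ?_⟩
    rw [List.getElem?_append_left hlt]
  | scxOk hctx hx =>
    refine .inr (.inr (.inl ⟨rfl, _, _, List.getElem?_set_self hlt, rfl⟩))
  | _ => exact .inl ⟨_, rfl, rfl⟩

theorem retryCaller_append {fs below : List (Frame Pr)} (h : fs ≠ []) :
    retryCaller (fs ++ below) = retryCaller fs ++ below := by
  cases fs with
  | nil => exact absurd rfl h
  | cons f fs => rfl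

/-- A step leaves the lower part of the stack alone, unless it pops the last activation above. -/
theorem ForceStep.of_append {H H' : Heap S} {f : Frame Pr} {fs below fs' : List (Frame Pr)}
    (h : ForceStep H f (fs ++ below) H' fs') :
    (∃ fs'', fs'' ≠ [] ∧ fs' = fs'' ++ below ∧ ForceStep H f fs H' fs'') ∨
      (fs = [] ∧ (fs' = below ∨ fs' = retryCaller below)) := by
  cases h with
  | rootStart hx => exact .inl ⟨_, by simp, rfl, .rootStart hx⟩
  | rootFailed hx hw => exact .inl ⟨_, by simp, rfl, .rootFailed hx hw⟩
  | rootOk hx hfin hc => exact .inl ⟨_, by simp, rfl, .rootOk hx hfin hc⟩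
  | rootGone hx hgone =>
    by_cases hfs : fs = []
    · subst hfs
      exact .inr ⟨rfl, .inr rfl⟩
    · refine .inl ⟨_, ?_, retryCaller_append hfs, .rootGone hx hgone⟩
      cases fs with
      | nil => exact absurd rfl hfs
      | cons g fs => simp [retryCaller]
  | loc hq => exact .inl ⟨_, by simp, rfl, .loc hq⟩
  | strictStart hq hx => exact .inl ⟨_, by simp, rfl, .strictStart hq hx⟩
  | strictFailed hq hx hw => exact .inl ⟨_, by simp, rfl, .strictFailed hq hx hw⟩
  | strictFinal hq hx hfin hc => exact .inl ⟨_, by simp, rfl, .strictFinal hq hx hfin hc⟩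
  | strictEscape hq hx hfin hc =>
    by_cases hfs : fs = []
    · subst hfs
      exact .inr ⟨rfl, .inr rfl⟩
    · refine .inl ⟨_, ?_, retryCaller_append hfs, .strictEscape hq hx hfin hc⟩
      cases fs with
      | nil => exact absurd rfl hfs
      | cons g fs => simp [retryCaller]
  | strictMut hq hx hfin hc => exact .inl ⟨_, by simp, rfl, .strictMut hq hx hfin hc⟩
  | strictForce hq hx hfin hc => exact .inl ⟨_, by simp, rfl, .strictForce hq hx hfin hc⟩
  | lazyStart hq hx => exact .inl ⟨_, by simp, rfl, .lazyStart hq hx⟩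
  | lazyFailed hq hx hw => exact .inl ⟨_, by simp, rfl, .lazyFailed hq hx hw⟩
  | lazyKeep hq hx hs => exact .inl ⟨_, by simp, rfl, .lazyKeep hq hx hs⟩
  | lazyNew hq hx hs => exact .inl ⟨_, by simp, rfl, .lazyNew hq hx hs⟩
  | scxOk hctx hx =>
    by_cases hfs : fs = []
    · subst hfs
      exact .inr ⟨rfl, .inl rfl⟩
    · exact .inl ⟨_, hfs, rfl, .scxOk hctx hx⟩
  | scxFailed hctx => exact .inl ⟨_, by simp, rfl, .scxFailed hctx⟩

theorem Frame.Link.rank_lt {V : Addr → Tree S} {ρ : Addr → ℕ} {f g : Frame Pr}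
    (h : f.Link g) (hg : g.Ok V ρ) : ρ f.node < ρ g.node := by
  obtain ⟨ctx, q, k, hp, hq⟩ := h
  have := hg.phase
  rw [hp] at this
  exact Apply.Ok.rank_strict this hq

/-- Ranks of nodes increase strictly from the top of the stack to the bottom. -/
theorem StackWF.pairwise {H : Heap S} {V : Addr → Tree S} {ρ : Addr → ℕ} {fs : List (Frame Pr)}
    (h : StackWF H fs) (hok : ∀ f ∈ fs, f.Ok V ρ) :
    fs.Pairwise fun f g => ρ f.node < ρ g.node := by
  obtain ⟨-, h⟩ := h
  induction fs with
  | nil => exact .nil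
  | cons f fs ih =>
    have ih := ih (fun g hg => hok g (List.mem_cons_of_mem _ hg)) h.of_cons
    refine List.pairwise_cons.2 ⟨fun g hg => ?_, ih⟩
    cases fs with
    | nil => cases hg
    | cons e fs =>
      have hfe := (List.isChain_cons_cons.1 h).1.rank_lt
        (hok e (List.mem_cons_of_mem _ List.mem_cons_self))
      rcases List.mem_cons.1 hg with rfl | hg
      · exact hfe
      · exact hfe.trans ((List.pairwise_cons.1 ih).1 g hg)

/-! ### Progress of a single attempt -/

/-- Measure of the work left in an attempt, given that forced nodes get immediate. -/
def Apply.WorkLe (V : Addr → Tree S) (H : Heap S) (n : Addr) (M : ℕ) (q : Apply Pr) : Prop :=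
  ∃ K, q.CostLe V n K ∧
    (4 * K + 2 ≤ M ∨ (4 * K ≤ M ∧ ∀ r k, q.strict? = some (r, k) → H.IsImm r))

/-- One unit of `CostLe` pays for four steps: starting and ending an `LLX` that finds a deferred
node (measures `4K + 3` and `4K + 2`), then, after the force, starting and ending the second `LLX`
(`4K + 1` and `4K`). The next unit starts at `4K - 1`. The phases before `apply` are left to
`restarts`. -/
def Phase.WorkLe (V : Addr → Tree S) (H : Heap S) (n : Addr) (M : ℕ) : Phase Pr → Prop
  | .run _ q => ∃ M', M' + 1 = M ∧ q.WorkLe V H n M'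
  | .llx _ q _ => q.WorkLe V H n M
  | _ => False

theorem Apply.WorkLe.mono {V : Addr → Tree S} {H H' : Heap S} {n : Addr} {M : ℕ} {q : Apply Pr}
    (h : q.WorkLe V H n M) (hle : H.Le H') : q.WorkLe V H' n M := by
  obtain ⟨K, hK, h⟩ := h
  exact ⟨K, hK, h.imp_right fun h => ⟨h.1, fun r k hq => hle.isImm (h.2 r k hq)⟩⟩

theorem Phase.WorkLe.mono {V : Addr → Tree S} {H H' : Heap S} {n : Addr} {M : ℕ} {ph : Phase Pr}
    (h : ph.WorkLe V H n M) (hle : H.Le H') : ph.WorkLe V H' n M := by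
  cases ph with
  | run ctx q => exact h.imp fun M' h => ⟨h.1, h.2.mono hle⟩
  | llx ctx q w => exact Apply.WorkLe.mono h hle
  | _ => exact h

/-- After a step of the topmost activation, less work is left, or the attempt is over. -/
theorem ForceStep.workLe {V : Addr → Tree S} {ρ : Addr → ℕ} {H H' : Heap S} {f : Frame Pr}
    {fs fs' : List (Frame Pr)} {M : ℕ} (h : ForceStep H f fs H' fs') (hH : H.Ok Pr V ρ)
    (hwf : H.WF) (hnew : ∀ (a : Addr) (x : Cell S), H.length ≤ a → H'[a]? = some x →
      x.content.Ok Pr V ρ a ∧ x.content.RankLe Pr V ρ a) (hf : f.Ok V ρ)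
    (hM : f.phase.WorkLe V H f.node M) :
    (∃ M' < M, ∃ ph, Phase.WorkLe V H' f.node M' ph ∧ fs' = ⟨f.node, f.dfr, ph⟩ :: fs) ∨
    fs' = ⟨f.node, f.dfr, .start⟩ :: fs ∨ fs' = fs ∨
    (∃ M' < M, ∃ ph g, fs' = g :: ⟨f.node, f.dfr, ph⟩ :: fs ∧ ρ g.node < ρ f.node ∧
      ∀ H'' : Heap S, H''.IsImm g.node → ph.WorkLe V H'' f.node M') := by
  have hok := hf.phase
  have run : ∀ {q q' : Apply Pr} {ctx : List (Addr × ℕ)}, q.WorkLe V H f.node M →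
      (∀ K, q.CostLe V f.node K → ∃ K', K' + 1 = K ∧ q'.CostLe V f.node K') →
      ∃ M' < M, Phase.WorkLe V H' f.node M' (.run ctx q') := by
    rintro q q' ctx ⟨K, hK, hM⟩ h
    obtain ⟨K', rfl, hK'⟩ := h K hK
    exact ⟨4 * K' + 3, by omega, 4 * K' + 2, rfl, K', hK', .inl le_rfl⟩
  cases h with
  | rootStart hx => exact hM.elim
  | rootFailed hx hw => exact .inr (.inl rfl)
  | rootOk hx hfin hcn => exact hM.elim
  | rootGone hx hgone => exact hM.elim
  | loc hq =>
    obtain ⟨M', rfl, K, hK, hM⟩ := hM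
    obtain ⟨K', rfl, hK'⟩ := (Apply.Ok.local hok hq hnew).2 K hK
    exact .inl ⟨4 * K' + 3, by omega, .run _ _, ⟨4 * K' + 2, rfl, K', hK', .inl le_rfl⟩, rfl⟩
  | strictStart hq hx =>
    obtain ⟨M', rfl, hM⟩ := hM
    exact .inl ⟨M', by omega, .llx _ _ _, hM, rfl⟩
  | strictFailed hq hx hw => exact .inr (.inl rfl)
  | strictFinal hq hx hfin hcn =>
    obtain ⟨M', h1, h2⟩ := run hM (Apply.Ok.strict hok hq (hcn ▸ hH _ _ hx) _).2
    exact .inl ⟨M', h1, _, h2, rfl⟩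
  | strictEscape hq hx hfin hcn => rw [(hwf _ _ hx _ hcn).2] at hfin; cases hfin
  | strictMut hq hx hfin hcn =>
    obtain ⟨M', h1, h2⟩ := run hM (Apply.Ok.strict hok hq (hcn ▸ hH _ _ hx) _).2
    exact .inl ⟨M', h1, _, h2, rfl⟩
  | strictForce hq hx hfin hcn =>
    obtain ⟨K, hK, hM⟩ := hM
    refine .inr (.inr (.inr ⟨4 * K + 1, ?_, _, _, rfl, Apply.Ok.rank_strict hok hq,
      fun H'' hr => ⟨4 * K, rfl, K, hK, .inr ⟨le_rfl, fun r' k' hq' => ?_⟩⟩⟩))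
    · rcases hM with hM | ⟨-, hM⟩
      · omega
      · obtain ⟨z, i, hz, hi⟩ := hM _ _ hq
        rw [hx] at hz
        cases hz
        rw [hcn] at hi
        cases hi
    · rw [hq] at hq'
      cases hq'
      exact hr
  | lazyStart hq hx =>
    obtain ⟨M', rfl, hM⟩ := hM
    exact .inl ⟨M', by omega, .llx _ _ _, hM, rfl⟩
  | lazyFailed hq hx hw => exact .inr (.inl rfl)
  | lazyKeep hq hx hs =>
    obtain ⟨M', h1, h2⟩ := run hM (Apply.Ok.lazy hok hq rfl (by omega)).2
    exact .inl ⟨M', h1, _, h2, rfl⟩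
  | lazyNew hq hx hs =>
    obtain ⟨h3, h4⟩ := hnew H.length _ le_rfl (by simp; rfl)
    obtain ⟨M', h1, h2⟩ := run hM (Apply.Ok.lazy hok hq h3.1 h4).2
    exact .inl ⟨M', h1, _, h2, rfl⟩
  | scxOk hctx hx => exact .inr (.inr (.inl rfl))
  | scxFailed hctx => exact .inr (.inl rfl)

/-! ### Attempts that are not disturbed -/

/-- An attempt has begun, and nothing that it has read has changed. -/
def Phase.Attempt (H : Heap S) (n : Addr) : Phase Pr → Prop
  | .start => False
  | .llxRoot w => ∀ x : Cell S, H[n]? = some x → x.version = w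
  | .run ctx _ => CtxValid H ctx
  | .llx ctx q w => CtxValid H ctx ∧
      (∀ r k, q.strict? = some (r, k) → ∀ x : Cell S, H[r]? = some x → x.version = w) ∧
      ∀ r k, q.lazy? = some (r, k) → ∀ x : Cell S, H[r]? = some x → x.version = w

theorem CtxValid.congr {H H' : Heap S} {ctx : List (Addr × ℕ)} (h : CtxValid H ctx)
    (heq : ∀ e ∈ ctx, H'[e.1]? = H[e.1]?) : CtxValid H' ctx := by
  intro e he
  rw [heq e he]
  exact h e he

theorem CtxValid.append {H : Heap S} {ctx : List (Addr × ℕ)} (h : CtxValid H ctx) {r : Addr}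
    {x : Cell S} (hx : H[r]? = some x) (hfin : x.final = false) :
    CtxValid H (ctx ++ [(r, x.version)]) := by
  intro e he
  rcases List.mem_append.1 he with he | he
  · exact h e he
  · rw [List.mem_singleton.1 he]
    exact ⟨x, hx, rfl, hfin⟩

theorem Phase.Attempt.congr {B : Addr → Prop} {H H' : Heap S} {n : Addr} {ph : Phase Pr}
    (h : ph.Attempt H n) (hB : ph.All B) (hn : B n) (heq : ∀ a, B a → H'[a]? = H[a]?) :
    ph.Attempt H' n := by
  cases ph with
  | start => exact h
  | llxRoot w => exact fun x hx => h x (heq n hn ▸ hx)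
  | run ctx q => exact CtxValid.congr h fun e he => heq _ (hB.1 e he)
  | llx ctx q w =>
    refine ⟨h.1.congr fun e he => heq _ (hB.1 e he), fun r k hq x hx => ?_, fun r k hq x hx => ?_⟩
    · exact h.2.1 r k hq x (heq r (hB.2.strict hq).1 ▸ hx)
    · exact h.2.2 r k hq x (heq r (hB.2.lazy hq).1 ▸ hx)

/-- The process `p` is in an attempt of the activation of `force` for the contents `d` of the node
`n`, with the activations `pre` above and `below` below it.  The cells `Q` are private to `p`, and
it uses no other cells than these and those of `F`. -/
structure Solo (C : Config Pr P) (p : P) (F Q : Set Addr) (x n : Addr) (d : Def S)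
    (below pre : List (Frame Pr)) (ph : Phase Pr) : Prop where
  alloc : ∀ a ∈ Q, a < C.mem.heap.length
  others : ∀ q, q ≠ p → (C.procs q).All fun a => a < C.mem.heap.length ∧ a ∉ Q
  root : C.mem.root ∉ Q
  closed_out : C.mem.heap.Closed fun a => a < C.mem.heap.length ∧ a ∉ Q
  closed_in : C.mem.heap.Closed fun a => a ∈ F ∨ a ∈ Q
  stack : (C.procs p).pc = .reading x none (pre ++ ⟨n, d, ph⟩ :: below)
  all : ∀ g ∈ pre ++ [⟨n, d, ph⟩], g.All fun a => a ∈ F ∨ a ∈ Q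
  phase : ph.Attempt C.mem.heap n
  last : ∀ l g, pre = l ++ [g] → ∃ y : Cell S, C.mem.heap[g.node]? = some y ∧
    y.content = .dfr g.dfr

/-! ### Private cells and undisturbed attempts are preserved by all steps. -/

variable {C C' : Config Pr P} {p : P} {F Q : Set Addr} {x n : Addr} {d : Def S}
  {below pre : List (Frame Pr)} {ph : Phase Pr} {κ : Kind}

/-- Another process can write only the node of its own topmost activation, which lies outside `Q`,
and cells of `F` do not change by assumption. Nor can it learn a private address: everything it
knows or reads lies outside `Q`, and what it allocates is new, hence not in `Q`. -/
theorem Solo.step_other (h : Solo C p F Q x n d below pre ph) (hwf : C.WF) {q : P}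
    (hs : Config.Step q κ C C') (hq : q ≠ p) (hn : n ∈ F)
    (hF : ∀ a ∈ F, C'.mem.heap[a]? = C.mem.heap[a]?) : Solo C' p F Q x n d below pre ph := by
  have hle := hs.1.heapLe (hwf.proc q)
  have hlen := hle.length_le
  have hch := hs.1.heapChange
  have hA : ∀ a, a < C.mem.heap.length ∧ a ∉ Q → a < C'.mem.heap.length ∧ a ∉ Q :=
    fun a ha => ⟨ha.1.trans_le hlen, ha.2⟩
  have hpq : (C.procs q).All fun a => a < C'.mem.heap.length ∧ a ∉ Q := (h.others q hq).mono hA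
  have hcl : C.mem.heap.Closed fun a => a < C'.mem.heap.length ∧ a ∉ Q := fun a z ha hz =>
    (h.closed_out a z ⟨(List.getElem?_eq_some_iff.1 hz).1, ha.2⟩ hz).mono hA
  have hroot : C.mem.root < C'.mem.heap.length ∧ C.mem.root ∉ Q :=
    ⟨hwf.mem.root.trans_le hlen, h.root⟩
  have heq : ∀ a, (a ∈ F ∨ a ∈ Q) → C'.mem.heap[a]? = C.mem.heap[a]? := by
    rintro a (ha | ha)
    · exact hF a ha
    · by_contra hne
      obtain ⟨f, hf, rfl⟩ := hch.eq_of_ne (h.alloc a ha) hne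
      exact ((h.others q hq).top hf).node.2 ha
  obtain ⟨hr', hq'⟩ := hs.1.all hroot hcl
    (fun a h1 h2 => ⟨h2, fun ha => absurd (h.alloc a ha) (not_lt.2 h1)⟩) hpq
  have hp' : C'.procs p = C.procs p := hs.2 p hq.symm
  refine ⟨fun a ha => (h.alloc a ha).trans_le hlen, fun e he => ?_, hr'.2,
    hch.closed hcl ⟨hroot, hpq⟩ fun f hf => hpq.top hf, fun a z ha hz => ?_, hp' ▸ h.stack, h.all,
    ?_, fun l g hl => ?_⟩
  · by_cases heq : e = q
    · rw [heq]; exact hq'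
    · rw [hs.2 e heq]; exact (h.others e he).mono hA
  · rw [heq a ha] at hz
    exact h.closed_in a z ha hz
  · exact h.phase.congr (h.all ⟨n, d, ph⟩ (by simp)).phase (.inl hn) heq
  · rw [heq _ (h.all g (by simp [hl])).node]
    exact h.last l g hl

/-- The part of `Solo` about the heap and the other processes is preserved by steps of `p`, if
allocated cells become private. -/
theorem Solo.step_heap (h : Solo C p F Q x n d below pre ph) (hwf : C.WF)
    (hs : Config.Step p κ C C') (hroot : C'.mem.root = C.mem.root) {top : Frame Pr}
    (htop : top.All fun a => a ∈ F ∨ a ∈ Q)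
    (hch : HeapChange C.mem.heap (fun A => top.All A) (· = top) C'.mem.heap)
    (hF : ∀ a ∈ F, C'.mem.heap[a]? = C.mem.heap[a]?) :
    ∃ Q' : Set Addr, Q ⊆ Q' ∧
      (∀ a, C.mem.heap.length ≤ a → a < C'.mem.heap.length → a ∈ Q') ∧
      (∀ a ∈ Q', a < C'.mem.heap.length) ∧
      (∀ q, q ≠ p → (C'.procs q).All fun a => a < C'.mem.heap.length ∧ a ∉ Q') ∧
      C'.mem.root ∉ Q' ∧ (C'.mem.heap.Closed fun a => a < C'.mem.heap.length ∧ a ∉ Q') ∧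
      (C'.mem.heap.Closed fun a => a ∈ F ∨ a ∈ Q') ∧
      C.mem.heap.Closed fun a => a ∈ F ∨ a ∈ Q' := by
  have hlen := hch.length_le
  let Q' : Set Addr := Q ∪ {a | C.mem.heap.length ≤ a ∧ a < C'.mem.heap.length}
  have hQQ : ∀ a, (a ∈ F ∨ a ∈ Q) → (a ∈ F ∨ a ∈ Q') := fun a ha => ha.imp_right .inl
  have hA : ∀ a, a < C.mem.heap.length ∧ a ∉ Q → a < C'.mem.heap.length ∧ a ∉ Q' := by
    rintro a ⟨h1, h2⟩
    refine ⟨h1.trans_le hlen, ?_⟩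
    rintro (h3 | h3)
    · exact h2 h3
    · exact absurd h1 (not_lt.2 h3.1)
  have hcl : C.mem.heap.Closed fun a => a ∈ F ∨ a ∈ Q' := fun a z ha hz => by
    refine (h.closed_in a z (ha.imp_right fun ha => ha.resolve_right fun h' => ?_) hz).mono hQQ
    exact absurd (List.getElem?_eq_some_iff.1 hz).1 (not_lt.2 h'.1)
  refine ⟨Q', fun a => .inl, fun a h1 h2 => .inr ⟨h1, h2⟩, ?_, fun q hq => ?_, ?_,
    fun a z ha hz => ?_, hch.closed hcl (htop.mono hQQ) fun f hf => hf ▸ htop.mono hQQ, hcl⟩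
  · rintro a (ha | ha)
    · exact (h.alloc a ha).trans_le hlen
    · exact ha.2
  · rw [hs.2 q hq]
    exact (h.others q hq).mono hA
  · rw [hroot]
    exact (hA _ ⟨hwf.mem.root, h.root⟩).2
  · have hlt : a < C.mem.heap.length := by
      by_contra! hge
      exact ha.2 (.inr ⟨hge, ha.1⟩)
    have haQ : a ∉ Q := fun h => ha.2 (.inl h)
    have hz' : C.mem.heap[a]? = some z := by
      -- The only old cell that `p` can write is a node in `F` or `Q`; here it is not in `Q`, and
      -- cells of `F` are unchanged.
      by_contra hne
      rw [← hz] at hne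
      obtain ⟨f, rfl, rfl⟩ := hch.eq_of_ne hlt (Ne.symm hne)
      exact htop.node.elim (fun hF' => hne (hF _ hF').symm) haQ
    exact (h.closed_out a z ⟨hlt, haQ⟩ hz').mono hA

/-- A step of the attempt itself, when no activation is above it: it goes on, unless popped. -/
theorem ForceStep.attempt {H H' : Heap S} {fs' : List (Frame Pr)}
    (h : ForceStep H ⟨n, d, ph⟩ [] H' fs') (hne : fs' ≠ [])
    (hph : ph.Attempt H n) (heq : ∀ a < H.length, H'[a]? = H[a]?) :
    ∃ pre' ph', fs' = pre' ++ [⟨n, d, ph'⟩] ∧ ph'.Attempt H' n ∧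
      ∀ l g, pre' = l ++ [g] → ∃ y : Cell S, H'[g.node]? = some y ∧ y.content = .dfr g.dfr := by
  have one : ∀ {ph' : Phase Pr}, ph'.Attempt H' n →
      ∃ pre' ph'', [(⟨n, d, ph'⟩ : Frame Pr)] = pre' ++ [⟨n, d, ph''⟩] ∧ ph''.Attempt H' n ∧
      ∀ l g, pre' = l ++ [g] → ∃ y : Cell S, H'[g.node]? = some y ∧ y.content = .dfr g.dfr :=
    fun hph' => ⟨[], _, rfl, hph', fun l g hl => by simp at hl⟩
  have some_eq : ∀ {a : Addr} {z : Cell S}, H[a]? = some z → H'[a]? = some z :=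
    fun hz => (heq _ (List.getElem?_eq_some_iff.1 hz).1).trans hz
  have valid : ∀ {ctx : List (Addr × ℕ)}, CtxValid H ctx → CtxValid H' ctx := by
    intro ctx hctx
    refine hctx.congr fun e he => ?_
    obtain ⟨z, hz, -⟩ := hctx e he
    rw [hz, some_eq hz]
  cases h with
  | rootStart hx =>
    refine one fun z hz => ?_
    rw [hx] at hz
    cases hz
    rfl
  | rootFailed hx hw => exact absurd (hph _ hx) hw
  | rootOk hx hfin hc =>
    refine one (ph' := .run _ _) fun e he => ?_
    rw [List.mem_singleton.1 he]
    exact ⟨_, hx, rfl, hfin⟩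
  | rootGone hx hgone => exact absurd rfl hne
  | loc hq => exact one (ph' := .run _ _) (valid hph)
  | strictStart hq hx =>
    refine one (ph' := .llx _ _ _) ⟨hph, fun r k hq' z hz => ?_, fun r k hq' z hz => ?_⟩
    · rw [hq] at hq'
      cases hq'
      rw [hx] at hz
      cases hz
      rfl
    -- A computation never waits for a strict and a lazy read at once.
    · obtain ⟨i, ds, hd, rfl, -, -⟩ := Apply.lazy?_eq_some hq'
      cases hq
  | strictFailed hq hx hw => exact absurd (hph.2.1 _ _ hq _ hx) hw
  | strictFinal hq hx hfin hc => exact one (ph' := .run _ _) hph.1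
  | strictEscape hq hx hfin hc => exact absurd rfl hne
  | strictMut hq hx hfin hc => exact one (ph' := .run _ _) (CtxValid.append hph.1 hx hfin)
  | strictForce hq hx hfin hc =>
    refine ⟨[_], .run _ _, rfl, hph.1, fun l g hl => ?_⟩
    obtain ⟨rfl, hg⟩ := List.append_inj' (s₁ := []) hl rfl
    cases hg
    exact ⟨_, hx, hc⟩
  | lazyStart hq hx =>
    refine one (ph' := .llx _ _ _) ⟨hph, fun r k hq' z hz => ?_, fun r k hq' z hz => ?_⟩
    · obtain ⟨i, ds, hd, rfl, -, -⟩ := Apply.lazy?_eq_some hq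
      cases hq'
    · rw [hq] at hq'
      cases hq'
      rw [hx] at hz
      cases hz
      rfl
  | lazyFailed hq hx hw => exact absurd (hph.2.2 _ _ hq _ hx) hw
  | lazyKeep hq hx hs =>
    refine one (ph' := .run _ _) ?_
    simp only [Phase.Attempt]
    split_ifs with hfin
    · exact hph.1
    · exact CtxValid.append hph.1 hx (by simpa using hfin)
  | lazyNew hq hx hs =>
    refine one (ph' := .run _ _) ?_
    simp only [Phase.Attempt]
    split_ifs with hfin
    · exact valid hph.1
    · exact CtxValid.append (valid hph.1) (some_eq hx) (by simpa using hfin)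
  | scxOk hctx hx => exact absurd rfl hne
  | scxFailed hctx => exact absurd hph hctx

/-- When the attempt is on top, only `n` could be written, and `n` is frozen. Otherwise the danger
is that forces nested in the attempt disturb it. They do write cells of `Q`, but not the read set of
the waiting attempt. They could restart it only by abandoning the activation directly above it,
whose node would have to be immediate already; the field `last` of `Solo` excludes this. -/
theorem Solo.step_self (h : Solo C p F Q x n d below pre ph) (hwf : C.WF)
    {V : Addr → Tree S} {ρ : Addr → ℕ} (hok : (C.procs p).pc.Ok V ρ)
    (hs : Config.Step p κ C C') (hn : n ∈ F)
    (hF : ∀ a ∈ F, C'.mem.heap[a]? = C.mem.heap[a]?)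
    (hpop : ∀ fs', (C'.procs p).pc = .reading x none fs' → C'.mem.heap.IsImm n →
      fs' ≠ below ∧ fs' ≠ retryCaller below) :
    ∃ Q' pre' ph', Solo C' p F Q' x n d below pre' ph' := by
  have hle := hs.1.heapLe (hwf.proc p)
  have hstk : StackWF C.mem.heap (pre ++ ⟨n, d, ph⟩ :: below) := by
    have := (hwf.proc p).pc
    rw [h.stack] at this
    exact this.2
  have hok' : ∀ f ∈ pre ++ ⟨n, d, ph⟩ :: below, f.Ok V ρ := by
    rw [h.stack] at hok
    exact hok
  cases hpre : pre with
  | nil =>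
    subst hpre
    obtain ⟨fs', hf, hroot, hpc⟩ := hs.1.of_reading_cons h.stack
    have hall := h.all ⟨n, d, ph⟩ (by simp)
    have hch := hf.heapChange
    have heq : ∀ a < C.mem.heap.length, C'.mem.heap[a]? = C.mem.heap[a]? := by
      intro a ha
      by_contra hne
      obtain ⟨f, rfl, rfl⟩ := hch.eq_of_ne ha hne
      exact hne (hF _ hn)
    obtain ⟨Q', hQ, hnew, h1, h2, h3, h4, h5, h6⟩ := h.step_heap hwf hs hroot hall hch hF
    have hQQ : ∀ a, (a ∈ F ∨ a ∈ Q) → (a ∈ F ∨ a ∈ Q') := fun a ha => ha.imp_right (@hQ a)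
    rcases hf.of_append (fs := []) with ⟨fs'', hne, rfl, hf'⟩ | ⟨-, hfs⟩
    · obtain ⟨pre', ph', rfl, hph, hlast⟩ := hf'.attempt hne h.phase heq
      refine ⟨Q', pre', ph', h1, h2, h3, h4, h5, ?_, ?_, hph, hlast⟩
      · rw [hpc, List.append_assoc]
        rfl
      · exact hf'.all h6 (fun a h1 h2 => .inr (hnew a h1 h2)) (hall.mono hQQ) (by simp)
    · have himm : C'.mem.heap.IsImm n := by
        rcases hf.shape hwf.mem.heap (hstk.1 _ (by simp)) with ⟨ph', h, -⟩ | ⟨ph', g, y, h, -⟩ |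
          ⟨-, h⟩ | ⟨-, h, h'⟩
        · rcases hfs with hfs | hfs <;> rw [h] at hfs
          · exact absurd (congrArg List.length hfs) (by simp)
          · refine absurd (congrArg List.length hfs) ?_
            cases below <;> simp [retryCaller]
        · rcases hfs with hfs | hfs <;> rw [h] at hfs
          · exact absurd (congrArg List.length hfs) (by simp; omega)
          · refine absurd (congrArg List.length hfs) ?_
            cases below <;> simp [retryCaller]
            omega
        · exact h
        · rw [h]; exact h'
      have := hpop fs' hpc himm
      exact (hfs.elim this.1 this.2).elim
  | cons g pre₁ =>
    subst hpre
    obtain ⟨fs', hf, hroot, hpc⟩ := hs.1.of_reading_cons h.stack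
    have hall := h.all g (by simp)
    have hch := hf.heapChange
    obtain ⟨Q', hQ, hnew, h1, h2, h3, h4, h5, h6⟩ := h.step_heap hwf hs hroot hall hch hF
    have hQQ : ∀ a, (a ∈ F ∨ a ∈ Q) → (a ∈ F ∨ a ∈ Q') := fun a ha => ha.imp_right (@hQ a)
    have hgwf := hstk.1 g (by simp)
    -- the attempt waits for the activation above it
    have hph : ∃ ctx q k e, ph = .run ctx q ∧ q.strict? = some (e, k) := by
      obtain ⟨l, e, hl⟩ : ∃ l e, g :: pre₁ = l ++ [e] :=
        ⟨_, _, (List.dropLast_append_getLast (List.cons_ne_nil g pre₁)).symm⟩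
      have := hstk.2
      rw [hl, List.append_assoc] at this
      obtain ⟨ctx, q, k, h1, h2⟩ := (List.isChain_append_cons_cons.1 this).2.1
      exact ⟨ctx, q, k, _, h1, h2⟩
    obtain ⟨ctx, q, k, e, rfl, hqe⟩ := hph
    have hattempt : Phase.Attempt (Pr := Pr) C'.mem.heap n (.run ctx q) := by
      -- A computation waiting for a strict read has in its read set only `n`, which is frozen, and
      -- immediate cells, which never change.
      have hctx := Apply.CtxOk.of_strict (hstk.1 ⟨n, d, .run ctx q⟩ (by simp)).phase hqe
      refine CtxValid.congr h.phase fun e he => ?_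
      rcases hctx e he with h | ⟨z, i, hz, hi⟩
      · rw [h]; exact hF n hn
      · rw [hz, hle.imm hz hi]
    have hrank := hstk.pairwise hok'
    rw [List.cons_append, List.pairwise_cons] at hrank
    -- The topmost activation writes at most its own node, whose rank is strictly below the ranks of
    -- all nodes further down the stack.
    have hkeep : ∀ f ∈ pre₁, C'.mem.heap[f.node]? = C.mem.heap[f.node]? := by
      intro f hmem
      by_contra hne
      obtain ⟨z, hz, -⟩ := (hstk.1 f (by simp [hmem])).cell
      obtain ⟨f', rfl, hf'⟩ := hch.eq_of_ne (List.getElem?_eq_some_iff.1 hz).1 hne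
      have := hrank.1 f (by simp [hmem])
      rw [hf'] at this
      exact lt_irrefl _ this
    have hlast : ∀ l f, pre₁ = l ++ [f] → ∃ y : Cell S, C'.mem.heap[f.node]? = some y ∧
        y.content = .dfr f.dfr := by
      intro l f hl
      rw [hkeep f (by simp [hl])]
      exact h.last (g :: l) f (by simp [hl])
    replace hf : ForceStep C.mem.heap g ((pre₁ ++ [⟨n, d, .run ctx q⟩]) ++ below)
        C'.mem.heap fs' := by
      simpa using hf
    rcases hf.of_append with ⟨fs'', -, rfl, hf'⟩ | ⟨hfs, -⟩
    swap
    · simp at hfs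
    have hall' : ∀ f ∈ fs'', f.All fun a => a ∈ F ∨ a ∈ Q' := by
      exact hf'.all h6 (fun a h1 h2 => .inr (hnew a h1 h2)) (hall.mono hQQ)
        fun f hf => (h.all f (by simp at hf ⊢; tauto)).mono hQQ
    suffices hsuff : ∃ pre', fs'' = pre' ++ [⟨n, d, .run ctx q⟩] ∧ ∀ l f, pre' = l ++ [f] →
        ∃ y : Cell S, C'.mem.heap[f.node]? = some y ∧ y.content = .dfr f.dfr by
      obtain ⟨pre', rfl, hlast'⟩ := hsuff
      refine ⟨Q', pre', _, h1, h2, h3, h4, h5, ?_, hall', hattempt, hlast'⟩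
      rw [hpc, List.append_assoc]
      rfl
    rcases hf'.shape hwf.mem.heap hgwf with ⟨ph', rfl, hg⟩ | ⟨ph', g', y, rfl, hH, hy, hc⟩ |
      ⟨rfl, -⟩ | ⟨rfl, hH, himm⟩
    · refine ⟨⟨g.node, g.dfr, ph'⟩ :: pre₁, by simp, fun l f hl => ?_⟩
      cases l with
      | nil =>
        simp only [List.nil_append, List.cons.injEq] at hl
        obtain ⟨rfl, rfl⟩ := hl
        simp only [hg]
        exact h.last [] g rfl
      | cons e l =>
        simp only [List.cons_append, List.cons.injEq] at hl
        exact hlast l f hl.2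
    · refine ⟨g' :: ⟨g.node, g.dfr, ph'⟩ :: pre₁, by simp, fun l f hl => ?_⟩
      rcases l with _ | ⟨e, _ | ⟨e', l⟩⟩
      · simp at hl
      · simp only [List.cons_append, List.nil_append, List.cons.injEq] at hl
        obtain ⟨rfl, rfl, rfl⟩ := hl
        simp only [hH]
        exact h.last [] g rfl
      · simp only [List.cons_append, List.cons.injEq] at hl
        exact hlast l f hl.2.2
    · exact ⟨pre₁, rfl, hlast⟩
    -- Abandonment restarts the activation below. If that were the attempt itself, `last` would
    -- contradict the node being immediate; otherwise the restarted activation still lies above the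
    -- attempt.
    · cases pre₁ with
      | nil =>
        obtain ⟨y, hy, hc⟩ := h.last [] g rfl
        obtain ⟨z, i, hz, hi⟩ := himm
        rw [hy] at hz
        cases hz
        rw [hc] at hi
        cases hi
      | cons g' pre₂ =>
        refine ⟨⟨g'.node, g'.dfr, .start⟩ :: pre₂, rfl, fun l f hl => ?_⟩
        cases l with
        | nil =>
          simp only [List.nil_append, List.cons.injEq] at hl
          obtain ⟨rfl, rfl⟩ := hl
          exact hlast [] g' rfl
        | cons e l =>
          simp only [List.cons_append, List.cons.injEq] at hl
          exact hlast (g' :: l) f (by simp [hl.2])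

namespace IsExecution

variable {C : ℕ → Config Pr P} {sched : ℕ → P} {kind : ℕ → Kind} {V : Addr → Tree S}
  {ρ : Addr → ℕ} {p : P}

/-! ### Forcing terminates -/

/-- The next step of a process that is forcing a node. -/
theorem exists_forceStep (hE : IsExecution C sched kind) (hp : ∀ n, ∃ m ≥ n, sched m = p)
    {t : ℕ} {x : Addr} {f : Frame Pr} {fs : List (Frame Pr)}
    (h : ((C t).procs p).pc = .reading x none (f :: fs)) :
    ∃ m ≥ t, ∃ fs', sched m = p ∧ ((C m).procs p).pc = .reading x none (f :: fs) ∧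
      ForceStep (C m).mem.heap f fs (C (m + 1)).mem.heap fs' ∧
      ((C (m + 1)).procs p).pc = .reading x none fs' := by
  obtain ⟨m, hm, hs, heq⟩ := hE.exists_next hp t
  have hst := hE.step m
  rw [hs] at hst
  rw [← heq] at h
  obtain ⟨fs', hf, -, hpc⟩ := hst.1.of_reading_cons h
  exact ⟨m, hm, fs', hs, h, hf, hpc⟩

/-- The topmost activation is popped at some time after `t`, with its node immediate. -/
def Pops (C : ℕ → Config Pr P) (p : P) (x : Addr) (t : ℕ) (n : Addr) (fs : List (Frame Pr)) :
    Prop :=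
  ∃ t' > t, ∃ fs', ((C t').procs p).pc = .reading x none fs' ∧ (C t').mem.heap.IsImm n ∧
    (fs' = fs ∨ fs' = retryCaller fs)

/-- If nodes of smaller rank are forced eventually, then an activation of `force` is popped or
restarted. -/
theorem restarts (hE : IsExecution C sched kind) (hok : Ok C V ρ)
    (hp : ∀ n, ∃ m ≥ n, sched m = p) {x n : Addr} {d : Def S} {below : List (Frame Pr)}
    (ih : ∀ t g fs, ((C t).procs p).pc = .reading x none (g :: fs) → ρ g.node < ρ n →
      Pops C p x t g.node fs)
    {t : ℕ} {ph : Phase Pr} (h : ((C t).procs p).pc = .reading x none (⟨n, d, ph⟩ :: below))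
    (hpop : ¬ Pops C p x t n below) :
    ∃ t' > t, ((C t').procs p).pc = .reading x none (⟨n, d, .start⟩ :: below) := by
  have top : ∀ {m : ℕ} {f : Frame Pr} {fs : List (Frame Pr)},
      ((C m).procs p).pc = .reading x none (f :: fs) → f.Ok V ρ ∧ f.WF (C m).mem.heap := by
    intro m f fs h
    have h1 := (hok m).2.1 p
    have h2 := ((hE.wf m).proc p).pc
    rw [h] at h1 h2
    exact ⟨h1 f List.mem_cons_self, h2.2.1 f List.mem_cons_self⟩
  -- steps that pop the activation
  have nopop : ∀ {m : ℕ} {ph' : Phase Pr} {fs' : List (Frame Pr)}, m ≥ t →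
      ((C m).procs p).pc = .reading x none (⟨n, d, ph'⟩ :: below) →
      ForceStep (C m).mem.heap ⟨n, d, ph'⟩ below (C (m + 1)).mem.heap fs' →
      ((C (m + 1)).procs p).pc = .reading x none fs' →
      fs' ≠ below ∧ fs' ≠ retryCaller below := by
    intro m ph' fs' hm hpc hf hpc'
    have key : (fs' = below ∨ fs' = retryCaller below) → False := by
      intro hfs
      have hl : fs'.length = below.length := by
        rcases hfs with rfl | rfl
        · rfl
        · cases below <;> rfl
      have himm : (C (m + 1)).mem.heap.IsImm n := by
        rcases hf.shape (hE.wf m).mem.heap (top hpc).2 with ⟨_, rfl, -⟩ | ⟨_, _, _, rfl, -⟩ |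
          ⟨-, h⟩ | ⟨-, h, h'⟩
        · simp at hl
        · simp at hl
          omega
        · exact h
        · rw [h]; exact h'
      exact hpop ⟨m + 1, by omega, fs', hpc', himm, hfs⟩
    exact ⟨fun h => key (.inl h), fun h => key (.inr h)⟩
  -- Induction on the work left. An activation pushed meanwhile is popped by `ih`, with its node
  -- immediate, and then the smaller measure is valid.
  have work : ∀ M t₁ (ph' : Phase Pr), t₁ ≥ t → ph'.WorkLe V (C t₁).mem.heap n M →
      ((C t₁).procs p).pc = .reading x none (⟨n, d, ph'⟩ :: below) →
      ∃ t' > t₁, ((C t').procs p).pc = .reading x none (⟨n, d, .start⟩ :: below) := by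
    intro M
    induction M using Nat.strong_induction_on with
    | _ M ihM =>
      intro t₁ ph' ht hM hpc
      obtain ⟨m, hm, fs', hs, hpcm, hf, hpc'⟩ := hE.exists_forceStep hp hpc
      have hMm := hM.mono (hE.le hm)
      rcases hf.workLe (hok m).1 (hE.wf m).mem.heap (hok m).2.2 (top hpcm).1 hMm with
        ⟨M', hlt, ph'', hM', rfl⟩ | rfl | hfs | ⟨M', hlt, ph'', g, rfl, hg, hM'⟩
      · obtain ⟨t', ht', h'⟩ := ihM M' hlt (m + 1) ph'' (by omega) hM' hpc'
        exact ⟨t', by omega, h'⟩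
      · exact ⟨m + 1, by omega, hpc'⟩
      · exact absurd hfs (nopop (by omega) hpcm hf hpc').1
      · obtain ⟨t₂, ht₂, fs₂, hpc₂, himm, hfs₂⟩ := ih _ _ _ hpc' hg
        -- The pop either resumes the caller or sends it back to `start`, which is the goal.
        rcases hfs₂ with rfl | rfl
        · obtain ⟨t', ht', h'⟩ := ihM M' hlt t₂ ph'' (by omega) (hM' _ himm) hpc₂
          exact ⟨t', by omega, h'⟩
        · exact ⟨t₂, by omega, hpc₂⟩
  have run : ∀ t₁ ctx (q : Apply Pr), t₁ ≥ t →
      ((C t₁).procs p).pc = .reading x none (⟨n, d, .run ctx q⟩ :: below) →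
      ∃ t' > t₁, ((C t').procs p).pc = .reading x none (⟨n, d, .start⟩ :: below) := by
    intro t₁ ctx q ht hpc
    obtain ⟨K, hK⟩ := Apply.Ok.exists_costLe (top hpc).1.phase
    exact work (4 * K + 3) t₁ (.run ctx q) ht ⟨4 * K + 2, rfl, K, hK, .inl le_rfl⟩ hpc
  have root : ∀ t₁ w, t₁ ≥ t →
      ((C t₁).procs p).pc = .reading x none (⟨n, d, .llxRoot w⟩ :: below) →
      ∃ t' > t₁, ((C t').procs p).pc = .reading x none (⟨n, d, .start⟩ :: below) := by
    intro t₁ w ht hpc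
    obtain ⟨m, hm, fs', hs, hpcm, hf, hpc'⟩ := hE.exists_forceStep hp hpc
    have hno := nopop (by omega) hpcm hf hpc'
    -- The resulting heap must be a variable for `cases` to unify it.
    generalize (C (m + 1)).mem.heap = H' at hf
    cases hf with
    | rootFailed hx hw => exact ⟨m + 1, by omega, hpc'⟩
    | rootOk hx hfin hc =>
      obtain ⟨t', ht', h'⟩ := run _ _ _ (by omega) hpc'
      exact ⟨t', by omega, h'⟩
    | rootGone hx hgone => exact absurd rfl hno.2
  cases ph with
  | start =>
    obtain ⟨m, hm, fs', hs, hpcm, hf, hpc'⟩ := hE.exists_forceStep hp h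
    generalize (C (m + 1)).mem.heap = H' at hf
    cases hf with
    | rootStart hx =>
      obtain ⟨t', ht', h'⟩ := root _ _ (by omega) hpc'
      exact ⟨t', by omega, h'⟩
  | llxRoot w => exact root t w le_rfl h
  | run ctx q => exact run t ctx q le_rfl h
  | llx ctx q w =>
    obtain ⟨K, hK⟩ := Apply.Ok.exists_costLe (top h).1.phase
    exact work (4 * K + 2) t (.llx ctx q w) le_rfl ⟨K, hK, .inl le_rfl⟩ h

/-- An attempt that begins when the cells in reach have stopped changing is never disturbed. -/
theorem exists_solo (hE : IsExecution C sched kind) (hok : Ok C V ρ) {x n : Addr} {d : Def S}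
    {below : List (Frame Pr)} {F : Set Addr} (hn : n ∈ F)
    (hd : (Content.dfr d).All (· ∈ F)) (hcl : ∀ t, (C t).mem.heap.Closed (· ∈ F)) {t : ℕ}
    (hF : ∀ m ≥ t, ∀ a ∈ F, (C (m + 1)).mem.heap[a]? = (C m).mem.heap[a]?)
    (h : ((C t).procs p).pc = .reading x none (⟨n, d, .start⟩ :: below)) (hs : sched t = p)
    (hpop : ¬ Pops C p x t n below) :
    ∀ m ≥ t + 1, ∃ Q pre ph, Solo (C m) p F Q x n d below pre ph := by
  intro m hm
  induction m, hm using Nat.le_induction with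
  | base =>
    have hst := hE.step t
    rw [hs] at hst
    obtain ⟨fs', hf, hroot, hpc⟩ := hst.1.of_reading_cons h
    have hwf := hE.wf (t + 1)
    have hFt := hF t le_rfl
    have hph : ∃ w, fs' = ⟨n, d, .llxRoot w⟩ :: below ∧
        ∀ z : Cell S, (C t).mem.heap[n]? = some z → z.version = w := by
      generalize (C (t + 1)).mem.heap = H' at hf
      cases hf with
      | rootStart hx =>
        refine ⟨_, rfl, fun z hz => ?_⟩
        rw [hx] at hz
        cases hz
        rfl
    obtain ⟨w, rfl, hw⟩ := hph
    -- The attempt has just begun and has allocated nothing, so its private set is empty.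
    refine ⟨∅, [], .llxRoot w, fun a ha => ha.elim, fun q _ => ?_, id, fun a z ha hz => ?_, ?_,
      hpc, ?_, fun z hz => hw z (by rw [← hFt n hn]; exact hz), fun l g hl => by simp at hl⟩
    · exact (hwf.proc q).all.mono fun a ha => ⟨ha, id⟩
    · exact (hwf.mem.closed a z ha.1 hz).mono fun a ha => ⟨ha, id⟩
    · exact fun a z ha hz => (hcl (t + 1) a z (ha.resolve_right id) hz).mono fun b hb => .inl hb
    · simp only [List.nil_append, List.mem_singleton, forall_eq]
      exact ⟨.inl hn, hd.mono fun b hb => .inl hb, trivial⟩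
  | succ m hm ih =>
    obtain ⟨Q, pre, ph, hsolo⟩ := ih
    by_cases hsm : sched m = p
    · have hst := hE.step m
      rw [hsm] at hst
      refine hsolo.step_self (hE.wf m) ((hok m).2.1 p) hst hn (hF m (by omega))
        fun fs' hpc himm => ?_
      constructor <;> intro hfs
      · exact hpop ⟨m + 1, by omega, fs', hpc, himm, .inl hfs⟩
      · exact hpop ⟨m + 1, by omega, fs', hpc, himm, .inr hfs⟩
    · exact ⟨Q, pre, ph, hsolo.step_other (hE.wf m) (hE.step m) hsm hn (hF m (by omega))⟩

/-- Every activation of `force` ends, if its process keeps moving. -/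
theorem pops (hE : IsExecution C sched kind) (hok : Ok C V ρ)
    (hp : ∀ n, ∃ m ≥ n, sched m = p) {x : Addr} {t : ℕ} {f : Frame Pr} {below : List (Frame Pr)}
    (h : ((C t).procs p).pc = .reading x none (f :: below)) : Pops C p x t f.node below := by
  induction hk : ρ f.node using Nat.strong_induction_on generalizing t f below with
  | _ k ihk =>
    subst hk
    by_contra hpop
    obtain ⟨n, d, ph⟩ := f
    have ih : ∀ t g fs, ((C t).procs p).pc = .reading x none (g :: fs) → ρ g.node < ρ n →
        Pops C p x t g.node fs := fun t g fs hg hlt => ihk _ hlt hg rfl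
    have hpop' : ∀ t' ≥ t, ¬ Pops C p x t' n below := fun t' ht' ⟨t₁, ht₁, h₁⟩ =>
      hpop ⟨t₁, by omega, h₁⟩
    -- The mentions of `d` are added to `n` explicitly, because `n` may no longer contain `d`.
    obtain ⟨F, T, hD, hcl, hF⟩ := hE.exists_frozen (fun n => (hok n).1)
      ((Set.finite_singleton n).union (Content.finite_dep (.dfr d)))
    have hn : n ∈ F := hD (.inl rfl)
    have hd : (Content.dfr d).All (· ∈ F) := fun b hb => hD (.inr hb)
    -- An activation that is never popped restarts again and again, hence also after the frozen
    -- time.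
    have late : ∀ T, ∃ t' ≥ t, t' ≥ T ∧
        ((C t').procs p).pc = .reading x none (⟨n, d, .start⟩ :: below) := by
      intro T
      induction T with
      | zero =>
        obtain ⟨t', ht', h'⟩ := hE.restarts hok hp ih h hpop
        exact ⟨t', by omega, by omega, h'⟩
      | succ T ihT =>
        obtain ⟨t₁, h1, h2, h3⟩ := ihT
        obtain ⟨t', ht', h'⟩ := hE.restarts hok hp ih h3 (hpop' t₁ h1)
        exact ⟨t', by omega, by omega, h'⟩
    obtain ⟨t₁, h1, h2, h3⟩ := late T
    obtain ⟨m, hm, hs, heq⟩ := hE.exists_next hp t₁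
    rw [← heq] at h3
    have hsolo := hE.exists_solo hok hn hd hcl (fun k hk => hF k (by omega)) h3 hs
      (hpop' m (by omega))
    obtain ⟨fs', hf, -, hpc⟩ := (hs ▸ hE.step m).1.of_reading_cons h3
    have hph : ∃ ph', fs' = ⟨n, d, ph'⟩ :: below := by
      generalize (C (m + 1)).mem.heap = H' at hf
      cases hf with
      | rootStart hx => exact ⟨_, rfl⟩
    obtain ⟨ph', rfl⟩ := hph
    obtain ⟨t₂, ht₂, h4⟩ := hE.restarts hok hp ih hpc (hpop' (m + 1) (by omega))
    obtain ⟨Q, pre, ph'', hsolo⟩ := hsolo t₂ (by omega)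
    have hstk := hsolo.stack
    rw [h4] at hstk
    simp only [Pc.reading.injEq, true_and] at hstk
    -- The restarted stack has nothing above the activation. Comparing it with the stack in `Solo`
    -- puts the attempt in phase `start`, where `Attempt` is false.
    have hpre : pre = [] := by
      have := congrArg List.length hstk
      simp only [List.length_cons, List.length_append] at this
      exact List.eq_nil_of_length_eq_zero (by omega)
    subst hpre
    simp only [List.nil_append, List.cons.injEq, Frame.mk.injEq, true_and, and_true] at hstk
    subst hstk
    exact hsolo.phase

/-! ### Operations complete -/

theorem pops_all (hE : IsExecution C sched kind) (hok : Ok C V ρ)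
    (hp : ∀ n, ∃ m ≥ n, sched m = p) {x : Addr} {t : ℕ} {fs : List (Frame Pr)}
    (h : ((C t).procs p).pc = .reading x none fs) :
    ∃ t' ≥ t, ((C t').procs p).pc = .reading x none [] := by
  induction hl : fs.length generalizing t fs with
  | zero =>
    rw [List.eq_nil_of_length_eq_zero hl] at h
    exact ⟨t, le_rfl, h⟩
  | succ l ih =>
    cases fs with
    | nil => cases hl
    | cons f fs =>
      obtain ⟨t', ht', fs', h', -, hfs⟩ := hE.pops hok hp h
      have hl' : fs'.length = l := by
        simp only [List.length_cons, Nat.succ.injEq] at hl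
        rcases hfs with rfl | rfl
        · exact hl
        · cases fs <;> exact hl
      obtain ⟨t₂, ht₂, h₂⟩ := ih h' hl'
      exact ⟨t₂, by omega, h₂⟩

/-- An immediate cell never changes again, so the next `LLX` neither fails nor finds deferred
contents. -/
theorem completes_of_isImm (hE : IsExecution C sched kind)
    (hp : ∀ n, ∃ m ≥ n, sched m = p) {x : Addr} {t : ℕ}
    (h : ((C t).procs p).pc = .reading x none []) (himm : (C t).mem.heap.IsImm x) :
    ∃ m ≥ t, kind m = .complete := by
  obtain ⟨m, hm, hs, heq⟩ := hE.exists_next hp t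
  obtain ⟨z, hz, -, hpc⟩ := (hs ▸ hE.step m).1.of_reading_none (heq ▸ h)
  obtain ⟨m', hm', hs', heq'⟩ := hE.exists_next hp (m + 1)
  obtain ⟨z', i, hz', hi⟩ := (hE.le hm).isImm himm
  rw [hz] at hz'
  cases hz'
  have hz₂ := (hE.le (show m ≤ m' by omega)).imm hz hi
  rcases (hs' ▸ hE.step m').1.of_reading_some (heq' ▸ hpc) with hk |
    ⟨y, hy, -, ⟨hne, -⟩ | ⟨d, hd, -⟩⟩
  · exact ⟨m', by omega, hk⟩
  · rw [hz₂] at hy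
    cases hy
    exact absurd rfl hne
  · rw [hz₂] at hy
    cases hy
    rw [hi] at hd
    cases hd

theorem completes_of_reading (hE : IsExecution C sched kind) (hok : Ok C V ρ)
    (hp : ∀ n, ∃ m ≥ n, sched m = p) {x : Addr} {w : Option ℕ} {fs : List (Frame Pr)} {t : ℕ}
    (h : ((C t).procs p).pc = .reading x w fs) : ∃ m ≥ t, kind m = .complete := by
  have forced : ∀ t₁ d, ((C t₁).procs p).pc = .reading x none [⟨x, d, .start⟩] →
      ∃ m ≥ t₁, kind m = .complete := by
    intro t₁ d h₁
    obtain ⟨t₂, ht₂, fs', h₂, himm, hfs⟩ := hE.pops hok hp h₁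
    obtain rfl : fs' = [] := by rcases hfs with rfl | rfl <;> rfl
    obtain ⟨m, hm, hk⟩ := hE.completes_of_isImm hp h₂ himm
    exact ⟨m, by omega, hk⟩
  have empty : ∀ t₁, ((C t₁).procs p).pc = .reading x none [] →
      ∃ m ≥ t₁, kind m = .complete := by
    intro t₁ h₁
    obtain ⟨m, hm, hs, heq⟩ := hE.exists_next hp t₁
    obtain ⟨z, hz, -, hpc⟩ := (hs ▸ hE.step m).1.of_reading_none (heq ▸ h₁)
    obtain ⟨m', hm', hs', heq'⟩ := hE.exists_next hp (m + 1)
    rcases (hs' ▸ hE.step m').1.of_reading_some (heq' ▸ hpc) with hk |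
      ⟨y, hy, -, ⟨hne, hpc'⟩ | ⟨d, hd, ⟨hfin, -⟩ | hpc'⟩⟩
    · exact ⟨m', by omega, hk⟩
    -- A failed `LLX` witnesses a change of the cell, and the only possible change has made it
    -- immediate; the retry then succeeds.
    · rcases hE.le (show m ≤ m' by omega) _ _ hz with h | ⟨y', i, _, hy', _, hi, _⟩
      · rw [hy] at h
        cases h
        exact absurd rfl hne
      · have himm := (hE.le_succ m').isImm ⟨y', i, hy', hi⟩
        obtain ⟨m₂, hm₂, hk⟩ := hE.completes_of_isImm hp hpc' himm
        exact ⟨m₂, by omega, hk⟩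
    · rw [((hE.wf m').mem.heap _ _ hy _ hd).2] at hfin
      cases hfin
    · obtain ⟨m₂, hm₂, hk⟩ := forced _ d hpc'
      exact ⟨m₂, by omega, hk⟩
  cases w with
  | none =>
    obtain ⟨t', ht', h'⟩ := hE.pops_all hok hp h
    obtain ⟨m, hm, hk⟩ := empty t' h'
    exact ⟨m, by omega, hk⟩
  | some w =>
    have hfs : fs = [] := by
      by_contra hne
      have := ((hE.wf t).proc p).pc
      rw [h] at this
      cases this.1 hne
    subst hfs
    obtain ⟨m', hm', hs', heq'⟩ := hE.exists_next hp t
    rcases (hs' ▸ hE.step m').1.of_reading_some (heq' ▸ h) with hk |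
      ⟨y, hy, -, ⟨hne, hpc'⟩ | ⟨d, hd, ⟨hfin, -⟩ | hpc'⟩⟩
    · exact ⟨m', by omega, hk⟩
    · obtain ⟨m₂, hm₂, hk⟩ := empty _ hpc'
      exact ⟨m₂, by omega, hk⟩
    · rw [((hE.wf m').mem.heap _ _ hy _ hd).2] at hfin
      cases hfin
    · obtain ⟨m₂, hm₂, hk⟩ := forced _ d hpc'
      exact ⟨m₂, by omega, hk⟩

/-- By pigeonhole on the finite set of processes, some process takes infinitely many operation
steps. If nothing completed from `N` on, the root would be constant. That process could not be
reading, since reads finish; it could not be starting, since its next `CAS` would succeed; nor could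
it be at a `CAS`, which succeeds or leads back to starting. An idle process that takes an operation
step starts one. -/
theorem completes (hE : IsExecution C sched kind) (hterm : Pr.Terminates) [Finite P]
    (hinf : ∀ N, ∃ n ≥ N, kind n ≠ .client) (N : ℕ) : ∃ n ≥ N, kind n = .complete := by
  by_contra! hno
  obtain ⟨V, ρ, hok⟩ := hE.exists_ok hterm
  -- some process takes infinitely many steps of operations
  obtain ⟨p, hp⟩ : ∃ p, ∀ M, ∃ n ≥ M, sched n = p ∧ kind n ≠ .client := by
    by_contra! hcon
    choose M hM using hcon
    obtain ⟨B, hB⟩ := (Set.finite_range M).bddAbove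
    obtain ⟨n, hn, hk⟩ := hinf B
    exact hk (hM (sched n) n ((hB ⟨sched n, rfl⟩).trans hn) rfl)
  have hmove : ∀ M, ∃ n ≥ M, sched n = p := fun M => (hp M).imp fun n h => ⟨h.1, h.2.1⟩
  have hroot : ∀ m n, N ≤ m → m ≤ n → (C n).mem.root = (C m).mem.root := by
    intro m n hm hmn
    induction hmn with
    | refl => rfl
    | step hle ih =>
      rw [← ih]
      exact (hE.step _).1.root_eq (hno _ (hm.trans hle))
  have hread : ∀ n ≥ N, ∀ x w fs, ((C n).procs p).pc ≠ .reading x w fs := by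
    intro n hn x w fs h
    obtain ⟨m, hm, hk⟩ := hE.completes_of_reading hok hmove h
    exact hno m (hn.trans hm) hk
  have hstart : ∀ n ≥ N, ∀ call, ((C n).procs p).pc ≠ .start call := by
    intro n hn call h
    obtain ⟨m, hm, hs, heq⟩ := hE.exists_next hmove n
    rcases (hs ▸ hE.step m).1.of_start (heq ▸ h) with ⟨x, h'⟩ | ⟨a, h'⟩
    · exact hread (m + 1) (by omega) _ _ _ h'
    · obtain ⟨m', hm', hs', heq'⟩ := hE.exists_next hmove (m + 1)
      rcases (hs' ▸ hE.step m').1.of_cas (heq' ▸ h') with hk | ⟨hne, -⟩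
      · exact hno m' (by omega) hk
      · exact hne (hroot m m' (by omega) (by omega))
  have hcas : ∀ n ≥ N, ∀ call r a, ((C n).procs p).pc ≠ .cas call r a := by
    intro n hn call r a h
    obtain ⟨m, hm, hs, heq⟩ := hE.exists_next hmove n
    rcases (hs ▸ hE.step m).1.of_cas (heq ▸ h) with hk | ⟨-, h'⟩
    · exact hno m (by omega) hk
    · exact hstart (m + 1) (by omega) _ h'
  obtain ⟨n, hn, hs, hk⟩ := hp N
  have hidle : ((C n).procs p).pc = .idle := by
    cases hpc : ((C n).procs p).pc with
    | idle => rfl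
    | start call => exact absurd hpc (hstart n hn call)
    | cas call r a => exact absurd hpc (hcas n hn call r a)
    | reading x w fs => exact absurd hpc (hread n hn x w fs)
  rcases (hs ▸ hE.step n).1.of_idle hidle with ⟨hk', -⟩ | ⟨call, h'⟩
  · exact hk hk'
  · exact hstart (n + 1) (by omega) call h'

end IsExecution

end LazyCow

theorem mainTheorem4 {S : LazyCow.Signature.{u}} (Pr : LazyCow.Program S)
    (hterm : Pr.Terminates) (P : Type v) [Finite P] : LazyCow.LockFree Pr P :=
  ⟨fun _ hC _ hp => hC.wf.exists_step hp, fun _ _ _ hE hinf => hE.completes hterm hinf⟩
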